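/- Let $P\in\mathbb C[x]$ be a monic polynomial of degree $n$, and let $\mathcal A_P$ be the $\mathbb C$-algebra generated by $u,v,z$ with defining relations $$[z,u]=-u,\quad [z,v]=v,\quad vu=P\big(z-\tfrac12\big),\quad uv=P\big(z+\tfrac12\big).$$ For $t\in\mathbb C^\times$ let $g_t$ be the automorphism of $\mathcal A_P$ with $g_t(v)=tv$, $g_t(u)=t^{-1}u$, $g_t(z)=z$. Let $\rho$ be a conjugation of $\mathcal A_P$, i.e. an antilinear ring automorphism with $\rho(v)=\lambda u$, $\rho(u)=\lambda_* v$, $\rho(z)=-z$ for some $\lambda,\lambda_*\in\mathbb C^\times$, and suppose that $\rho^2=g_t$. Then $|t|=1$; write $t=e^{2\pi \mathrm i c}$ with $c\in[0,1)$, and let $\varepsilon\in\{1,-1\}$ be the sign with $\lambda=\varepsilon\,|\lambda|\,\mathrm i^{-n}e^{-\pi \mathrm i c}$ (so $\rho=\rho_+$ if $\varepsilon=1$ and $\rho=\rho_-$ if $\varepsilon=-1$). Let $\mathcal C_+$ be the cone of $\rho$-equivariant positive definite $g_t$-twisted traces on $\mathcal A_P$, i.e. of the linear maps $T:\mathcal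 A_P\to\mathbb C$ such that $T(ab)=T(b\,g_t(a))$ and $T(\rho(a))=\overline{T(a)}$ for all $a,b\in\mathcal A_P$, and $T(a\rho(a))>0$ for all nonzero $a\in\mathcal A_P$. Let $\ell$ be the number of roots $\alpha$ of $P$ with $|\operatorname{Re}\alpha|<\frac12$, counted with multiplicity, and let $r$ be the number of distinct roots $\alpha$ of $P$ with $\operatorname{Re}\alpha=-\frac12$. **Theorem.** The cone $\mathcal C_+$ is isomorphic to $\mathcal C_+^1\times\mathbb R_{\ge0}^r$, that is, there is a bijection between them which respects addition and multiplication by positive real numbers. Here $\mathcal C_+^1$ is the cone of nonzero polynomials $G\in\mathbb R[X]$ such that 1. $G$ has degree less than $\ell$; 2. $G(0)=0$ if $t=1$; 3. $G(X)\ge0$ for $X>0$; 4. for $X<0$: $G(X)\ge0$ if $\varepsilon=1$ (i.e. $\rho=\rho_+$), and $G(X)\le0$ if $\varepsilon=-1$ (i.e. $\rho=\rho_-$). -/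

import Mathlib

open Polynomial
open scoped NNReal

noncomputable section

/-- The three generators `u`, `v`, `z`. -/
inductive QGen : Type
  | u
  | v
  | z

/-- The defining relations of the algebra with parameter `P`:
`[z,u] = -u`, `[z,v] = v`, `vu = P(z - 1/2)`, `uv = P(z + 1/2)`. -/
inductive QRel (P : ℂ[X]) : FreeAlgebra ℂ QGen → FreeAlgebra ℂ QGen → Prop
  | zu : QRel P
      (FreeAlgebra.ι ℂ QGen.z * FreeAlgebra.ι ℂ QGen.u
        - FreeAlgebra.ι ℂ QGen.u * FreeAlgebra.ι ℂ QGen.z)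
      (-FreeAlgebra.ι ℂ QGen.u)
  | zv : QRel P
      (FreeAlgebra.ι ℂ QGen.z * FreeAlgebra.ι ℂ QGen.v
        - FreeAlgebra.ι ℂ QGen.v * FreeAlgebra.ι ℂ QGen.z)
      (FreeAlgebra.ι ℂ QGen.v)
  | vu : QRel P
      (FreeAlgebra.ι ℂ QGen.v * FreeAlgebra.ι ℂ QGen.u)
      (aeval (FreeAlgebra.ι ℂ QGen.z - algebraMap ℂ (FreeAlgebra ℂ QGen) (1 / 2)) P)
  | uv : QRel P
      (FreeAlgebra.ι ℂ QGen.u * FreeAlgebra.ι ℂ QGen.v)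
      (aeval (FreeAlgebra.ι ℂ QGen.z + algebraMap ℂ (FreeAlgebra ℂ QGen) (1 / 2)) P)

/-- The filtered quantization `𝒜_P` of the Kleinian singularity of type `A_{n-1}`, `n = deg P`. -/
abbrev QAlg (P : ℂ[X]) : Type := RingQuot (QRel P)

namespace QAlg

variable (P : ℂ[X])

/-- The image of a generator in `𝒜_P`. -/
def gen (i : QGen) : QAlg P := RingQuot.mkAlgHom ℂ (QRel P) (FreeAlgebra.ι ℂ i)

/-- The generator `u`. -/
def u : QAlg P := gen P QGen.u

/-- The generator `v`. -/
def v : QAlg P := gen P QGen.v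

/-- The generator `z`. -/
def z : QAlg P := gen P QGen.z

theorem z_u : z P * u P - u P * z P = -u P := by
  have h := RingQuot.mkAlgHom_rel ℂ (QRel.zu (P := P))
  simpa [z, u, gen] using h

theorem z_v : z P * v P - v P * z P = v P := by
  have h := RingQuot.mkAlgHom_rel ℂ (QRel.zv (P := P))
  simpa [z, v, gen] using h

theorem v_u : v P * u P = aeval (z P - algebraMap ℂ (QAlg P) (1 / 2)) P := by
  have h := RingQuot.mkAlgHom_rel ℂ (QRel.vu (P := P))
  rw [map_mul, ← aeval_algHom_apply, map_sub, AlgHom.commutes] at h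
  exact h

theorem u_v : u P * v P = aeval (z P + algebraMap ℂ (QAlg P) (1 / 2)) P := by
  have h := RingQuot.mkAlgHom_rel ℂ (QRel.uv (P := P))
  rw [map_mul, ← aeval_algHom_apply, map_add, AlgHom.commutes] at h
  exact h

/-- The values of `g_t` on the generators: `u ↦ t⁻¹ u`, `v ↦ t v`, `z ↦ z`. -/
def gtGen (t : ℂˣ) : QGen → QAlg P
  | QGen.u => ((t⁻¹ : ℂˣ) : ℂ) • u P
  | QGen.v => (t : ℂ) • v P
  | QGen.z => z P

theorem gt_rel (t : ℂˣ) ⦃a b : FreeAlgebra ℂ QGen⦄ (h : QRel P a b) :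
    FreeAlgebra.lift ℂ (gtGen P t) a = FreeAlgebra.lift ℂ (gtGen P t) b := by
  cases h with
  | zu =>
    have h := congrArg (fun a => ((t⁻¹ : ℂˣ) : ℂ) • a) (z_u P)
    simpa [gtGen, smul_sub] using h
  | zv =>
    have h := congrArg (fun a => (t : ℂ) • a) (z_v P)
    simpa [gtGen, smul_sub] using h
  | vu =>
    rw [map_mul, ← aeval_algHom_apply, map_sub, AlgHom.commutes]
    simp only [FreeAlgebra.lift_ι_apply, gtGen, smul_mul_smul_comm, Units.mul_inv, one_smul]
    exact v_u P
  | uv =>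
    rw [map_mul, ← aeval_algHom_apply, map_add, AlgHom.commutes]
    simp only [FreeAlgebra.lift_ι_apply, gtGen, smul_mul_smul_comm, Units.inv_mul, one_smul]
    exact u_v P

/-- The automorphism `g_t` of `𝒜_P`: `g_t(v) = t v`, `g_t(u) = t⁻¹ u`, `g_t(z) = z`. -/
def gt (t : ℂˣ) : QAlg P →ₐ[ℂ] QAlg P :=
  RingQuot.liftAlgHom ℂ ⟨FreeAlgebra.lift ℂ (gtGen P t), gt_rel P t⟩

theorem gt_u (t : ℂˣ) : gt P t (u P) = ((t⁻¹ : ℂˣ) : ℂ) • u P := by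
  simp [gt, u, gen, gtGen]

theorem gt_v (t : ℂˣ) : gt P t (v P) = (t : ℂ) • v P := by
  simp [gt, v, gen, gtGen]

theorem gt_z (t : ℂˣ) : gt P t (z P) = z P := by
  simp [gt, z, gen, gtGen]

/-- A conjugation of `𝒜_P`: an antilinear ring automorphism `ρ` with
`ρ(v) = λ u`, `ρ(u) = λ_* v`, `ρ(z) = -z`, where `λ, λ_* ∈ ℂˣ`. -/
structure Conjugation extends QAlg P ≃+* QAlg P where
  map_smul' : ∀ (a : ℂ) (x : QAlg P), toFun (a • x) = (starRingEnd ℂ a) • toFun x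
  lam : ℂˣ
  lamStar : ℂˣ
  map_v' : toFun (v P) = (lam : ℂ) • u P
  map_u' : toFun (u P) = (lamStar : ℂ) • v P
  map_z' : toFun (z P) = -z P

instance : CoeFun (Conjugation P) (fun _ => QAlg P → QAlg P) := ⟨fun ρ => ρ.toRingEquiv⟩

/-- `T` is a `g_t`-twisted trace: `T(ab) = T(b g_t(a))`. -/
def IsTwistedTrace (t : ℂˣ) (T : QAlg P →ₗ[ℂ] ℂ) : Prop :=
  ∀ a b : QAlg P, T (a * b) = T (b * gt P t a)

variable {P}

/-- `T` is `ρ`-equivariant: `T(ρ(a))` is the complex conjugate of `T(a)`. -/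
def IsEquivariant (ρ : Conjugation P) (T : QAlg P →ₗ[ℂ] ℂ) : Prop :=
  ∀ a : QAlg P, T (ρ a) = (starRingEnd ℂ) (T a)

/-- `T` is positive definite: `T(a ρ(a))` is real and `> 0` for all nonzero `a`, that is,
the form `(a, b) = T(a ρ(b))` is positive definite. -/
def IsPositiveDefinite (ρ : Conjugation P) (T : QAlg P →ₗ[ℂ] ℂ) : Prop :=
  ∀ a : QAlg P, a ≠ 0 → (T (a * ρ a)).im = 0 ∧ 0 < (T (a * ρ a)).re

/-- The cone of `ρ`-equivariant positive definite `g_t`-twisted traces on `𝒜_P`. -/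
def positiveTraceCone (ρ : Conjugation P) (t : ℂˣ) : ConvexCone ℝ (QAlg P →ₗ[ℂ] ℂ) where
  carrier := {T | IsTwistedTrace P t T ∧ IsEquivariant ρ T ∧ IsPositiveDefinite ρ T}
  smul_mem' := by
    rintro c hc T ⟨h1, h2, h3⟩
    refine ⟨fun a b => ?_, fun a => ?_, fun a ha => ?_⟩
    · simp only [LinearMap.smul_apply, h1 a b]
    · simp only [LinearMap.smul_apply, h2 a, Complex.real_smul, map_mul, Complex.conj_ofReal]
    · have h := h3 a ha
      simp only [LinearMap.smul_apply, Complex.smul_im, Complex.smul_re, smul_eq_mul]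
      exact ⟨by rw [h.1, mul_zero], mul_pos hc h.2⟩
  add_mem' := by
    rintro T ⟨h1, h2, h3⟩ S ⟨k1, k2, k3⟩
    refine ⟨fun a b => ?_, fun a => ?_, fun a ha => ?_⟩
    · simp only [LinearMap.add_apply, h1 a b, k1 a b]
    · simp only [LinearMap.add_apply, h2 a, k2 a, map_add]
    · have h := h3 a ha
      have k := k3 a ha
      simp only [LinearMap.add_apply, Complex.add_im, Complex.add_re]
      exact ⟨by rw [h.1, k.1, add_zero], add_pos h.2 k.2⟩

end QAlg

/-- The cone of nonzero real polynomials `G` of degree `< ℓ`, with `G(0) = 0` if `t = 1`, such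
that `G ≥ 0` on `X > 0` and `ε G ≥ 0` on `X < 0`. -/
def polynomialCone (ℓ : ℕ) (t : ℂˣ) (ε : ℤˣ) : ConvexCone ℝ ℝ[X] where
  carrier := {G | G ≠ 0 ∧ G.degree < (ℓ : WithBot ℕ) ∧ (t = 1 → G.eval 0 = 0) ∧
    (∀ x : ℝ, 0 < x → 0 ≤ G.eval x) ∧ (∀ x : ℝ, x < 0 → 0 ≤ ((ε : ℤ) : ℝ) * G.eval x)}
  smul_mem' := by
    rintro c hc G ⟨h0, h1, h2, h3, h4⟩
    refine ⟨smul_ne_zero hc.ne' h0, lt_of_le_of_lt (degree_smul_le c G) h1, fun ht => ?_,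
      fun x hx => ?_, fun x hx => ?_⟩
    · rw [eval_smul, h2 ht, smul_zero]
    · rw [eval_smul, smul_eq_mul]
      exact mul_nonneg hc.le (h3 x hx)
    · rw [eval_smul, smul_eq_mul, mul_left_comm]
      exact mul_nonneg hc.le (h4 x hx)
  add_mem' := by
    rintro G ⟨h0, h1, h2, h3, h4⟩ H ⟨_, k1, k2, k3, k4⟩
    refine ⟨fun h => h0 ?_, lt_of_le_of_lt (degree_add_le G H) (max_lt h1 k1), fun ht => ?_,
      fun x hx => ?_, fun x hx => ?_⟩
    · refine eq_zero_of_infinite_isRoot G ((Set.Ioi_infinite (0 : ℝ)).mono fun x hx => ?_)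
      have e : G.eval x + H.eval x = 0 := by rw [← eval_add, h, eval_zero]
      have a := h3 x hx
      have b := k3 x hx
      show G.eval x = 0
      linarith
    · rw [eval_add, h2 ht, k2 ht, add_zero]
    · rw [eval_add]
      exact add_nonneg (h3 x hx) (k3 x hx)
    · rw [eval_add, mul_add]
      exact add_nonneg (h4 x hx) (k4 x hx)

/-- The number of roots `α` of `P` with `|Re α| < 1/2`, counted with multiplicity. -/
def openStripRootCount (P : ℂ[X]) : ℕ := (P.roots.filter fun α => |α.re| < 1 / 2).card

/-- The number of distinct roots `α` of `P` with `Re α = -1/2`. -/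
def boundaryRootCount (P : ℂ[X]) : ℕ := {α : ℂ | P.IsRoot α ∧ α.re = -1 / 2}.ncard

end

/-!
A `g_t`-twisted trace `T` vanishes on the nonzero weight spaces of `ad z`, so it is determined by the
functional `τ(R) = T(R(z))` on `ℂ[X]`. In these terms `T` is a twisted trace if and only if
`τ(S(x - 1/2) P(x - 1/2)) = t τ(S(x + 1/2) P(x + 1/2))` for all `S` (`IsTwisted`). Since
`a ↦ ρ(a)` exchanges opposite weights and `T(v b v ρ(v b v)) = T(b p ρ(b p))` with `p = v ρ(v)` a
polynomial in `z`, positivity of `T` only has to be checked in weights `0` and `1`, where it says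
(`QAlg.IsPositivePair`) that `τ(R R*)` and `λ τ(R(x - 1/2) R*(x - 1/2) P(x - 1/2))` are positive for
`R ≠ 0`; here `R*` is the polynomial whose values on the imaginary axis are conjugate to those of `R`.
Equivariance is then automatic.

*From polynomials to traces.* For a numerator `G`, let
`W(x) = e^{2πic(x+1/2)} G(-e^{2πix}) / ∏ (e^{2πiα} - e^{2πix})`, the product being over the roots `α`
in the open strip `|Re α| < 1/2`. It satisfies `W(x + 1) = t W(x)`, decays exponentially at `±i∞`
thanks to the bounds on `G`, and `W P` is regular in the closed strip `|Re x| ≤ 1/2`. By Cauchy's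
theorem (`integral_vertical_line_eq`) the functional `τ(R) = ∫ R(iy) W(iy - 1/2) dy` is twisted, and
`λ τ(R(x - 1/2) R*(x - 1/2) P(x - 1/2))` is the integral of `|R(iy)|²` against `λ P(iy) W(iy)`. The
roots are symmetric under `α ↦ -conj α`, because `P*` is proportional to `P`; this makes `W(iy - 1/2)`
a positive multiple of `G(e^{-2πy})` and `λ P(iy) W(iy)` a positive multiple of `ε G(-e^{-2πy})`. A
boundary root `α`, `Re α = -1/2`, contributes the point mass `R ↦ R(α + 1/2)`, which is twisted as both
`α` and `α + 1` are roots of `P`, and which does not enter the second positivity condition.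

*From traces to polynomials.* If `T` is positive, then `τ` is nonnegative on squares, and Hamburger's
theorem (`IsNonnegOnSquares.exists_measure`) gives a positive measure `μ` with
`τ(R) = ∫ R(iy) dμ(y)`. Twistedness bounds the moments by `B Mᵏ k!` (`IsTwisted.moment_growth`), so
that `μ` has exponential tails. After removal of its masses at the boundary points, `μ` is twisted even
for the product of `X - α` over the roots in the open strip: the defect for a root `α` in the
complement, transformed in the variable `s`, would be a multiple of `e^{αs}`, which grows too fast
(`IsTwisted.of_mul_X_sub_C`). A count of dimensions (`IsTwisted.eq_zero_of_low_degree`) shows that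
functionals with this property come from numerators `G`
(`IsTwisted.exists_weightFunctional_eq`). Finally an exponentially decaying continuous density is
determined by its moments, and is nonnegative if it is so in mean against all squares
(`nonneg_of_isNonnegOnSquares`); this gives the signs of `G`, and also injectivity.
-/

noncomputable section

/-! ### The Hamburger moment problem -/

open MeasureTheory Filter Topology CompactlySupported in
/-- The pairs `(p, g)` of a polynomial and a compactly supported function with `p + g ≥ 0`. -/
def polyCcCone : PointedCone ℝ (ℝ[X] × C_c(ℝ, ℝ)) where
  carrier := {x | ∀ y : ℝ, 0 ≤ x.1.eval y + x.2 y}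
  zero_mem' := by intro y; simp
  add_mem' := by
    intro a b ha hb y
    have h1 := ha y
    have h2 := hb y
    simp only [Prod.fst_add, Prod.snd_add, eval_add, CompactlySupportedContinuousMap.add_apply]
    linarith
  smul_mem' := by
    rintro ⟨c, hc⟩ x hx y
    have h1 := hx y
    have e : (((⟨c, hc⟩ : {c : ℝ // 0 ≤ c}) • x).1.eval y + ((⟨c, hc⟩ : {c : ℝ // 0 ≤ c}) • x).2 y)
        = c * (x.1.eval y + x.2 y) := by
      change ((c • x.1).eval y + (c • x.2) y) = _
      simp [mul_add]
    rw [e]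
    exact mul_nonneg hc h1

/-- The cutoff equal to `1` on `[-N, N]` and to `0` off `[-N-1, N+1]`. -/
def cutoff (N : ℕ) (y : ℝ) : ℝ := max 0 (min 1 (N + 1 - |y|))

theorem continuous_cutoff (N : ℕ) : Continuous (cutoff N) := by
  unfold cutoff; fun_prop

theorem cutoff_nonneg (N : ℕ) (y : ℝ) : 0 ≤ cutoff N y := le_max_left _ _

theorem cutoff_le_one (N : ℕ) (y : ℝ) : cutoff N y ≤ 1 :=
  max_le zero_le_one (min_le_left _ _)

theorem cutoff_eq_one {N : ℕ} {y : ℝ} (h : |y| ≤ N) : cutoff N y = 1 := by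
  unfold cutoff
  rw [min_eq_left (by linarith), max_eq_right zero_le_one]

theorem hasCompactSupport_mul_cutoff (f : ℝ → ℝ) (N : ℕ) :
    HasCompactSupport fun y => f y * cutoff N y := by
  refine HasCompactSupport.intro (isCompact_Icc (a := -((N : ℝ) + 1)) (b := N + 1)) fun y hy => ?_
  have : (N : ℝ) + 1 < |y| := by
    by_contra! h
    exact hy (abs_le.mp h)
  have h0 : cutoff N y = 0 := by
    unfold cutoff
    exact max_eq_left ((min_le_right _ _).trans (by linarith))
  simp [h0]

/-- The truncation of a polynomial by a cutoff. -/
def truncPoly (q : ℝ[X]) (N : ℕ) : CompactlySupportedContinuousMap ℝ ℝ :=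
  ⟨⟨fun y => q.eval y * cutoff N y, q.continuous.mul (continuous_cutoff N)⟩,
    hasCompactSupport_mul_cutoff _ N⟩

theorem truncPoly_apply (q : ℝ[X]) (N : ℕ) (y : ℝ) : truncPoly q N y = q.eval y * cutoff N y := rfl

theorem abs_sub_truncPoly_le (q : ℝ[X]) {N : ℕ} (hN : 0 < N) (y : ℝ) :
    |q.eval y - truncPoly q N y| ≤ (((N : ℝ) ^ 2)⁻¹ • ((1 + q ^ 2) * X ^ 2)).eval y := by
  have hN' : (0 : ℝ) < N := by exact_mod_cast hN
  rw [truncPoly_apply, eval_smul]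
  simp only [eval_mul, eval_add, eval_one, eval_pow, eval_X, smul_eq_mul]
  have hq : |q.eval y| ≤ 1 + q.eval y ^ 2 := by
    rw [← sq_abs]; nlinarith [sq_nonneg (|q.eval y| - 1), abs_nonneg (q.eval y)]
  by_cases h : |y| ≤ N
  · rw [cutoff_eq_one h]; simp only [mul_one, sub_self, abs_zero]; positivity
  · push Not at h
    have h1 : (1 : ℝ) ≤ ((N : ℝ) ^ 2)⁻¹ * y ^ 2 := by
      rw [← sq_abs y, inv_mul_eq_div, one_le_div (by positivity)]
      gcongr
    have h2 : |q.eval y - q.eval y * cutoff N y| ≤ |q.eval y| := by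
      rw [← mul_one_sub, abs_mul]
      refine mul_le_of_le_one_right (abs_nonneg _) ?_
      rw [abs_le]; constructor <;> linarith [cutoff_nonneg N y, cutoff_le_one N y]
    calc _ ≤ 1 + q.eval y ^ 2 := h2.trans hq
      _ ≤ (1 + q.eval y ^ 2) * (((N : ℝ) ^ 2)⁻¹ * y ^ 2) :=
        le_mul_of_one_le_right (by positivity) h1
      _ = _ := by ring

open MeasureTheory Filter Topology CompactlySupported in
/-- **Hamburger's theorem**: a linear functional that is nonnegative on the nonnegative real
polynomials is given by a measure. The functional is extended to compactly supported functions
by M. Riesz's extension theorem, and represented there by a measure. -/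
theorem exists_measure_of_nonneg_poly (L : ℝ[X] →ₗ[ℝ] ℝ)
    (hL : ∀ f : ℝ[X], (∀ y, 0 ≤ f.eval y) → 0 ≤ L f) :
    ∃ μ : Measure ℝ, ∀ f : ℝ[X], Integrable (fun y => f.eval y) μ ∧ ∫ y, f.eval y ∂μ = L f := by
  obtain ⟨Φ, hΦL, hΦ⟩ := riesz_extension polyCcCone
    ((L ∘ₗ LinearMap.fst ℝ ℝ[X] C_c(ℝ, ℝ)).toPMap (Submodule.prod ⊤ ⊥))
    (by
      rintro ⟨⟨p, g⟩, hg⟩ hx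
      have hg0 : g = 0 := by simpa using hg
      subst hg0
      refine hL p fun y => ?_
      simpa using hx y)
    (by
      rintro ⟨p, g⟩
      obtain ⟨C, hC⟩ := g.hasCompactSupport.exists_bound_of_continuous g.continuous
      refine ⟨⟨(-p + Polynomial.C C, 0), by simp⟩, fun y => ?_⟩
      have := (abs_le.mp (hC y)).1
      simp only [Prod.mk_add_mk, zero_add]
      simp only [eval_add, eval_neg, eval_C]
      linarith)
  have hΦp : ∀ p : ℝ[X], Φ (p, 0) = L p := fun p => hΦL ⟨(p, 0), by simp⟩
  have hle : ∀ (p : ℝ[X]) (g : C_c(ℝ, ℝ)), (∀ y, g y ≤ p.eval y) → Φ (0, g) ≤ L p := by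
    intro p g h
    have h1 : 0 ≤ Φ (p, -g) := hΦ _ fun y => by
      simp only [CompactlySupportedContinuousMap.neg_apply]; linarith [h y]
    have h2 : ((p, -g) : ℝ[X] × C_c(ℝ, ℝ)) = (p, 0) - (0, g) := by simp
    rw [h2, map_sub, hΦp] at h1
    linarith
  let Λ : C_c(ℝ, ℝ) →ₚ[ℝ] ℝ := PositiveLinearMap.mk₀ (Φ ∘ₗ LinearMap.inr ℝ ℝ[X] C_c(ℝ, ℝ))
    (by
      intro g hg
      refine hΦ _ fun y => ?_
      simpa using hg y)
  have hΛ : ∀ g, Λ g = Φ (0, g) := fun g => rfl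
  set μ := RealRMK.rieszMeasure Λ with hμ
  have hint : ∀ g : C_c(ℝ, ℝ), ∫ y, g y ∂μ = Φ (0, g) := fun g => by
    rw [hμ, RealRMK.integral_rieszMeasure, hΛ]
  have hgint : ∀ g : C_c(ℝ, ℝ), Integrable g μ := fun g =>
    g.continuous.integrable_of_hasCompactSupport g.hasCompactSupport
  have htr : ∀ y : ℝ, ∀ q : ℝ[X], Tendsto (fun N => truncPoly q N y) atTop (𝓝 (q.eval y)) := by
    intro y q
    refine tendsto_const_nhds.congr' ?_
    filter_upwards [eventually_ge_atTop ⌈|y|⌉₊] with N hN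
    rw [truncPoly_apply, cutoff_eq_one (Nat.ceil_le.mp hN), mul_one]
  have hlim : ∀ q : ℝ[X], Tendsto (fun N => ∫ y, truncPoly q N y ∂μ) atTop (𝓝 (L q)) := by
    intro q
    rw [tendsto_iff_dist_tendsto_zero]
    have hz : Tendsto (fun N : ℕ => ((N : ℝ) ^ 2)⁻¹ * L ((1 + q ^ 2) * X ^ 2)) atTop (𝓝 0) := by
      have : Tendsto (fun N : ℕ => ((N : ℝ) ^ 2)⁻¹) atTop (𝓝 0) :=
        ((tendsto_pow_atTop two_ne_zero).comp tendsto_natCast_atTop_atTop).inv_tendsto_atTop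
      simpa using this.mul_const (L ((1 + q ^ 2) * X ^ 2))
    refine squeeze_zero' (Eventually.of_forall fun _ => dist_nonneg) ?_ hz
    filter_upwards [eventually_gt_atTop 0] with N hN
    rw [Real.dist_eq, hint, ← smul_eq_mul, ← map_smul, abs_le]
    have hb := abs_sub_truncPoly_le q hN
    constructor
    · have h1 : 0 ≤ Φ (((N : ℝ) ^ 2)⁻¹ • ((1 + q ^ 2) * X ^ 2) - q, truncPoly q N) :=
        hΦ _ fun y => by
          have := (abs_le.mp (hb y)).2
          simp only [eval_sub]
          linarith
      have h2 : ((((N : ℝ) ^ 2)⁻¹ • ((1 + q ^ 2) * X ^ 2) - q, truncPoly q N) :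
          ℝ[X] × C_c(ℝ, ℝ)) = (((N : ℝ) ^ 2)⁻¹ • ((1 + q ^ 2) * X ^ 2) - q, 0)
            + (0, truncPoly q N) := by simp
      rw [h2, map_add, hΦp, map_sub] at h1
      linarith
    · have h1 := hle (((N : ℝ) ^ 2)⁻¹ • ((1 + q ^ 2) * X ^ 2) + q) (truncPoly q N) fun y => by
        have := (abs_le.mp (hb y)).1
        simp only [eval_add]
        linarith
      rw [map_add] at h1
      linarith
  have hsq : ∀ q : ℝ[X], Integrable (fun y => (1 + q ^ 2).eval y) μ := by
    intro q
    have hnn : ∀ y, 0 ≤ (1 + q ^ 2).eval y := fun y => by simp; positivity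
    refine ⟨(Polynomial.continuous _).aestronglyMeasurable, ?_⟩
    rw [hasFiniteIntegral_iff_ofReal (Eventually.of_forall hnn)]
    have hF := lintegral_liminf_le (μ := μ) (u := atTop)
      (f := fun N y => ENNReal.ofReal (truncPoly (1 + q ^ 2) N y))
      (fun N => (truncPoly (1 + q ^ 2) N).continuous.measurable.ennreal_ofReal)
    have e1 : ∀ y, liminf (fun N => ENNReal.ofReal (truncPoly (1 + q ^ 2) N y)) atTop
        = ENNReal.ofReal ((1 + q ^ 2).eval y) := fun y =>
      (ENNReal.tendsto_ofReal (htr y _)).liminf_eq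
    simp only [e1] at hF
    refine lt_of_le_of_lt (hF.trans ?_) (ENNReal.ofReal_lt_top (r := L (1 + q ^ 2)))
    refine (liminf_le_liminf (v := fun _ => ENNReal.ofReal (L (1 + q ^ 2)))
      (Eventually.of_forall fun N => ?_)).trans (by simp)
    have hnn' : ∀ y, 0 ≤ truncPoly (1 + q ^ 2) N y := fun y =>
      mul_nonneg (hnn y) (cutoff_nonneg N y)
    rw [← ofReal_integral_eq_lintegral_ofReal (hgint _) (Eventually.of_forall hnn'), hint]
    refine ENNReal.ofReal_le_ofReal (hle _ _ fun y => ?_)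
    exact mul_le_of_le_one_right (hnn y) (cutoff_le_one N y)
  have hbd : ∀ (q : ℝ[X]) (y : ℝ), ‖q.eval y‖ ≤ (1 + q ^ 2).eval y := by
    intro q y
    simp only [eval_add, eval_one, eval_pow, Real.norm_eq_abs]
    rw [← sq_abs]; nlinarith [sq_nonneg (|q.eval y| - 1), abs_nonneg (q.eval y)]
  refine ⟨μ, fun q => ⟨?_, ?_⟩⟩
  · exact (hsq q).mono' q.continuous.aestronglyMeasurable (Eventually.of_forall (hbd q))
  · refine tendsto_nhds_unique ?_ (hlim q)
    refine tendsto_integral_of_dominated_convergence (fun y => (1 + q ^ 2).eval y)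
      (fun N => (truncPoly q N).continuous.aestronglyMeasurable) (hsq q)
      (fun N => Eventually.of_forall fun y => ?_) (Eventually.of_forall fun y => htr y q)
    rw [truncPoly_apply, norm_mul]
    refine (mul_le_of_le_one_right (norm_nonneg _) ?_).trans (hbd q y)
    rw [Real.norm_eq_abs, abs_of_nonneg (cutoff_nonneg N y)]
    exact cutoff_le_one N y

/-- A nonnegative real polynomial is the squared absolute value of a complex polynomial. -/
theorem exists_normSq_of_nonneg (f : ℝ[X]) (hf : ∀ y, 0 ≤ f.eval y) :
    ∃ R : ℂ[X], f.map Complex.ofRealHom = R * R.map (starRingEnd ℂ) := by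
  induction hn : f.natDegree using Nat.strong_induction_on generalizing f with
  | _ n ih =>
    subst hn
    -- a nonnegative square factor `d` with `d = e * conj e` can be split off
    have key : ∀ (d g : ℝ[X]) (e : ℂ[X]), d.map Complex.ofRealHom = e * e.map (starRingEnd ℂ) →
        0 < d.natDegree → f = d * g → f ≠ 0 →
        ∃ R : ℂ[X], f.map Complex.ofRealHom = R * R.map (starRingEnd ℂ) := by
      intro d g e hd hdeg hfg hf0
      have hd0 : d ≠ 0 := by rintro rfl; simp at hdeg
      have hg0 : g ≠ 0 := by rintro rfl; simp at hfg; exact hf0 hfg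
      have hdn : ∀ y : ℝ, 0 ≤ d.eval y := by
        intro y
        have h1 := congrArg (fun q => (q.eval (y : ℂ)).re) hd
        simp only [eval_mul] at h1
        have h2 : (e.map (starRingEnd ℂ)).eval (y : ℂ) = (starRingEnd ℂ) (e.eval (y : ℂ)) := by
          rw [← Polynomial.eval_map_apply]; simp
        have h3 : ((d.map Complex.ofRealHom).eval (y : ℂ)) = ((d.eval y : ℝ) : ℂ) := by
          simpa using Polynomial.eval_map_apply (f := Complex.ofRealHom) (p := d) y
        rw [h2, h3, Complex.mul_conj, Complex.ofReal_re, Complex.ofReal_re] at h1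
        rw [h1]; exact Complex.normSq_nonneg _
      have hg : ∀ y : ℝ, 0 ≤ g.eval y := by
        -- `g ≥ 0` off the finitely many zeros of `d`, hence everywhere by continuity
        have hdense : Dense {y : ℝ | d.eval y ≠ 0} := by
          have : {y : ℝ | d.eval y ≠ 0} = ((d.roots.toFinset : Set ℝ))ᶜ := by
            ext y; simp [hd0]
          rw [this]
          exact (Finset.countable_toSet _).dense_compl ℝ
        intro y
        have hcl : IsClosed {y : ℝ | 0 ≤ g.eval y} := isClosed_le continuous_const g.continuous
        refine hcl.closure_subset_iff.mpr (fun z hz => ?_) (hdense y)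
        have h1 := hf z
        rw [hfg, eval_mul] at h1
        exact nonneg_of_mul_nonneg_right h1 (lt_of_le_of_ne (hdn z) (Ne.symm hz))
      have hlt : g.natDegree < f.natDegree := by
        rw [hfg, natDegree_mul hd0 hg0]; omega
      obtain ⟨R, hR⟩ := ih _ hlt g hg rfl
      refine ⟨e * R, ?_⟩
      rw [hfg, Polynomial.map_mul, hd, hR, Polynomial.map_mul]; ring
    by_cases h0 : f.natDegree = 0
    · obtain ⟨a, rfl⟩ := natDegree_eq_zero.mp h0
      have ha : 0 ≤ a := by simpa using hf 0
      refine ⟨C ((Real.sqrt a : ℝ) : ℂ), ?_⟩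
      simp only [map_C, Complex.conj_ofReal, ← C_mul, ← Complex.ofReal_mul, Real.mul_self_sqrt ha]
      simp
    have hf0 : f ≠ 0 := by rintro rfl; simp at h0
    have hdeg : (f.map Complex.ofRealHom).degree ≠ 0 := by
      rw [degree_map]; intro h; exact h0 (natDegree_eq_of_degree_eq_some h)
    obtain ⟨w, hw⟩ := IsAlgClosed.exists_root _ hdeg
    have hw' : aeval w f = 0 := by
      rw [IsRoot.def, eval_map] at hw; exact hw
    by_cases him : w.im = 0
    · obtain ⟨r, rfl⟩ : ∃ r : ℝ, w = r := ⟨w.re, Complex.ext rfl (by simpa using him)⟩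
      have hr : f.IsRoot r := by
        have : ((f.eval r : ℝ) : ℂ) = 0 := by
          rw [← hw']; exact (eval₂_at_apply Complex.ofRealHom r).symm
        simpa using this
      obtain ⟨g, hg⟩ := dvd_iff_isRoot.mpr hr
      have hg0 : g ≠ 0 := by rintro rfl; simp at hg; exact hf0 hg
      have hgr : g.IsRoot r := by
        -- otherwise `f = (X - r) g` changes sign at `r`
        by_contra hne
        have hcont : Filter.Tendsto (fun y => g.eval y) (nhds r) (nhds (g.eval r)) :=
          g.continuous.tendsto r
        have hval : ∀ y, f.eval y = (y - r) * g.eval y := fun y => by rw [hg]; simp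
        rcases lt_or_gt_of_ne hne with hlt | hgt
        · obtain ⟨ε, hε, hb⟩ := Metric.eventually_nhds_iff.mp (hcont.eventually_lt_const hlt)
          have h1 := hb (y := r + ε / 2) (by simp [abs_of_pos hε]; linarith)
          have h2 := hf (r + ε / 2)
          rw [hval] at h2
          nlinarith
        · obtain ⟨ε, hε, hb⟩ := Metric.eventually_nhds_iff.mp (hcont.eventually_const_lt hgt)
          have h1 := hb (y := r - ε / 2) (by simp [abs_of_pos hε]; linarith)
          have h2 := hf (r - ε / 2)
          rw [hval] at h2
          nlinarith
      obtain ⟨g', hg'⟩ := dvd_iff_isRoot.mpr hgr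
      refine key ((X - C r) * (X - C r)) g' (X - C (r : ℂ)) ?_ ?_ ?_ hf0
      · simp [Polynomial.map_mul]
      · rw [natDegree_mul (X_sub_C_ne_zero r) (X_sub_C_ne_zero r)]; simp
      · rw [hg, hg', mul_assoc]
    · obtain ⟨g, hg⟩ := f.quadratic_dvd_of_aeval_eq_zero_im_ne_zero hw' him
      refine key (X ^ 2 - C (2 * w.re) * X + C (‖w‖ ^ 2)) g (X - C w) ?_ ?_ hg hf0
      · have e1 : (2 * w.re : ℂ) = w + (starRingEnd ℂ) w := by
          rw [Complex.add_conj]; push_cast; ring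
        have e2 : ((‖w‖ : ℂ) ^ 2) = w * (starRingEnd ℂ) w := by
          rw [Complex.mul_conj, Complex.normSq_eq_norm_sq]; push_cast; ring
        simp only [Polynomial.map_add, Polynomial.map_sub, Polynomial.map_mul, Polynomial.map_pow,
          map_X, map_C, Complex.ofRealHom_eq_coe]
        push_cast
        rw [e1, e2]
        simp only [C_add, C_mul]
        ring
      · have : (X ^ 2 - C (2 * w.re) * X + C (‖w‖ ^ 2)).natDegree = 2 := by compute_degree!
        omega

/-! ### Polynomials on the imaginary axis -/

/-- The antilinear involution `R(x) ↦ conj R(-conj x)` of `ℂ[X]`, which on the imaginary axis is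
complex conjugation of the values. -/
def conjRefl : ℂ[X] →+* ℂ[X] := (compRingHom (-X)).comp (mapRingHom (starRingEnd ℂ))

theorem conjRefl_apply (R : ℂ[X]) : conjRefl R = (R.map (starRingEnd ℂ)).comp (-X) := rfl

theorem eval_conjRefl (R : ℂ[X]) (x : ℂ) :
    (conjRefl R).eval x = starRingEnd ℂ (R.eval (-starRingEnd ℂ x)) := by
  rw [conjRefl_apply, eval_comp, ← Polynomial.eval_map_apply]
  simp

theorem eval_conjRefl_mul_I (R : ℂ[X]) (y : ℝ) :
    (conjRefl R).eval (y * Complex.I) = starRingEnd ℂ (R.eval (y * Complex.I)) := by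
  rw [eval_conjRefl]; simp

@[simp] theorem conjRefl_C (a : ℂ) : conjRefl (C a) = C (starRingEnd ℂ a) := by
  simp [conjRefl_apply]

@[simp] theorem conjRefl_X : conjRefl X = -X := by simp [conjRefl_apply]

@[simp] theorem conjRefl_conjRefl (R : ℂ[X]) : conjRefl (conjRefl R) = R := by
  refine Polynomial.funext fun x => ?_
  simp [eval_conjRefl]

theorem conjRefl_ne_zero {R : ℂ[X]} (h : R ≠ 0) : conjRefl R ≠ 0 := fun h0 =>
  h (by rw [← conjRefl_conjRefl R, h0, map_zero])

/-- The real polynomial `f(y)` as a polynomial in `x = i y`. -/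
def ofImag (f : ℝ[X]) : ℂ[X] := (f.map Complex.ofRealHom).comp (C (-Complex.I) * X)

theorem eval_ofImag (f : ℝ[X]) (y : ℝ) : (ofImag f).eval (y * Complex.I) = (f.eval y : ℝ) := by
  have : (-Complex.I * (y * Complex.I)) = (y : ℂ) := by
    linear_combination -(y : ℂ) * Complex.I_mul_I
  rw [ofImag, eval_comp, eval_mul, eval_C, eval_X, this]
  exact Polynomial.eval_map_apply (f := Complex.ofRealHom) (p := f) y

theorem funext_mul_I {R Q : ℂ[X]} (h : ∀ y : ℝ, R.eval (y * Complex.I) = Q.eval (y * Complex.I)) :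
    R = Q := by
  refine Polynomial.eq_of_infinite_eval_eq R Q ?_
  refine Set.Infinite.mono (s := Set.range fun y : ℝ => (y : ℂ) * Complex.I) ?_
    (Set.infinite_range_of_injective fun a b hab => ?_)
  · rintro _ ⟨y, rfl⟩; exact h y
  · simpa using hab

theorem conjRefl_ofImag (f : ℝ[X]) : conjRefl (ofImag f) = ofImag f := by
  refine funext_mul_I fun y => ?_
  rw [eval_conjRefl_mul_I, eval_ofImag, Complex.conj_ofReal]

theorem ofImag_eq_mul_conjRefl_of_nonneg {f : ℝ[X]} (hf : ∀ y, 0 ≤ f.eval y) :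
    ∃ R : ℂ[X], ofImag f = R * conjRefl R := by
  obtain ⟨R, hR⟩ := exists_normSq_of_nonneg f hf
  refine ⟨R.comp (C (-Complex.I) * X), ?_⟩
  rw [ofImag, hR, mul_comp, conjRefl_apply, map_comp, comp_assoc]
  congr 2
  simp

/-- `τ` takes nonnegative real values on the polynomials `|R|²`, `R ∈ ℂ[X]`, on the imaginary
axis. -/
def IsNonnegOnSquares (τ : ℂ[X] →ₗ[ℂ] ℂ) : Prop :=
  ∀ R : ℂ[X], (τ (R * conjRefl R)).im = 0 ∧ 0 ≤ (τ (R * conjRefl R)).re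

/-- Polarization: positivity on squares makes `τ` real. -/
theorem IsNonnegOnSquares.map_conjRefl {τ : ℂ[X] →ₗ[ℂ] ℂ} (h : IsNonnegOnSquares τ) (R : ℂ[X]) :
    τ (conjRefl R) = starRingEnd ℂ (τ R) := by
  have h1 := (h (1 + R)).1
  have h2 := (h (1 + C Complex.I * R)).1
  have h3 := (h R).1
  have h4 := (h 1).1
  rw [one_mul] at h4
  have e1 : (1 + R) * conjRefl (1 + R) = conjRefl 1 + R + conjRefl R + R * conjRefl R := by
    simp only [map_add, map_one]; ring
  have e2 : (1 + C Complex.I * R) * conjRefl (1 + C Complex.I * R)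
      = conjRefl 1 + Complex.I • R - Complex.I • conjRefl R + R * conjRefl R := by
    simp only [map_add, map_one, map_mul, conjRefl_C, Complex.conj_I, smul_eq_C_mul, C_neg]
    have : (C Complex.I : ℂ[X]) * C Complex.I = -1 := by rw [← C_mul]; simp
    linear_combination -(R * conjRefl R) * this
  rw [e1] at h1
  rw [e2] at h2
  simp only [map_add, map_sub, map_smul, Complex.add_im, Complex.sub_im, smul_eq_mul,
    Complex.mul_im, Complex.I_re, Complex.I_im, zero_mul, one_mul, zero_add] at h1 h2
  apply Complex.ext
  · rw [Complex.conj_re]; linarith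
  · rw [Complex.conj_im]; linarith

open MeasureTheory in
/-- A functional on `ℂ[X]` that is nonnegative on squares is integration over the imaginary axis
against a measure. -/
theorem IsNonnegOnSquares.exists_measure {τ : ℂ[X] →ₗ[ℂ] ℂ} (h : IsNonnegOnSquares τ) :
    ∃ μ : Measure ℝ, ∀ R : ℂ[X], Integrable (fun y : ℝ => R.eval (y * Complex.I)) μ ∧
      ∫ y, R.eval (y * Complex.I) ∂μ = τ R := by
  let L : ℝ[X] →ₗ[ℝ] ℝ :=
    { toFun := fun f => (τ (ofImag f)).re
      map_add' := fun f g => by simp [ofImag]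
      map_smul' := fun a f => by
        have : ofImag (a • f) = (a : ℂ) • ofImag f := by
          simp [ofImag, smul_eq_C_mul]
        rw [this, map_smul]; simp }
  obtain ⟨μ, hμ⟩ := exists_measure_of_nonneg_poly L fun f hf => by
    obtain ⟨R, hR⟩ := ofImag_eq_mul_conjRefl_of_nonneg hf
    change 0 ≤ (τ (ofImag f)).re
    rw [hR]; exact (h R).2
  have key : ∀ f : ℝ[X], Integrable (fun y : ℝ => (ofImag f).eval (y * Complex.I)) μ ∧
      ∫ y, (ofImag f).eval (y * Complex.I) ∂μ = τ (ofImag f) := by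
    intro f
    have e : τ (ofImag f) = ((L f : ℝ) : ℂ) := by
      refine Complex.ext rfl ?_
      have := congrArg Complex.im (h.map_conjRefl (ofImag f))
      rw [conjRefl_ofImag, Complex.conj_im] at this
      rw [Complex.ofReal_im]; linarith
    simp only [eval_ofImag]
    refine ⟨(hμ f).1.ofReal, ?_⟩
    rw [integral_complex_ofReal, (hμ f).2, e]
  refine ⟨μ, fun R => ?_⟩
  induction R using Polynomial.induction_on' with
  | add p q hp hq =>
    simp only [eval_add, map_add]
    exact ⟨hp.1.add hq.1, by rw [integral_add hp.1 hq.1, hp.2, hq.2]⟩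
  | monomial n a =>
    have e : monomial n a = (a * Complex.I ^ n) • ofImag (X ^ n) := by
      simp only [ofImag, Polynomial.map_pow, map_X, X_pow_comp, mul_pow, ← C_pow]
      rw [smul_eq_C_mul, ← mul_assoc, ← C_mul, ← C_mul_X_pow_eq_monomial, mul_assoc, ← mul_pow]
      simp
    rw [e]
    simp only [eval_smul, map_smul, smul_eq_mul]
    exact ⟨(key _).1.const_mul _, by rw [integral_const_mul, (key _).2]⟩

/-! ### Exponential tails and analytic continuation -/

theorem pow_le_factorial_mul_exp {u ε : ℝ} (hu : 0 ≤ u) (hε : 0 < ε) (n : ℕ) :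
    u ^ n ≤ (n.factorial / ε ^ n) * Real.exp (ε * u) := by
  have h := Real.pow_div_factorial_le_exp (ε * u) (by positivity) n
  have hn : (0 : ℝ) < n.factorial := by exact_mod_cast n.factorial_pos
  rw [div_le_iff₀ hn, mul_pow] at h
  rw [div_mul_eq_mul_div, le_div_iff₀ (by positivity)]
  linarith

open MeasureTheory in
/-- Moments of at most geometric times factorial growth force exponential tails. -/
theorem exists_integrable_exp_of_moments {μ : Measure ℝ} {C M : ℝ} (hM : 0 ≤ M)
    (hint : ∀ k : ℕ, Integrable (fun y : ℝ => y ^ k) μ)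
    (hbd : ∀ k : ℕ, ∫ y : ℝ, y ^ (2 * k) ∂μ ≤ C * M ^ (2 * k) * (2 * k).factorial) :
    ∃ δ > 0, Integrable (fun y : ℝ => Real.exp (δ * |y|)) μ := by
  set δ : ℝ := 1 / (2 * (M + 1)) with hδ
  have hδ0 : 0 < δ := by positivity
  have hδM : δ * M ≤ 1 / 2 := by
    rw [hδ, div_mul_eq_mul_div, div_le_div_iff₀ (by positivity) (by norm_num)]; linarith
  have hcosh : Integrable (fun y : ℝ => Real.cosh (δ * y)) μ := by
    refine ⟨(Real.continuous_cosh.comp (by fun_prop)).aestronglyMeasurable, ?_⟩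
    rw [hasFiniteIntegral_iff_ofReal (Filter.Eventually.of_forall fun y => (Real.cosh_pos _).le)]
    have hnn : ∀ (k : ℕ) (y : ℝ), 0 ≤ (δ * y) ^ (2 * k) / (2 * k).factorial := fun k y => by
      have : 0 ≤ (δ * y) ^ (2 * k) := by rw [pow_mul]; positivity
      positivity
    have e : ∀ y : ℝ, ENNReal.ofReal (Real.cosh (δ * y))
        = ∑' k : ℕ, ENNReal.ofReal ((δ * y) ^ (2 * k) / (2 * k).factorial) := fun y => by
      have := Real.hasSum_cosh (δ * y)
      rw [← this.tsum_eq, ENNReal.ofReal_tsum_of_nonneg (fun k => hnn k y) this.summable]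
    simp only [e]
    rw [lintegral_tsum (fun k => by fun_prop)]
    have hterm : ∀ k : ℕ, ∫⁻ y, ENNReal.ofReal ((δ * y) ^ (2 * k) / (2 * k).factorial) ∂μ
        ≤ ENNReal.ofReal (|C| * (1 / 4) ^ k) := by
      intro k
      have hi : Integrable (fun y : ℝ => (δ * y) ^ (2 * k) / (2 * k).factorial) μ := by
        simp only [mul_pow]
        exact ((hint (2 * k)).const_mul _).div_const _
      rw [← ofReal_integral_eq_lintegral_ofReal hi (Filter.Eventually.of_forall (hnn k))]
      refine ENNReal.ofReal_le_ofReal ?_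
      simp only [mul_pow]
      rw [integral_div, integral_const_mul]
      have hf : (0 : ℝ) < (2 * k).factorial := by exact_mod_cast (2 * k).factorial_pos
      rw [div_le_iff₀ hf]
      calc δ ^ (2 * k) * ∫ y : ℝ, y ^ (2 * k) ∂μ
          ≤ δ ^ (2 * k) * (|C| * M ^ (2 * k) * (2 * k).factorial) := by
            gcongr
            refine (hbd k).trans ?_
            gcongr
            exact le_abs_self C
        _ = |C| * ((δ * M) ^ 2) ^ k * (2 * k).factorial := by rw [← pow_mul, mul_pow]; ring
        _ ≤ |C| * (1 / 4) ^ k * (2 * k).factorial := by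
            gcongr
            have : 0 ≤ δ * M := by positivity
            nlinarith
    refine lt_of_le_of_lt (ENNReal.tsum_le_tsum hterm) ?_
    rw [← ENNReal.ofReal_tsum_of_nonneg (fun k => by positivity)
      ((summable_geometric_of_lt_one (by norm_num) (by norm_num)).mul_left _)]
    exact ENNReal.ofReal_lt_top
  refine ⟨δ, hδ0, (hcosh.const_mul 2).mono' (by fun_prop) (Filter.Eventually.of_forall fun y => ?_)⟩
  rw [Real.norm_eq_abs, Real.abs_exp, ← Real.cosh_abs, abs_mul, abs_of_pos hδ0, Real.cosh_eq]
  linarith [Real.exp_pos (-(δ * |y|))]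

open MeasureTheory in
/-- `h` is integrable against the weight `exp (δ |y|)`. -/
def ExpIntegrable (δ : ℝ) (h : ℝ → ℂ) (μ : Measure ℝ) : Prop :=
  AEStronglyMeasurable h μ ∧ Integrable (fun y => ‖h y‖ * Real.exp (δ * |y|)) μ

open MeasureTheory in
/-- The transform `s ↦ ∫ h(y) (iy + a)^k exp (s (iy + a)) dμ(y)`, and its formal `s`-derivatives
as `k` varies. -/
def expTransform (μ : Measure ℝ) (h : ℝ → ℂ) (a : ℝ) (k : ℕ) (s : ℂ) : ℂ :=
  ∫ y : ℝ, h y * (y * Complex.I + a) ^ k * Complex.exp (s * (y * Complex.I + a)) ∂μ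

theorem norm_expTransform_integrand_le (h : ℝ → ℂ) (a : ℝ) (k : ℕ) {δ δ₁ A : ℝ} (hδ : δ₁ < δ)
    {s : ℂ} (hs : |s.im| ≤ δ₁) (hA : |s.re| ≤ A) (y : ℝ) :
    ‖h y * (y * Complex.I + a) ^ k * Complex.exp (s * (y * Complex.I + a))‖
      ≤ (k.factorial / (δ - δ₁) ^ k * Real.exp ((δ - δ₁) * |a|) * Real.exp (A * |a|))
        * (‖h y‖ * Real.exp (δ * |y|)) := by
  have hε : 0 < δ - δ₁ := by linarith
  have h1 : ‖((y * Complex.I + a : ℂ)) ^ k‖ ≤ (|y| + |a|) ^ k := by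
    rw [norm_pow]
    gcongr
    refine (norm_add_le _ _).trans ?_
    simp
  have h2 := h1.trans (pow_le_factorial_mul_exp (by positivity) hε k)
  have h3 : ‖Complex.exp (s * (y * Complex.I + a))‖ ≤ Real.exp (A * |a|) * Real.exp (δ₁ * |y|) := by
    rw [Complex.norm_exp, ← Real.exp_add]
    refine Real.exp_le_exp.mpr ?_
    have e : (s * (y * Complex.I + a)).re = s.re * a - s.im * y := by simp
    rw [e]
    have i1 : s.re * a ≤ A * |a| := (le_abs_self _).trans (by rw [abs_mul]; gcongr)
    have i2 : -(s.im * y) ≤ δ₁ * |y| := (neg_le_abs _).trans (by rw [abs_mul]; gcongr)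
    linarith
  rw [norm_mul, norm_mul]
  calc ‖h y‖ * ‖((y * Complex.I + a : ℂ)) ^ k‖ * ‖Complex.exp (s * (y * Complex.I + a))‖
      ≤ ‖h y‖ * (k.factorial / (δ - δ₁) ^ k * Real.exp ((δ - δ₁) * (|y| + |a|)))
        * (Real.exp (A * |a|) * Real.exp (δ₁ * |y|)) := by gcongr
    _ = _ := by
      have : Real.exp (δ * |y|) = Real.exp ((δ - δ₁) * |y|) * Real.exp (δ₁ * |y|) := by
        rw [← Real.exp_add]; ring_nf
      rw [this, mul_add, Real.exp_add]; ring

open MeasureTheory in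
theorem aestronglyMeasurable_expTransform_integrand {μ : Measure ℝ} {h : ℝ → ℂ}
    (hh : AEStronglyMeasurable h μ) (a : ℝ) (k : ℕ) (s : ℂ) :
    AEStronglyMeasurable
      (fun y : ℝ => h y * (y * Complex.I + a) ^ k * Complex.exp (s * (y * Complex.I + a))) μ := by
  refine (hh.mul ?_).mul ?_
  · exact Continuous.aestronglyMeasurable (by fun_prop)
  · exact Continuous.aestronglyMeasurable (by fun_prop)

open MeasureTheory in
theorem ExpIntegrable.integrable_expTransform {μ : Measure ℝ} {h : ℝ → ℂ} {δ : ℝ}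
    (hh : ExpIntegrable δ h μ) (a : ℝ) (k : ℕ) {s : ℂ} (hs : |s.im| < δ) :
    Integrable
      (fun y : ℝ => h y * (y * Complex.I + a) ^ k * Complex.exp (s * (y * Complex.I + a))) μ :=
  (hh.2.const_mul _).mono' (aestronglyMeasurable_expTransform_integrand hh.1 a k s)
    (Filter.Eventually.of_forall (norm_expTransform_integrand_le h a k hs le_rfl le_rfl))

open MeasureTheory in
theorem ExpIntegrable.hasDerivAt_expTransform {μ : Measure ℝ} {h : ℝ → ℂ} {δ : ℝ}
    (hh : ExpIntegrable δ h μ) (a : ℝ) (k : ℕ) {s : ℂ} (hs : |s.im| < δ) :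
    HasDerivAt (expTransform μ h a k) (expTransform μ h a (k + 1) s) s := by
  set r : ℝ := (δ - |s.im|) / 2 with hr
  have hr0 : 0 < r := by rw [hr]; linarith
  have hball : ∀ s' ∈ Metric.ball s r, |s'.im| ≤ |s.im| + r ∧ |s'.re| ≤ |s.re| + r := by
    intro s' hs'
    rw [Metric.mem_ball, dist_eq_norm] at hs'
    have h1 := (Complex.abs_im_le_norm (s' - s)).trans hs'.le
    have h2 := (Complex.abs_re_le_norm (s' - s)).trans hs'.le
    rw [Complex.sub_im] at h1
    rw [Complex.sub_re] at h2
    constructor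
    · have := abs_sub_abs_le_abs_sub s'.im s.im; linarith
    · have := abs_sub_abs_le_abs_sub s'.re s.re; linarith
  refine (hasDerivAt_integral_of_dominated_loc_of_deriv_le (Metric.ball_mem_nhds s hr0)
    (Filter.Eventually.of_forall (aestronglyMeasurable_expTransform_integrand hh.1 a k))
    (hh.integrable_expTransform a k hs)
    (aestronglyMeasurable_expTransform_integrand hh.1 a (k + 1) s)
    (Filter.Eventually.of_forall fun y s' hs' => norm_expTransform_integrand_le h a (k + 1)
      (δ := δ) (by rw [hr]; linarith) (hball s' hs').1 (hball s' hs').2 y)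
    (hh.2.const_mul _) (Filter.Eventually.of_forall fun y s' _ => ?_)).2
  have h1 : HasDerivAt (fun s : ℂ => s * (y * Complex.I + a)) (y * Complex.I + a) s' := by
    simpa using (hasDerivAt_id s').mul_const ((y : ℂ) * Complex.I + a)
  convert! (h1.cexp.const_mul (h y * (y * Complex.I + a) ^ k)) using 1
  ring

/-- A sequence of functions on a horizontal strip, each the derivative of the one before, vanishes
on the strip if all of them vanish at `0`. -/
theorem eq_zero_of_hasDerivAt_strip {δ : ℝ} (hδ : 0 < δ) (f : ℕ → ℂ → ℂ)
    (hf : ∀ k s, |s.im| < δ → HasDerivAt (f k) (f (k + 1) s) s) (h0 : ∀ k, f k 0 = 0)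
    {s : ℂ} (hs : |s.im| < δ) : f 0 s = 0 := by
  set U : Set ℂ := {s | |s.im| < δ} with hU
  have hUo : IsOpen U := isOpen_lt (by fun_prop) continuous_const
  have hUc : IsPreconnected U := by
    have : U = Complex.imLm ⁻¹' (Set.Ioo (-δ) δ) := by ext s; simp [hU, abs_lt]
    rw [this]
    exact ((convex_Ioo _ _).linear_preimage Complex.imLm).isPreconnected
  have h0U : (0 : ℂ) ∈ U := by simpa [hU] using hδ
  have hiter : ∀ k, ∀ s ∈ U, iteratedDeriv k (f 0) s = f k s := by
    intro k
    induction k with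
    | zero => intro s _; simp
    | succ k ih =>
      intro s hs
      rw [iteratedDeriv_succ]
      have : iteratedDeriv k (f 0) =ᶠ[nhds s] f k :=
        Filter.eventually_of_mem (hUo.mem_nhds hs) ih
      rw [this.deriv_eq, (hf k s hs).deriv]
  have hdiff : DifferentiableOn ℂ (f 0) U := fun s hs =>
    (hf 0 s hs).differentiableAt.differentiableWithinAt
  have hloc : f 0 =ᶠ[nhds 0] 0 := by
    obtain ⟨r, hr, hrU⟩ := Metric.isOpen_iff.mp hUo 0 h0U
    refine Filter.eventually_of_mem (Metric.ball_mem_nhds 0 hr) fun z hz => ?_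
    have hsum := Complex.hasSum_taylorSeries_on_ball (hdiff.mono hrU) hz
    simp only [hiter _ 0 h0U, h0, smul_zero] at hsum
    exact hsum.unique hasSum_zero
  exact (hdiff.analyticOnNhd hUo).eqOn_zero_of_preconnected_of_eventuallyEq_zero hUc h0U hloc hs

/-! ### Exponentially integrable densities and their moments -/

theorem exists_norm_eval_le_exp (R : ℂ[X]) {r : ℝ} (hr : 0 ≤ r) {ε : ℝ} (hε : 0 < ε) :
    ∃ B : ℝ, 0 ≤ B ∧ ∀ x : ℂ, |x.re| ≤ r → ‖R.eval x‖ ≤ B * Real.exp (ε * |x.im|) := by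
  induction R using Polynomial.induction_on' with
  | add p q hp hq =>
    obtain ⟨B, hB, h⟩ := hp
    obtain ⟨B', hB', h'⟩ := hq
    refine ⟨B + B', by positivity, fun x hx => ?_⟩
    rw [eval_add, add_mul]
    exact (norm_add_le _ _).trans (add_le_add (h x hx) (h' x hx))
  | monomial n c =>
    refine ⟨‖c‖ * ((n.factorial / ε ^ n) * Real.exp (ε * r)), by positivity, fun x hx => ?_⟩
    rw [eval_monomial, norm_mul, norm_pow, mul_assoc]
    have h1 : ‖x‖ ≤ |x.im| + r := by linarith [Complex.norm_le_abs_re_add_abs_im x]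
    have h2 := pow_le_factorial_mul_exp (u := |x.im| + r) (by positivity) hε n
    rw [mul_add, add_comm (ε * |x.im|), Real.exp_add, ← mul_assoc] at h2
    gcongr
    exact (pow_le_pow_left₀ (norm_nonneg _) h1 n).trans h2

open MeasureTheory in
theorem ExpIntegrable.mul_eval {μ : Measure ℝ} {h : ℝ → ℂ} {δ δ' : ℝ}
    (hh : ExpIntegrable δ h μ) (hδ : δ' < δ) (R : ℂ[X]) (a : ℝ) :
    ExpIntegrable δ' (fun y => h y * R.eval (y * Complex.I + a)) μ := by
  obtain ⟨B, hB, hR⟩ := exists_norm_eval_le_exp R (abs_nonneg a) (sub_pos.mpr hδ)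
  have hc : Continuous fun y : ℝ => R.eval (y * Complex.I + a) :=
    R.continuous.comp (by fun_prop)
  refine ⟨hh.1.mul hc.aestronglyMeasurable, (hh.2.const_mul B).mono' ?_ ?_⟩
  · exact ((hh.1.mul hc.aestronglyMeasurable).norm).mul
      (Continuous.aestronglyMeasurable (by fun_prop))
  · refine Filter.Eventually.of_forall fun y => ?_
    rw [norm_mul, norm_norm, norm_mul, Real.norm_eq_abs, Real.abs_exp]
    have e : Real.exp (δ * |y|) = Real.exp ((δ - δ') * |y|) * Real.exp (δ' * |y|) := by
      rw [← Real.exp_add]; ring_nf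
    calc ‖h y‖ * ‖R.eval (y * Complex.I + a)‖ * Real.exp (δ' * |y|)
        ≤ ‖h y‖ * (B * Real.exp ((δ - δ') * |y|)) * Real.exp (δ' * |y|) := by
          gcongr; simpa using hR (y * Complex.I + a) (by simp)
      _ = _ := by rw [e]; ring

open MeasureTheory in
theorem ExpIntegrable.mono {μ : Measure ℝ} {h : ℝ → ℂ} {δ δ' : ℝ}
    (hh : ExpIntegrable δ h μ) (hδ : δ' < δ) : ExpIntegrable δ' h μ := by
  simpa using hh.mul_eval hδ 1 0

open MeasureTheory in
theorem ExpIntegrable.integrable {μ : Measure ℝ} {h : ℝ → ℂ} {δ : ℝ} (hδ : 0 < δ)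
    (hh : ExpIntegrable δ h μ) : Integrable h μ := by
  simpa using hh.integrable_expTransform 0 0 (s := 0) (by simpa using hδ)

open MeasureTheory in
theorem ExpIntegrable.integrable_mul_eval {μ : Measure ℝ} {h : ℝ → ℂ} {δ : ℝ} (hδ : 0 < δ)
    (hh : ExpIntegrable δ h μ) (R : ℂ[X]) (a : ℝ) :
    Integrable (fun y : ℝ => h y * R.eval (y * Complex.I + a)) μ :=
  (hh.mul_eval (half_lt_self hδ) R a).integrable (half_pos hδ)

open MeasureTheory in
/-- The functional `R ↦ ∫ h(y) R(iy) dμ(y)` of an exponentially integrable density. -/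
def momentFunctional {μ : Measure ℝ} {h : ℝ → ℂ} {δ : ℝ} (hδ : 0 < δ)
    (hh : ExpIntegrable δ h μ) : ℂ[X] →ₗ[ℂ] ℂ where
  toFun R := ∫ y : ℝ, h y * R.eval (y * Complex.I) ∂μ
  map_add' R Q := by
    have h1 := hh.integrable_mul_eval hδ R 0
    have h2 := hh.integrable_mul_eval hδ Q 0
    simp only [Complex.ofReal_zero, add_zero] at h1 h2
    simp only [eval_add, mul_add]
    exact integral_add h1 h2
  map_smul' a R := by
    simp only [eval_smul, smul_eq_mul, RingHom.id_apply]
    rw [← integral_const_mul]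
    congr 1; ext y; ring

open MeasureTheory in
theorem momentFunctional_apply {μ : Measure ℝ} {h : ℝ → ℂ} {δ : ℝ} (hδ : 0 < δ)
    (hh : ExpIntegrable δ h μ) (R : ℂ[X]) :
    momentFunctional hδ hh R = ∫ y : ℝ, h y * R.eval (y * Complex.I) ∂μ := rfl

open MeasureTheory in
/-- A continuous function with exponential decay all of whose moments vanish is zero: its Fourier
transform continues analytically to a strip and vanishes to infinite order at `0`. -/
theorem eq_zero_of_moments_eq_zero {w : ℝ → ℂ} {δ : ℝ} (hδ : 0 < δ) (hw : Continuous w)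
    (hh : ExpIntegrable δ w volume)
    (h0 : ∀ R : ℂ[X], ∫ y : ℝ, w y * R.eval (y * Complex.I) = 0) : w = 0 := by
  have hz : ∀ s : ℝ, ∫ y : ℝ, w y * Complex.exp (s * (y * Complex.I)) = 0 := by
    intro s
    have := eq_zero_of_hasDerivAt_strip hδ (fun k => expTransform volume w 0 k)
      (fun k s hs => hh.hasDerivAt_expTransform 0 k hs)
      (fun k => by simpa [expTransform] using h0 (X ^ k)) (s := s) (by simpa using hδ)
    simpa [expTransform] using this
  have hF : FourierTransform.fourier w = 0 := by
    ext ξ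
    rw [Real.fourier_real_eq_integral_exp_smul, Pi.zero_apply, ← hz (-2 * Real.pi * ξ)]
    congr 1; ext y
    rw [smul_eq_mul, mul_comm]; push_cast; ring_nf
  have h1 := hw.fourierInv_fourier_eq (hh.integrable hδ) (by rw [hF]; exact integrable_zero _ _ _)
  rw [← h1, hF]
  ext y
  rw [Real.fourierInv_eq]
  simp

open MeasureTheory in
/-- A measure has exponential tails if the moments grow at most like `C Mᵏ k!`. -/
theorem exists_expIntegrable_one {μ : Measure ℝ} {τ : ℂ[X] →ₗ[ℂ] ℂ}
    (hμ : ∀ R : ℂ[X], Integrable (fun y : ℝ => R.eval (y * Complex.I)) μ ∧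
      ∫ y, R.eval (y * Complex.I) ∂μ = τ R)
    {B M : ℝ} (hM : 0 ≤ M) (hb : ∀ k : ℕ, ‖τ (X ^ k)‖ ≤ B * M ^ k * k.factorial) :
    ∃ δ > 0, ExpIntegrable δ (fun _ => 1) μ := by
  have hpow : ∀ (k : ℕ) (y : ℝ), (ofImag (X ^ k)).eval (y * Complex.I) = ((y ^ k : ℝ) : ℂ) :=
    fun k y => by rw [eval_ofImag]; simp
  obtain ⟨δ, hδ, h⟩ := exists_integrable_exp_of_moments (μ := μ) (C := B) hM
    (fun k => by
      have := (hμ (ofImag (X ^ k))).1.re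
      simpa only [hpow, RCLike.re_eq_complex_re, Complex.ofReal_re] using this)
    (fun k => by
      have e : ((∫ y : ℝ, y ^ (2 * k) ∂μ : ℝ) : ℂ) = (-1) ^ k * τ (X ^ (2 * k)) := by
        rw [← (hμ _).2, ← integral_complex_ofReal, ← integral_const_mul]
        congr 1; ext y
        rw [eval_pow, eval_X, mul_pow, pow_mul Complex.I, Complex.I_sq, mul_comm ((y : ℂ) ^ _),
          ← mul_assoc, ← mul_pow]
        simp
      refine (le_abs_self _).trans ?_
      have h1 : |∫ y : ℝ, y ^ (2 * k) ∂μ| = ‖τ (X ^ (2 * k))‖ := by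
        rw [← Real.norm_eq_abs, ← Complex.norm_real, e]; simp
      rw [h1]; exact hb _)
  exact ⟨δ, hδ, aestronglyMeasurable_const, by simpa using h⟩

open MeasureTheory in
theorem ExpIntegrable.isFiniteMeasure {μ : Measure ℝ} {δ : ℝ} (hδ : 0 < δ)
    (h : ExpIntegrable δ (fun _ => (1 : ℂ)) μ) : IsFiniteMeasure μ := by
  have := h.integrable hδ
  rw [integrable_const_iff] at this
  simpa using this

open MeasureTheory in
/-- Two functionals given by exponentially integrable densities with the same moments have the
same Fourier transform. -/
theorem fourier_eq_of_moments_eq {μ ν : Measure ℝ} {g h : ℝ → ℂ} {δ : ℝ} (hδ : 0 < δ)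
    (hg : ExpIntegrable δ g μ) (hh : ExpIntegrable δ h ν)
    (h0 : ∀ R : ℂ[X], ∫ y : ℝ, g y * R.eval (y * Complex.I) ∂μ
      = ∫ y : ℝ, h y * R.eval (y * Complex.I) ∂ν) (s : ℝ) :
    ∫ y : ℝ, g y * Complex.exp (s * (y * Complex.I)) ∂μ
      = ∫ y : ℝ, h y * Complex.exp (s * (y * Complex.I)) ∂ν := by
  have := eq_zero_of_hasDerivAt_strip hδ
    (fun k s => expTransform μ g 0 k s - expTransform ν h 0 k s)
    (fun k s hs => (hg.hasDerivAt_expTransform 0 k hs).sub (hh.hasDerivAt_expTransform 0 k hs))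
    (fun k => by
      have := h0 (X ^ k)
      simp only [eval_pow, eval_X] at this
      simp [expTransform, this]) (s := s) (by simpa using hδ)
  simpa [expTransform, sub_eq_zero] using this

open MeasureTheory in
theorem integrable_mul_cexp {μ : Measure ℝ} {g : ℝ → ℂ} (hg : Integrable g μ) {φ : ℝ → ℝ}
    (hφ : Measurable φ) : Integrable (fun y => g y * Complex.exp (φ y * Complex.I)) μ := by
  refine hg.mul_bdd (c := 1) ?_ (Filter.Eventually.of_forall fun y => ?_)
  · exact Measurable.aestronglyMeasurable (by fun_prop)
  · rw [Complex.norm_exp_ofReal_mul_I]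

open MeasureTheory in
theorem integral_withDensity_ofReal_mul {v : ℝ → ℝ} (hv : Continuous v) (g : ℝ → ℂ) :
    ∫ y, g y ∂(volume.withDensity fun y => ENNReal.ofReal (v y))
      = ∫ y, ((max (v y) 0 : ℝ) : ℂ) * g y := by
  rw [integral_withDensity_eq_integral_toReal_smul (by fun_prop)
    (Filter.Eventually.of_forall fun y => ENNReal.ofReal_lt_top)]
  rfl

open MeasureTheory in
/-- A continuous exponentially decaying density that is nonnegative in mean against all squares is
nonnegative: by Hamburger's theorem its moments are those of a positive measure, and by
determinacy the two agree. -/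
theorem nonneg_of_isNonnegOnSquares {w : ℝ → ℂ} {δ : ℝ} (hδ : 0 < δ) (hw : Continuous w)
    (hh : ExpIntegrable δ w volume) (hτ : IsNonnegOnSquares (momentFunctional hδ hh)) (y : ℝ) :
    (w y).im = 0 ∧ 0 ≤ (w y).re := by
  have hreal : ∀ y, (w y).im = 0 := by
    have h1 : ExpIntegrable δ (fun y => starRingEnd ℂ (w y) - w y) volume := by
      refine ⟨(Complex.continuous_conj.comp hw |>.sub hw).aestronglyMeasurable,
        (hh.2.const_mul 2).mono' (Continuous.aestronglyMeasurable (by fun_prop))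
        (Filter.Eventually.of_forall fun y => ?_)⟩
      rw [norm_mul, norm_norm, Real.norm_eq_abs, Real.abs_exp, ← mul_assoc]
      gcongr
      refine (norm_sub_le _ _).trans ?_
      rw [Complex.norm_conj]; linarith
    have h2 := eq_zero_of_moments_eq_zero hδ (by fun_prop) h1 fun R => by
      have e1 := hτ.map_conjRefl R
      rw [momentFunctional_apply, momentFunctional_apply] at e1
      simp only [eval_conjRefl_mul_I] at e1
      have e2 := congrArg (starRingEnd ℂ) e1
      rw [Complex.conj_conj, ← integral_conj] at e2
      simp only [map_mul, Complex.conj_conj] at e2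
      have i1 := hh.integrable_mul_eval hδ R 0
      have i2 := (hh.integrable_mul_eval hδ (conjRefl R) 0)
      simp only [Complex.ofReal_zero, add_zero] at i1 i2
      have i3 : Integrable (fun y : ℝ => starRingEnd ℂ (w y) * R.eval (y * Complex.I)) := by
        refine ((Complex.conjLIE.integrable_comp_iff (φ := fun y : ℝ =>
          w y * (conjRefl R).eval (y * Complex.I))).mpr i2).congr
          (Filter.Eventually.of_forall fun y => ?_)
        simp [eval_conjRefl_mul_I]
      simp only [sub_mul]
      rw [integral_sub i3 i1, e2, sub_self]
    intro y
    have h3 := congrArg Complex.im (congrFun h2 y)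
    simp only [Complex.sub_im, Complex.conj_im, Pi.zero_apply, Complex.zero_im] at h3
    linarith
  refine ⟨hreal y, ?_⟩
  obtain ⟨μ, hμ⟩ := hτ.exists_measure
  obtain ⟨δ₁, hδ₁, hμ1⟩ := exists_expIntegrable_one hμ (B := ∫ y, ‖w y‖ * Real.exp (δ * |y|))
    (M := 1 / δ) (by positivity) (fun k => by
      rw [momentFunctional_apply, mul_assoc, ← integral_mul_const]
      refine norm_integral_le_of_norm_le (hh.2.mul_const _) (Filter.Eventually.of_forall fun y => ?_)
      have := pow_le_factorial_mul_exp (abs_nonneg y) hδ k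
      simp only [eval_pow, eval_X, norm_mul, norm_pow, Complex.norm_real, Complex.norm_I, mul_one,
        Real.norm_eq_abs]
      calc ‖w y‖ * |y| ^ k ≤ ‖w y‖ * (k.factorial / δ ^ k * Real.exp (δ * |y|)) := by gcongr
        _ = _ := by rw [div_pow, one_pow]; ring)
  have := hμ1.isFiniteMeasure hδ₁
  set v : ℝ → ℝ := fun y => (w y).re with hv
  have hvc : Continuous v := by fun_prop
  have hwv : ∀ y, w y = (v y : ℂ) := fun y => Complex.ext rfl (hreal y)
  have hvi : Integrable v := (hh.integrable hδ).re
  set νp : Measure ℝ := volume.withDensity fun y => ENNReal.ofReal (v y) with hνp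
  set νm : Measure ℝ := volume.withDensity fun y => ENNReal.ofReal (-v y) with hνm
  have : IsFiniteMeasure νp := isFiniteMeasure_withDensity_ofReal hvi.2
  have : IsFiniteMeasure νm := isFiniteMeasure_withDensity_ofReal hvi.neg.2
  have hmain : μ + νm = νp := by
    refine Measure.ext_of_charFun (funext fun s => ?_)
    simp only [charFun_apply_real]
    have hbi : ∀ (ν : Measure ℝ) [IsFiniteMeasure ν],
        Integrable (fun y : ℝ => Complex.exp (s * y * Complex.I)) ν := fun ν _ => by
      have := integrable_mul_cexp (μ := ν) (integrable_const (1 : ℂ)) (φ := fun y => s * y)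
        (by fun_prop)
      simpa using this
    rw [integral_add_measure (hbi _) (hbi _), hνp, hνm, integral_withDensity_ofReal_mul hvc,
      integral_withDensity_ofReal_mul (v := fun y => -v y) hvc.neg]
    have hF := fourier_eq_of_moments_eq (δ := min δ₁ δ / 2) (by positivity)
      (hμ1.mono ((half_lt_self (by positivity)).trans_le (min_le_left _ _)))
      (hh.mono ((half_lt_self (by positivity)).trans_le (min_le_right _ _)))
      (fun R => by simpa [momentFunctional_apply] using (hμ R).2) s
    simp only [one_mul] at hF
    have e1 : ∀ y : ℝ, Complex.exp (s * y * Complex.I) = Complex.exp (s * (y * Complex.I)) :=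
      fun y => by rw [mul_assoc]
    have hpi : ∀ u : ℝ → ℝ, Integrable u →
        Integrable (fun y => ((max (u y) 0 : ℝ) : ℂ) * Complex.exp (s * (y * Complex.I))) := by
      intro u hu
      have := integrable_mul_cexp (hu.pos_part.ofReal (𝕜 := ℂ)) (φ := fun y => s * y) (by fun_prop)
      simpa [mul_assoc] using this
    simp only [e1]
    rw [hF, ← integral_add ?_ (hpi (fun y => -v y) hvi.neg)]
    · congr 1; ext y
      rw [← add_mul, hwv y, ← Complex.ofReal_add]
      congr 2
      rcases le_total 0 (v y) with h | h
      · rw [max_eq_right (by linarith), max_eq_left h, add_zero]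
      · rw [max_eq_left (by linarith), max_eq_right h, add_neg_cancel]
    · have := integrable_mul_cexp (hh.integrable hδ) (φ := fun y => s * y) (by fun_prop)
      simpa [mul_assoc] using this
  -- `νm` is carried by the open set `{v < 0}`, which is null for `νp`
  have hzero : νm {y | v y < 0} = 0 := by
    have hms : MeasurableSet {y | v y < 0} := measurableSet_lt hvc.measurable measurable_const
    have h1 : νp {y | v y < 0} = 0 := by
      rw [hνp, withDensity_apply _ hms, setLIntegral_congr_fun hms
        (g := fun _ => 0) (fun y hy => ENNReal.ofReal_of_nonpos (le_of_lt hy))]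
      simp
    rw [← hmain, Measure.add_apply] at h1
    exact (add_eq_zero.mp h1).2
  by_contra! hneg
  have hopen : IsOpen {y | v y < 0} := isOpen_lt hvc continuous_const
  rw [hνm, withDensity_apply _ hopen.measurableSet] at hzero
  rw [lintegral_eq_zero_iff (by fun_prop)] at hzero
  have hae : ∀ᵐ y ∂(volume.restrict {y | v y < 0}), False := by
    filter_upwards [hzero, ae_restrict_mem hopen.measurableSet] with y h1 h2
    simp only [Pi.zero_apply, ENNReal.ofReal_eq_zero] at h1
    have h2' : v y < 0 := h2
    linarith
  have h3 : volume {y | v y < 0} = 0 := by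
    rw [Filter.eventually_false_iff_eq_bot, ae_eq_bot, Measure.restrict_eq_zero] at hae
    exact hae
  exact (hopen.measure_pos volume ⟨y, hneg⟩).ne' h3

/-! ### Twisted functionals on `ℂ[X]` -/

/-- The functional `τ` on `ℂ[X]` is the restriction to polynomials in `z` of a twisted trace with
parameters `t` and `P`: `τ((SP)(X - 1/2)) = t τ((SP)(X + 1/2))` for all `S`. -/
def IsTwisted (t : ℂ) (P : ℂ[X]) (τ : ℂ[X] →ₗ[ℂ] ℂ) : Prop :=
  ∀ S : ℂ[X], τ (taylor (-(1 / 2)) (S * P)) = t * τ (taylor (1 / 2) (S * P))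

theorem IsTwisted.of_dvd {t : ℂ} {P Q : ℂ[X]} {τ : ℂ[X] →ₗ[ℂ] ℂ} (h : IsTwisted t P τ)
    (hd : P ∣ Q) : IsTwisted t Q τ := by
  obtain ⟨R, rfl⟩ := hd
  intro S
  have := h (S * R)
  rwa [mul_assoc, mul_comm R P] at this

theorem IsTwisted.sub {t : ℂ} {P : ℂ[X]} {τ σ : ℂ[X] →ₗ[ℂ] ℂ} (h : IsTwisted t P τ)
    (h' : IsTwisted t P σ) : IsTwisted t P (τ - σ) := fun S => by
  simp only [LinearMap.sub_apply, h S, h' S]; ring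

theorem IsTwisted.add {t : ℂ} {P : ℂ[X]} {τ σ : ℂ[X] →ₗ[ℂ] ℂ} (h : IsTwisted t P τ)
    (h' : IsTwisted t P σ) : IsTwisted t P (τ + σ) := fun S => by
  simp only [LinearMap.add_apply, h S, h' S]; ring

/-- `1` if `t = 1` and `0` otherwise: the drop of degree of `R ↦ R(X - 1/2) - t R(X + 1/2)`. -/
def degreeDrop (t : ℂ) : ℕ := if t = 1 then 1 else 0

theorem coeff_taylor_of_natDegree_le (r : ℂ) {Q : ℂ[X]} {m : ℕ} (h : Q.natDegree ≤ m) :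
    (taylor r Q).coeff m = Q.coeff m := by
  rcases h.eq_or_lt with h | h
  · rw [← h, coeff_taylor_natDegree]; rfl
  · rw [coeff_eq_zero_of_natDegree_lt h, coeff_eq_zero_of_natDegree_lt (by rwa [natDegree_taylor])]

/-- The polynomial `Q(X - 1/2) - t Q(X + 1/2)` has degree `deg Q - degreeDrop t`: the leading
coefficients cancel for `t = 1` only, and then the next ones do not. -/
theorem natDegree_twistedDifference (t : ℂ) {Q : ℂ[X]} (hQ : Q.Monic) {m : ℕ}
    (hm : Q.natDegree = m + degreeDrop t) :
    (taylor (-(1 / 2)) Q - t • taylor (1 / 2) Q).natDegree ≤ m ∧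
      (taylor (-(1 / 2)) Q - t • taylor (1 / 2) Q).coeff m ≠ 0 := by
  have hle : ∀ r : ℂ, (taylor r Q).natDegree ≤ m + degreeDrop t := fun r => by
    rw [natDegree_taylor, hm]
  have hle' : (taylor (-(1 / 2)) Q - t • taylor (1 / 2) Q).natDegree ≤ m + degreeDrop t :=
    (natDegree_sub_le _ _).trans (max_le (hle _) ((natDegree_smul_le _ _).trans (hle _)))
  have htop : ∀ r : ℂ, (taylor r Q).coeff (m + degreeDrop t) = 1 := fun r => by
    rw [coeff_taylor_of_natDegree_le r hm.le, ← hm]; exact hQ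
  by_cases ht : t = 1
  · subst ht
    simp only [degreeDrop, if_true] at *
    have hcoeff : ∀ r : ℂ, (taylor r Q).coeff m = r * (m + 1) + Q.coeff m := by
      intro r
      set Q' := Q - X ^ (m + 1) with hQ'
      have hQ'd : Q'.natDegree ≤ m := by
        refine natDegree_le_iff_coeff_eq_zero.mpr fun j hj => ?_
        rw [hQ', coeff_sub, coeff_X_pow]
        rcases (Nat.succ_le_of_lt hj).eq_or_lt with h | h
        · have h' : j = m + 1 := h.symm
          rw [if_pos h', h', ← hm, coeff_natDegree, hQ.leadingCoeff, sub_self]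
        · rw [if_neg (Nat.ne_of_gt h), coeff_eq_zero_of_natDegree_lt (by rw [hm]; exact h), sub_zero]
      have hQQ : Q = X ^ (m + 1) + Q' := by rw [hQ']; ring
      have e1 : (taylor r Q).coeff m = ((X + C r) ^ (m + 1)).coeff m + Q'.coeff m := by
        conv_lhs => rw [hQQ]
        rw [map_add, coeff_add, taylor_X_pow, coeff_taylor_of_natDegree_le r hQ'd]
      have e2 : Q.coeff m = Q'.coeff m := by
        rw [hQ', coeff_sub, coeff_X_pow, if_neg (by omega), sub_zero]
      rw [e1, e2, coeff_X_add_C_pow]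
      simp
    refine ⟨?_, ?_⟩
    · refine natDegree_le_iff_coeff_eq_zero.mpr fun j hj => ?_
      rcases (Nat.succ_le_of_lt hj).eq_or_lt with h | h
      · rw [← h, coeff_sub, coeff_smul, htop, htop]; simp
      · exact coeff_eq_zero_of_natDegree_lt (hle'.trans_lt h)
    · rw [coeff_sub, coeff_smul, hcoeff, hcoeff]
      have : (m : ℂ) + 1 ≠ 0 := by exact_mod_cast Nat.succ_ne_zero m
      intro h
      apply this
      simp only [smul_eq_mul] at h
      linear_combination -h
  · have h0 : degreeDrop t = 0 := if_neg ht
    rw [h0, add_zero] at hle'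
    simp only [h0, add_zero] at htop
    refine ⟨hle', ?_⟩
    rw [coeff_sub, coeff_smul, htop, htop, smul_eq_mul, mul_one]
    exact sub_ne_zero.mpr (Ne.symm ht)

/-- A twisted functional is determined by its values in degrees `< deg P - degreeDrop t`. -/
theorem IsTwisted.eq_zero_of_low_degree {t : ℂ} {P : ℂ[X]} (hP : P.Monic) {τ : ℂ[X] →ₗ[ℂ] ℂ}
    (h : IsTwisted t P τ) (h0 : ∀ k < P.natDegree - degreeDrop t, τ (X ^ k) = 0) : τ = 0 := by
  have key : ∀ m, τ (X ^ m) = 0 := by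
    intro m
    induction m using Nat.strong_induction_on with
    | _ m ih =>
      by_cases hm : m < P.natDegree - degreeDrop t
      · exact h0 m hm
      have hQm : (X ^ (m + degreeDrop t - P.natDegree) * P).Monic := (monic_X_pow _).mul hP
      obtain ⟨hd, hc⟩ := natDegree_twistedDifference t hQm (m := m) (by
        rw [(monic_X_pow _).natDegree_mul hP, natDegree_X_pow]; omega)
      have h1 := h (X ^ (m + degreeDrop t - P.natDegree))
      set D := taylor (-(1 / 2)) (X ^ (m + degreeDrop t - P.natDegree) * P)
        - t • taylor (1 / 2) (X ^ (m + degreeDrop t - P.natDegree) * P) with hD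
      have hτD : τ D = 0 := by rw [hD, map_sub, map_smul, h1, smul_eq_mul, sub_self]
      rw [D.as_sum_range_C_mul_X_pow' (Nat.lt_succ_of_le hd), map_sum, Finset.sum_range_succ,
        Finset.sum_eq_zero, zero_add, ← smul_eq_C_mul, map_smul, smul_eq_mul] at hτD
      · exact (mul_eq_zero.mp hτD).resolve_left hc
      · intro i hi
        rw [← smul_eq_C_mul, map_smul, ih i (Finset.mem_range.mp hi), smul_zero]
  ext m
  simpa [X_pow_eq_monomial] using key m

/-- A convolution inverse preserves geometric growth. -/
theorem geometric_bound_of_conv {c m : ℕ → ℂ} {K B A : ℝ} (hc : ∀ j, ‖c j‖ ≤ K) (hc0 : c 0 ≠ 0)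
    (hA : 0 ≤ A) (hB : 0 ≤ B)
    (hconv : ∀ k, ‖∑ i ∈ Finset.range (k + 1), m i * c (k - i)‖ ≤ B * A ^ k) :
    ∃ B' M : ℝ, 0 ≤ M ∧ ∀ k, ‖m k‖ ≤ B' * M ^ k := by
  set κ := ‖c 0‖ with hκ
  have hκ0 : 0 < κ := norm_pos_iff.mpr hc0
  have hK : 0 < K := hκ0.trans_le (hc 0)
  set M := A + 1 + 2 * K / κ with hM
  have hM1 : 2 * K / κ ≤ M - 1 := by rw [hM]; linarith
  have hM0 : 0 < M - 1 := (by positivity : (0 : ℝ) < 2 * K / κ).trans_le hM1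
  have hAM : A ≤ M := by rw [hM]; have : 0 ≤ 2 * K / κ := by positivity
                         linarith
  set B' := 2 * B / κ with hB'
  have hB'0 : 0 ≤ B' := by positivity
  refine ⟨B', M, by linarith, fun k => ?_⟩
  induction k using Nat.strong_induction_on with
  | _ k ih =>
    have h1 := hconv k
    rw [Finset.sum_range_succ, Nat.sub_self] at h1
    have h2 : ‖∑ i ∈ Finset.range k, m i * c (k - i)‖ ≤ K * B' * ∑ i ∈ Finset.range k, M ^ i := by
      rw [Finset.mul_sum]
      refine norm_sum_le_of_le _ fun i hi => ?_
      rw [norm_mul]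
      calc ‖m i‖ * ‖c (k - i)‖ ≤ (B' * M ^ i) * K :=
            mul_le_mul (ih i (Finset.mem_range.mp hi)) (hc _) (norm_nonneg _)
              (mul_nonneg hB'0 (pow_nonneg (by linarith) i))
        _ = _ := by ring
    have h3 : (∑ i ∈ Finset.range k, M ^ i) * (M - 1) ≤ M ^ k := by
      rw [geom_sum_mul]; linarith
    have h4 : K * (∑ i ∈ Finset.range k, M ^ i) ≤ κ / 2 * M ^ k := by
      have h5 : 0 ≤ ∑ i ∈ Finset.range k, M ^ i :=
        Finset.sum_nonneg fun i _ => pow_nonneg (by linarith) i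
      have h6 : K ≤ κ / 2 * (M - 1) := by
        rw [div_le_iff₀ hκ0] at hM1; linarith
      calc K * (∑ i ∈ Finset.range k, M ^ i) ≤ κ / 2 * (M - 1) * ∑ i ∈ Finset.range k, M ^ i := by
            gcongr
        _ = κ / 2 * ((∑ i ∈ Finset.range k, M ^ i) * (M - 1)) := by ring
        _ ≤ _ := by gcongr
    have h7 : ‖m k * c 0‖ ≤ B * A ^ k + K * B' * ∑ i ∈ Finset.range k, M ^ i := by
      have e : m k * c 0 = (∑ i ∈ Finset.range k, m i * c (k - i) + m k * c 0)
        - ∑ i ∈ Finset.range k, m i * c (k - i) := by ring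
      rw [e]
      exact (norm_sub_le _ _).trans (add_le_add h1 h2)
    have h8 : B * A ^ k ≤ B * M ^ k := by gcongr
    have h9 : B = B' * (κ / 2) := by rw [hB']; field_simp
    rw [norm_mul, ← hκ] at h7
    have h10 : ‖m k‖ * κ ≤ B' * M ^ k * κ := by
      calc ‖m k‖ * κ ≤ B * M ^ k + B' * (K * ∑ i ∈ Finset.range k, M ^ i) := by linarith
        _ ≤ B * M ^ k + B' * (κ / 2 * M ^ k) := by gcongr
        _ = _ := by rw [h9]; ring
    exact le_of_mul_le_mul_right h10 hκ0

/-- A functional vanishing on the multiples of a monic polynomial grows geometrically. -/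
theorem geometric_bound_of_ideal {P : ℂ[X]} (hP : P.Monic) {Ψ : ℂ[X] →ₗ[ℂ] ℂ}
    (h : ∀ S, Ψ (S * P) = 0) : ∃ B A : ℝ, 0 ≤ B ∧ 0 ≤ A ∧ ∀ k, ‖Ψ (X ^ k)‖ ≤ B * A ^ k := by
  set n := P.natDegree
  set s := ∑ i ∈ Finset.range n, ‖P.coeff i‖ with hs
  have hs0 : 0 ≤ s := Finset.sum_nonneg fun _ _ => norm_nonneg _
  set B := ∑ i ∈ Finset.range n, ‖Ψ (X ^ i)‖ with hB
  have hB0 : 0 ≤ B := Finset.sum_nonneg fun _ _ => norm_nonneg _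
  refine ⟨B, 1 + s, hB0, by positivity, fun k => ?_⟩
  have h1A : (1 : ℝ) ≤ 1 + s := by linarith
  induction k using Nat.strong_induction_on with
  | _ k ih =>
    by_cases hk : k < n
    · calc ‖Ψ (X ^ k)‖ ≤ B :=
            Finset.single_le_sum (f := fun i => ‖Ψ (X ^ i)‖) (fun _ _ => norm_nonneg _)
              (Finset.mem_range.mpr hk)
        _ ≤ _ := le_mul_of_one_le_right hB0 (one_le_pow₀ h1A)
    push Not at hk
    have e : (X ^ k : ℂ[X]) = X ^ (k - n) * P
        - ∑ i ∈ Finset.range n, P.coeff i • X ^ (k - n + i) := by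
      have e1 : X ^ (k - n) * P = X ^ (k - n)
          * (X ^ n + ∑ i ∈ Finset.range n, C (P.coeff i) * X ^ i) := congrArg _ hP.as_sum
      rw [e1, mul_add, ← pow_add, Nat.sub_add_cancel hk, Finset.mul_sum, add_sub_assoc,
        sub_eq_zero.mpr, add_zero]
      refine Finset.sum_congr rfl fun i _ => ?_
      rw [smul_eq_C_mul, pow_add]; ring
    rw [e, map_sub, h, zero_sub, norm_neg, map_sum]
    rcases k with _ | k
    · have : n = 0 := by omega
      simp [this, hB0]
    have h1 : ‖∑ i ∈ Finset.range n, Ψ (P.coeff i • X ^ (k + 1 - n + i))‖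
        ≤ ∑ i ∈ Finset.range n, ‖P.coeff i‖ * (B * (1 + s) ^ k) := by
      refine norm_sum_le_of_le _ fun i hi => ?_
      have hi' := Finset.mem_range.mp hi
      rw [map_smul, norm_smul]
      gcongr
      refine (ih _ (by omega)).trans ?_
      gcongr
      · omega
    refine h1.trans ?_
    rw [← Finset.sum_mul, ← hs, pow_succ]
    nlinarith [mul_nonneg hB0 (pow_nonneg (by positivity : (0 : ℝ) ≤ 1 + s) k)]

/-- The moments of a twisted functional grow at most like `B Mᵏ k!`. Indeed
`R ↦ τ(R(X - 1/2)) - t τ(R(X + 1/2))` vanishes on the multiples of `P`, so that it grows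
geometrically, and its values at `Xᵏ / k!` are the convolution of `τ(Xᵏ) / k!` with the Taylor
coefficients of `e^{-s/2} - t e^{s/2}`. -/
theorem IsTwisted.moment_growth {t : ℂ} {P : ℂ[X]} (hP : P.Monic) {τ : ℂ[X] →ₗ[ℂ] ℂ}
    (h : IsTwisted t P τ) :
    ∃ B M : ℝ, 0 ≤ M ∧ ∀ k : ℕ, ‖τ (X ^ k)‖ ≤ B * M ^ k * k.factorial := by
  set Ψ : ℂ[X] →ₗ[ℂ] ℂ := τ ∘ₗ taylor (-(1 / 2)) - t • (τ ∘ₗ taylor (1 / 2)) with hΨ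
  obtain ⟨B, A, hB, hA, hBA⟩ := geometric_bound_of_ideal hP (Ψ := Ψ) fun S => by
    simp only [hΨ, LinearMap.sub_apply, LinearMap.comp_apply, LinearMap.smul_apply, h S,
      smul_eq_mul, sub_self]
  set c : ℕ → ℂ := fun j => ((-(1 / 2)) ^ j - t * (1 / 2) ^ j) / j.factorial with hc
  set m : ℕ → ℂ := fun k => τ (X ^ k) / k.factorial with hm
  have hconv : ∀ k, ∑ i ∈ Finset.range (k + 1), m i * c (k - i) = Ψ (X ^ k) / k.factorial := by
    intro k
    have hT : ∀ r : ℂ, τ (taylor r (X ^ k))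
        = ∑ i ∈ Finset.range (k + 1), (r ^ (k - i) * k.choose i) * τ (X ^ i) := by
      intro r
      rw [taylor_X_pow, add_pow, map_sum]
      refine Finset.sum_congr rfl fun i _ => ?_
      have e : X ^ i * C r ^ (k - i) * ((k.choose i : ℕ) : ℂ[X])
          = (r ^ (k - i) * k.choose i) • X ^ i := by
        rw [smul_eq_C_mul, C_mul, C_pow, map_natCast]; ring
      rw [e, map_smul, smul_eq_mul]
    have hk : (k.factorial : ℂ) ≠ 0 := by exact_mod_cast k.factorial_ne_zero
    rw [eq_div_iff hk, hΨ, LinearMap.sub_apply, LinearMap.smul_apply, LinearMap.comp_apply,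
      LinearMap.comp_apply, hT, hT, smul_eq_mul, Finset.mul_sum, ← Finset.sum_sub_distrib,
      Finset.sum_mul]
    refine Finset.sum_congr rfl fun i hi => ?_
    have hi' : i ≤ k := Nat.lt_succ_iff.mp (Finset.mem_range.mp hi)
    have h1 : (i.factorial : ℂ) ≠ 0 := by exact_mod_cast i.factorial_ne_zero
    have h2 : ((k - i).factorial : ℂ) ≠ 0 := by exact_mod_cast (k - i).factorial_ne_zero
    rw [Nat.cast_choose ℂ hi']
    simp only [hm, hc]
    field_simp
  have hcK : ∀ j, ‖c j‖ ≤ 1 + ‖t‖ := by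
    intro j
    have hj : (1 : ℝ) ≤ j.factorial := by exact_mod_cast j.factorial_pos
    have hp : ((1 : ℝ) / 2) ^ j ≤ 1 := pow_le_one₀ (by norm_num) (by norm_num)
    rw [hc, norm_div, Complex.norm_natCast, div_le_iff₀ (by linarith)]
    calc ‖(-(1 / 2) : ℂ) ^ j - t * (1 / 2) ^ j‖ ≤ ‖(-(1 / 2) : ℂ) ^ j‖ + ‖t * (1 / 2) ^ j‖ :=
          norm_sub_le _ _
      _ ≤ 1 + ‖t‖ * 1 := by
        rw [norm_mul, norm_pow, norm_pow, norm_neg]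
        have : ‖(1 / 2 : ℂ)‖ = 1 / 2 := by simp
        rw [this]
        gcongr
      _ ≤ (1 + ‖t‖) * j.factorial := by nlinarith [norm_nonneg t]
  have hΨb : ∀ k, ‖Ψ (X ^ k) / k.factorial‖ ≤ B * A ^ k := by
    intro k
    have hk : (1 : ℝ) ≤ k.factorial := by exact_mod_cast k.factorial_pos
    rw [norm_div, Complex.norm_natCast]
    exact (div_le_self (norm_nonneg _) hk).trans (hBA k)
  obtain ⟨B', M, hM, hb⟩ : ∃ B' M : ℝ, 0 ≤ M ∧ ∀ k, ‖m k‖ ≤ B' * M ^ k := by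
    by_cases ht : t = 1
    -- the convolution factor starts in degree `1`
    · refine geometric_bound_of_conv (c := fun j => c (j + 1)) (m := m) (K := 1 + ‖t‖) (B := B * A)
        (A := A) (fun j => hcK _) ?_ hA (by positivity) fun k => ?_
      · simp only [hc, ht]; norm_num
      · have h1 := hconv (k + 1)
        have hc0 : c 0 = 0 := by simp [hc, ht]
        rw [Finset.sum_range_succ, Nat.sub_self, hc0, mul_zero, add_zero] at h1
        have h2 : ∑ i ∈ Finset.range (k + 1), m i * c (k - i + 1)
            = ∑ i ∈ Finset.range (k + 1), m i * c (k + 1 - i) := by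
          refine Finset.sum_congr rfl fun i hi => ?_
          have := Finset.mem_range.mp hi
          congr 2; omega
        rw [h2, h1, mul_assoc, ← pow_succ']
        exact hΨb (k + 1)
    · refine geometric_bound_of_conv (c := c) (m := m) hcK ?_ hA hB fun k => ?_
      · simp only [hc]; simpa [sub_eq_zero] using Ne.symm ht
      · rw [hconv]; exact hΨb k
  refine ⟨B', M, hM, fun k => ?_⟩
  have hk : (0 : ℝ) < k.factorial := by exact_mod_cast k.factorial_pos
  have := hb k
  rw [hm, norm_div, Complex.norm_natCast, div_le_iff₀ hk] at this
  exact this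

/-! ### Roots on or outside the boundary of the strip -/

open MeasureTheory Filter Topology in
/-- If the Fourier transform of `g dμ` along a nowhere vanishing phase `φ` has a limit at infinity,
the limit is zero: the mean of the transform over `[n, 2n]` tends to the limit and, by dominated
convergence, to zero. -/
theorem eq_zero_of_tendsto_fourier {μ : Measure ℝ} [SFinite μ] {g : ℝ → ℂ} (hg : Integrable g μ)
    {φ : ℝ → ℝ} (hφ : Measurable φ) (hφ0 : ∀ᵐ y ∂μ, φ y ≠ 0) {b : ℂ}
    (hb : Tendsto (fun s : ℝ => ∫ y, g y * Complex.exp ((s * φ y : ℝ) * Complex.I) ∂μ)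
      atTop (𝓝 b)) : b = 0 := by
  set J : ℝ → ℂ := fun s => ∫ y, g y * Complex.exp ((s * φ y : ℝ) * Complex.I) ∂μ with hJ
  have hJc : Continuous J := by
    refine continuous_of_dominated (fun s => (integrable_mul_cexp hg (hφ.const_mul s)).1)
      (bound := fun y => ‖g y‖) (fun s => Eventually.of_forall fun y => ?_) hg.norm
      (Eventually.of_forall fun y => by fun_prop)
    rw [norm_mul, Complex.norm_exp_ofReal_mul_I, mul_one]
  have hJb : ∀ s, ‖J s‖ ≤ ∫ y, ‖g y‖ ∂μ := fun s =>
    norm_integral_le_of_norm_le hg.norm (Eventually.of_forall fun y => by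
      rw [norm_mul, Complex.norm_exp_ofReal_mul_I, mul_one])
  have hlim1 : Tendsto (fun n : ℕ => ∫ s in (1 : ℝ)..2, J (n * s)) atTop (𝓝 b) := by
    have : ∫ _ in (1 : ℝ)..2, b = b := by
      rw [intervalIntegral.integral_const]; norm_num
    rw [← this]
    refine intervalIntegral.tendsto_integral_filter_of_dominated_convergence
      (fun _ => ∫ y, ‖g y‖ ∂μ) (Eventually.of_forall fun n => ?_)
      (Eventually.of_forall fun n => Eventually.of_forall fun s _ => hJb _) (by simp)
      (Eventually.of_forall fun s hs => ?_)
    · exact (hJc.comp (by fun_prop)).aestronglyMeasurable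
    · rw [Set.uIoc_of_le (by norm_num)] at hs
      exact hb.comp (tendsto_natCast_atTop_atTop.atTop_mul_const (by linarith [hs.1]))
  set Φ : ℕ → ℝ → ℂ := fun n y => ∫ s in (1 : ℝ)..2,
    Complex.exp ((n * φ y * Complex.I) * s) with hΦ
  have hswap : ∀ n : ℕ, ∫ s in (1 : ℝ)..2, J (n * s) = ∫ y, g y * Φ n y ∂μ := by
    intro n
    simp only [hJ]
    rw [intervalIntegral_integral_swap]
    · congr 1; ext y
      rw [intervalIntegral.integral_const_mul]
      congr 2; ext s
      push_cast; ring_nf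
    · rw [Set.uIoc_of_le one_le_two]
      have h1 : Integrable (fun p : ℝ × ℝ => g p.2)
          ((volume.restrict (Set.Ioc (1 : ℝ) 2)).prod μ) := hg.comp_snd _
      refine h1.mul_bdd (c := 1) ?_ (Eventually.of_forall fun p => ?_)
      · exact Measurable.aestronglyMeasurable (by fun_prop)
      · rw [Complex.norm_exp_ofReal_mul_I]
  have hΦ1 : ∀ n y, ‖Φ n y‖ ≤ 1 := by
    intro n y
    refine (intervalIntegral.norm_integral_le_of_norm_le_const (C := 1) fun s _ => ?_).trans
      (by norm_num)
    have : (n * φ y * Complex.I) * s = ((n * φ y * s : ℝ) : ℂ) * Complex.I := by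
      push_cast; ring
    rw [this, Complex.norm_exp_ofReal_mul_I]
  have hΦ0 : ∀ y, φ y ≠ 0 → Tendsto (fun n => Φ n y) atTop (𝓝 0) := by
    intro y hy
    have h1 : Tendsto (fun n : ℕ => 2 / |φ y| * (1 / (n : ℝ))) atTop (𝓝 0) := by
      simpa using (tendsto_one_div_atTop_nhds_zero_nat (𝕜 := ℝ)).const_mul (2 / |φ y|)
    refine squeeze_zero_norm' ?_ h1
    filter_upwards [eventually_gt_atTop 0] with n hn
    have hn' : (n : ℂ) ≠ 0 := by exact_mod_cast hn.ne'
    have hc : (n * φ y * Complex.I : ℂ) ≠ 0 :=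
      mul_ne_zero (mul_ne_zero hn' (by exact_mod_cast hy)) Complex.I_ne_zero
    have hu : ∀ s : ℝ, ‖Complex.exp ((n * φ y * Complex.I) * s)‖ = 1 := fun s => by
      have : (n * φ y * Complex.I) * s = ((n * φ y * s : ℝ) : ℂ) * Complex.I := by
        push_cast; ring
      rw [this, Complex.norm_exp_ofReal_mul_I]
    rw [hΦ]
    simp only
    rw [integral_exp_mul_complex hc, norm_div]
    have h2 : ‖(n * φ y * Complex.I : ℂ)‖ = n * |φ y| := by simp
    rw [h2]
    have h3 := (norm_sub_le (Complex.exp ((n * φ y * Complex.I) * (2 : ℝ)))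
      (Complex.exp ((n * φ y * Complex.I) * (1 : ℝ))))
    rw [hu, hu] at h3
    have hn0 : (0 : ℝ) < n := by exact_mod_cast hn
    have hy0 : 0 < |φ y| := abs_pos.mpr hy
    calc _ ≤ (1 + 1) / (n * |φ y|) := by gcongr
      _ = _ := by field_simp; norm_num
  have hlim2 : Tendsto (fun n : ℕ => ∫ s in (1 : ℝ)..2, J (n * s)) atTop (𝓝 0) := by
    simp only [hswap]
    have : (∫ _, (0 : ℂ) ∂μ) = 0 := integral_zero _ _
    rw [← this]
    refine tendsto_integral_of_dominated_convergence (fun y => ‖g y‖) (fun n => ?_) hg.norm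
      (fun n => Eventually.of_forall fun y => ?_) ?_
    · refine hg.1.mul (StronglyMeasurable.aestronglyMeasurable ?_)
      simp only [hΦ, intervalIntegral.integral_of_le (one_le_two : (1 : ℝ) ≤ 2)]
      refine StronglyMeasurable.integral_prod_right ?_
      exact Measurable.stronglyMeasurable (by fun_prop)
    · rw [norm_mul]; exact mul_le_of_le_one_right (norm_nonneg _) (hΦ1 n y)
    · filter_upwards [hφ0] with y hy
      simpa using (hΦ0 y hy).const_mul (g y)
  exact tendsto_nhds_unique hlim1 hlim2

open MeasureTheory Filter Topology in
/-- A constant `b` written with exponential factors `e^{(1/2 - ρ)s}` and `e^{-(1/2 + ρ)s}`, where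
`ρ ≥ 1/2`, and bounded Fourier transforms must vanish; for `ρ = 1/2` this needs the phase to be
nonzero almost everywhere. -/
theorem eq_zero_of_exp_asymptotics {μ : Measure ℝ} [SFinite μ] {g₁ g₂ : ℝ → ℂ}
    (hg₁ : Integrable g₁ μ) (hg₂ : Integrable g₂ μ) {φ : ℝ → ℝ} (hφ : Measurable φ) {ρ : ℝ}
    (hρ : 1 / 2 ≤ ρ) (hφ0 : ρ = 1 / 2 → ∀ᵐ y ∂μ, φ y ≠ 0) {b : ℂ}
    (hb : ∀ s : ℝ, b = Real.exp ((1 / 2 - ρ) * s)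
        * (∫ y, g₁ y * Complex.exp ((s * φ y : ℝ) * Complex.I) ∂μ)
      + Real.exp (-((1 / 2 + ρ) * s))
        * ∫ y, g₂ y * Complex.exp ((s * φ y : ℝ) * Complex.I) ∂μ) : b = 0 := by
  have hbd : ∀ g : ℝ → ℂ, Integrable g μ → ∀ s : ℝ,
      ‖∫ y, g y * Complex.exp ((s * φ y : ℝ) * Complex.I) ∂μ‖ ≤ ∫ y, ‖g y‖ ∂μ := fun g hg s =>
    norm_integral_le_of_norm_le hg.norm (Eventually.of_forall fun y => by
      rw [norm_mul, Complex.norm_exp_ofReal_mul_I, mul_one])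
  have hsmall : ∀ κ : ℝ, 0 < κ → ∀ g : ℝ → ℂ, Integrable g μ →
      Tendsto (fun s : ℝ => (Real.exp (-(κ * s)) : ℂ)
        * ∫ y, g y * Complex.exp ((s * φ y : ℝ) * Complex.I) ∂μ) atTop (𝓝 0) := by
    intro κ hκ g hg
    have h1 : Tendsto (fun s : ℝ => Real.exp (-(κ * s)) * ∫ y, ‖g y‖ ∂μ) atTop (𝓝 0) := by
      have := (Real.tendsto_exp_neg_atTop_nhds_zero.comp
        (tendsto_id.const_mul_atTop hκ)).mul_const (∫ y, ‖g y‖ ∂μ)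
      simpa [Function.comp_def] using this
    refine squeeze_zero_norm (fun s => ?_) h1
    rw [norm_mul, Complex.norm_real, Real.norm_eq_abs, Real.abs_exp]
    gcongr
    exact hbd g hg s
  have h2 := hsmall (1 / 2 + ρ) (by linarith) g₂ hg₂
  have h1 : Tendsto (fun s : ℝ => (Real.exp ((1 / 2 - ρ) * s) : ℂ)
      * ∫ y, g₁ y * Complex.exp ((s * φ y : ℝ) * Complex.I) ∂μ) atTop (𝓝 b) := by
    have h3 := (tendsto_const_nhds (x := b)).sub h2
    rw [sub_zero] at h3
    refine h3.congr fun s => ?_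
    rw [sub_eq_iff_eq_add]
    exact hb s
  rcases hρ.eq_or_lt with h | h
  · rw [← h] at h1
    simp only [sub_self, zero_mul, Real.exp_zero, Complex.ofReal_one, one_mul] at h1
    exact eq_zero_of_tendsto_fourier hg₁ hφ (hφ0 h.symm) h1
  · have h3 := hsmall (ρ - 1 / 2) (by linarith) g₁ hg₁
    refine tendsto_nhds_unique h1 (h3.congr fun s => ?_)
    rw [← neg_mul, neg_sub]

open MeasureTheory in
/-- A positive measure that is twisted for `(X - α) P` is already twisted for `P` if `α` lies
outside the closed strip `|Re α| ≤ 1/2`, or on its boundary without there being a mass at the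
corresponding point `Im α`. Indeed, the defect of twistedness for `P`, transformed in the variable
`s`, equals `b e^{αs}`, which grows too fast unless `b = 0`. -/
theorem IsTwisted.of_mul_X_sub_C {μ : Measure ℝ} {δ : ℝ} (hδ : 0 < δ)
    (hμ : ExpIntegrable δ (fun _ => 1) μ) {t α : ℂ} {P : ℂ[X]}
    (h : IsTwisted t ((X - C α) * P) (momentFunctional hδ hμ)) (hα : 1 / 2 ≤ |α.re|)
    (hα0 : |α.re| = 1 / 2 → μ {α.im} = 0) : IsTwisted t P (momentFunctional hδ hμ) := by
  have := hμ.isFiniteMeasure hδ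
  intro S
  set Q := S * P with hQ
  set g₁ : ℝ → ℂ := fun y => Q.eval (y * Complex.I + (-(1 / 2) : ℝ)) with hg₁
  set g₂ : ℝ → ℂ := fun y => Q.eval (y * Complex.I + (1 / 2 : ℝ)) with hg₂
  have hδ' : δ / 2 < δ := half_lt_self hδ
  have hδ'0 : 0 < δ / 2 := half_pos hδ
  have e₁ : ExpIntegrable (δ / 2) g₁ μ := by simpa only [one_mul] using hμ.mul_eval hδ' Q (-(1 / 2))
  have e₂ : ExpIntegrable (δ / 2) g₂ μ := by simpa only [one_mul] using hμ.mul_eval hδ' Q (1 / 2)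
  set Ψ : ℕ → ℂ → ℂ := fun k s =>
    expTransform μ g₁ (-(1 / 2)) k s - t * expTransform μ g₂ (1 / 2) k s with hΨ
  have hΨd : ∀ k s, |s.im| < δ / 2 → HasDerivAt (Ψ k) (Ψ (k + 1) s) s := fun k s hs =>
    (e₁.hasDerivAt_expTransform _ k hs).sub ((e₂.hasDerivAt_expTransform _ k hs).const_mul t)
  have hΨ0 : ∀ k, Ψ k 0 = momentFunctional hδ hμ (taylor (-(1 / 2)) (X ^ k * Q))
      - t * momentFunctional hδ hμ (taylor (1 / 2) (X ^ k * Q)) := by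
    intro k
    simp only [hΨ, expTransform, momentFunctional_apply, taylor_eval, hg₁, hg₂, zero_mul,
      Complex.exp_zero, mul_one, one_mul, eval_mul, eval_pow, eval_X]
    push_cast
    congr 2
    · ext y; ring
    · congr 1; ext y; ring
  have hzero : ∀ s : ℂ, |s.im| < δ / 2 → Ψ 1 s - α * Ψ 0 s = 0 := fun s hs =>
    eq_zero_of_hasDerivAt_strip hδ'0 (fun k s => Ψ (k + 1) s - α * Ψ k s)
      (fun k s hs => (hΨd (k + 1) s hs).sub ((hΨd k s hs).const_mul α))
      (fun k => by
        have h1 := h (X ^ k * S)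
        have e : X ^ k * S * ((X - C α) * P) = X ^ (k + 1) * Q - α • (X ^ k * Q) := by
          rw [hQ, smul_eq_C_mul]; ring
        rw [e] at h1
        simp only [map_sub, map_smul, smul_eq_mul] at h1
        simp only [hΨ0]
        linear_combination h1) hs
  have hconst : ∀ s : ℝ, Ψ 0 s * Complex.exp (-(α * s)) = Ψ 0 0 := by
    intro s
    have hd : ∀ s : ℝ, HasDerivAt (fun s : ℝ => Ψ 0 s * Complex.exp (-(α * s))) 0 s := by
      intro s
      have him : |(s : ℂ).im| < δ / 2 := by simpa using hδ'0
      have h1 := (hΨd 0 s him).comp_ofReal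
      have h2 : HasDerivAt (fun s : ℝ => Complex.exp (-(α * s)))
          (Complex.exp (-(α * s)) * (-(α * 1))) s :=
        (((hasDerivAt_id (s : ℂ)).const_mul α).neg.cexp).comp_ofReal
      convert! h1.mul h2 using 1
      have := sub_eq_zero.mp (hzero s him)
      simp only [zero_add, this]; ring
    have := is_const_of_deriv_eq_zero (fun s => (hd s).differentiableAt) (fun s => (hd s).deriv) s 0
    simpa using this
  have hae : |α.re| = 1 / 2 → ∀ᵐ y ∂μ, y - α.im ≠ 0 := fun hr => by
    have h1 := hα0 hr
    rw [ae_iff]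
    simpa [sub_eq_zero] using h1
  have i₁ := e₁.integrable hδ'0
  have i₂ : Integrable (fun y => -t * g₂ y) μ := (e₂.integrable hδ'0).const_mul _
  -- the transform with its exponential factors separated
  have hsplit : ∀ s : ℝ, Ψ 0 0
      = Real.exp (-((1 / 2 + α.re) * s))
        * (∫ y, g₁ y * Complex.exp ((s * (y - α.im) : ℝ) * Complex.I) ∂μ)
      + Real.exp ((1 / 2 - α.re) * s)
        * ∫ y, -t * g₂ y * Complex.exp ((s * (y - α.im) : ℝ) * Complex.I) ∂μ := by
    intro s
    rw [← hconst s]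
    simp only [hΨ, expTransform, pow_zero, mul_one]
    rw [sub_mul, mul_assoc t, ← integral_mul_const, ← integral_mul_const, ← integral_const_mul,
      ← integral_const_mul, ← integral_const_mul, sub_eq_add_neg, ← integral_neg]
    have hα' : α = α.re + α.im * Complex.I := (Complex.re_add_im α).symm
    refine congrArg₂ (· + ·) (integral_congr_ae (ae_of_all _ fun y => ?_))
      (integral_congr_ae (ae_of_all _ fun y => ?_))
    · simp only
      rw [mul_assoc, ← Complex.exp_add, Complex.ofReal_exp, mul_left_comm, ← Complex.exp_add]
      congr 2
      conv_lhs => rw [hα']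
      push_cast; ring
    · have key : Complex.exp (s * (y * Complex.I + (1 / 2 : ℝ))) * Complex.exp (-(α * s))
          = Real.exp ((1 / 2 - α.re) * s) * Complex.exp ((s * (y - α.im) : ℝ) * Complex.I) := by
        rw [← Complex.exp_add, Complex.ofReal_exp, ← Complex.exp_add]
        congr 1
        conv_lhs => rw [hα']
        push_cast; ring
      linear_combination (-t * g₂ y) * key
  have hb : Ψ 0 0 = 0 := by
    rcases le_abs.mp hα with hr | hr
    · have habs : |α.re| = α.re := abs_of_nonneg (by linarith)
      refine eq_zero_of_exp_asymptotics i₂ i₁ (φ := fun y => y - α.im) (by fun_prop) hr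
        (fun h => hae (by rw [habs, h])) fun s => ?_
      rw [add_comm]; exact hsplit s
    · have habs : |α.re| = -α.re := abs_of_nonpos (by linarith)
      refine eq_zero_of_exp_asymptotics i₁ i₂ (φ := fun y => -(y - α.im)) (by fun_prop) hr
        (fun h => (hae (by rw [habs, h])).mono fun y hy => neg_ne_zero.mpr hy) fun s => ?_
      rw [hsplit (-s)]
      have k1 : -((1 / 2 + α.re) * -s) = (1 / 2 - -α.re) * s := by ring
      have k2 : (1 / 2 - α.re) * -s = -((1 / 2 + -α.re) * s) := by ring
      have k3 : ∀ y : ℝ, -s * (y - α.im) = s * -(y - α.im) := fun y => by ring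
      simp only [k1, k2, k3]
  rw [hΨ0 0, pow_zero, one_mul] at hb
  exact sub_eq_zero.mp hb

/-! ### The algebra and its weight decomposition -/

namespace QAlg

variable (P : ℂ[X])

/-- The polynomial `R(z)` in `𝒜_P`. -/
def ofPoly : ℂ[X] →ₐ[ℂ] QAlg P := aeval (z P)

theorem ofPoly_X : ofPoly P X = z P := aeval_X _

theorem ofPoly_C (a : ℂ) : ofPoly P (C a) = algebraMap ℂ _ a := aeval_C _ _

theorem v_mul_u : v P * u P = ofPoly P (taylor (-(1 / 2)) P) := by
  rw [v_u, ofPoly, taylor_apply, aeval_comp]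
  simp [sub_eq_add_neg]

theorem u_mul_v : u P * v P = ofPoly P (taylor (1 / 2) P) := by
  rw [u_v, ofPoly, taylor_apply, aeval_comp]
  simp

theorem v_mul_ofPoly (R : ℂ[X]) : v P * ofPoly P R = ofPoly P (taylor (-1) R) * v P := by
  have hz : v P * z P = (z P - 1) * v P := by
    rw [sub_mul, one_mul, sub_eq_iff_eq_add.mp (z_v P)]; abel
  induction R using Polynomial.induction_on with
  | C a => rw [taylor_C, ofPoly_C, Algebra.commutes]
  | add p q hp hq => rw [map_add, mul_add, hp, hq, map_add, map_add, add_mul]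
  | monomial n a h =>
    rw [pow_succ, ← mul_assoc, map_mul, ← mul_assoc, h, mul_assoc, ofPoly_X, hz,
      taylor_mul _ (C a * X ^ n), map_mul _ (taylor (-1) (C a * X ^ n)), taylor_X, map_add, ofPoly_X,
      ofPoly_C, ← mul_assoc]
    simp [sub_eq_add_neg]

theorem u_mul_ofPoly (R : ℂ[X]) : u P * ofPoly P R = ofPoly P (taylor 1 R) * u P := by
  have hz : u P * z P = (z P + 1) * u P := by
    rw [add_mul, one_mul, sub_eq_iff_eq_add.mp (z_u P)]; abel
  induction R using Polynomial.induction_on with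
  | C a => rw [taylor_C, ofPoly_C, Algebra.commutes]
  | add p q hp hq => rw [map_add, mul_add, hp, hq, map_add, map_add, add_mul]
  | monomial n a h =>
    rw [pow_succ, ← mul_assoc, map_mul, ← mul_assoc, h, mul_assoc, ofPoly_X, hz,
      taylor_mul _ (C a * X ^ n), map_mul _ (taylor 1 (C a * X ^ n)), taylor_X, map_add, ofPoly_X,
      ofPoly_C, ← mul_assoc]
    simp

theorem v_pow_mul_ofPoly (k : ℕ) (R : ℂ[X]) :
    v P ^ k * ofPoly P R = ofPoly P (taylor (-(k : ℂ)) R) * v P ^ k := by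
  induction k generalizing R with
  | zero => simp
  | succ k ih =>
    rw [pow_succ, mul_assoc, v_mul_ofPoly, ← mul_assoc, ih, taylor_taylor, mul_assoc]
    congr 4; push_cast; ring

theorem u_pow_mul_ofPoly (k : ℕ) (R : ℂ[X]) :
    u P ^ k * ofPoly P R = ofPoly P (taylor (k : ℂ) R) * u P ^ k := by
  induction k generalizing R with
  | zero => simp
  | succ k ih =>
    rw [pow_succ, mul_assoc, u_mul_ofPoly, ← mul_assoc, ih, taylor_taylor, mul_assoc]
    congr 4; push_cast; ring

/-- The homogeneous element `R(z) vᵏ` or `R(z) u⁻ᵏ` of weight `k` for `ad z`. -/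
def homog : ℤ → ℂ[X] → QAlg P
  | Int.ofNat k, R => ofPoly P R * v P ^ k
  | Int.negSucc k, R => ofPoly P R * u P ^ (k + 1)

theorem homog_natCast (k : ℕ) (R : ℂ[X]) : homog P k R = ofPoly P R * v P ^ k := rfl

theorem homog_zero (R : ℂ[X]) : homog P 0 R = ofPoly P R := by
  have := homog_natCast P 0 R; simpa using this

theorem homog_neg_natCast (k : ℕ) (R : ℂ[X]) :
    homog P (-(k : ℤ)) R = ofPoly P R * u P ^ k := by
  rcases k with _ | k
  · simp [homog_zero]
  · rfl

theorem homog_add (k : ℤ) (R Q : ℂ[X]) : homog P k (R + Q) = homog P k R + homog P k Q := by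
  cases k <;> simp [homog, add_mul]

theorem homog_smul (k : ℤ) (a : ℂ) (R : ℂ[X]) : homog P k (a • R) = a • homog P k R := by
  cases k <;> simp [homog]

theorem ofPoly_mul_homog (k : ℤ) (Q R : ℂ[X]) : ofPoly P Q * homog P k R = homog P k (Q * R) := by
  cases k <;> simp [homog, mul_assoc]

theorem homog_mul_ofPoly (k : ℤ) (R Q : ℂ[X]) :
    homog P k R * ofPoly P Q = homog P k (R * taylor (-(k : ℂ)) Q) := by
  cases k with
  | ofNat k => simp [homog, mul_assoc, v_pow_mul_ofPoly]
  | negSucc k =>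
    simp only [homog, mul_assoc, u_pow_mul_ofPoly, map_mul]
    congr 5; push_cast; ring

theorem v_mul_homog (k : ℕ) (R : ℂ[X]) : v P * homog P k R = homog P (k + 1 : ℕ) (taylor (-1) R) := by
  rw [homog_natCast, homog_natCast, ← mul_assoc, v_mul_ofPoly, mul_assoc, pow_succ']

theorem u_mul_homog (k : ℕ) (R : ℂ[X]) :
    u P * homog P (-(k : ℤ)) R = homog P (-((k + 1 : ℕ) : ℤ)) (taylor 1 R) := by
  rw [homog_neg_natCast, homog_neg_natCast, ← mul_assoc, u_mul_ofPoly, mul_assoc, pow_succ']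

theorem v_mul_homog_neg (k : ℕ) (R : ℂ[X]) :
    v P * homog P (-((k + 1 : ℕ) : ℤ)) R
      = homog P (-(k : ℤ)) (taylor (-1) R * taylor (-(1 / 2)) P) := by
  rw [homog_neg_natCast, homog_neg_natCast, ← mul_assoc, v_mul_ofPoly, pow_succ', mul_assoc,
    ← mul_assoc (v P), v_mul_u, ← mul_assoc, map_mul]

theorem u_mul_homog_succ (k : ℕ) (R : ℂ[X]) :
    u P * homog P (k + 1 : ℕ) R = homog P k (taylor 1 R * taylor (1 / 2) P) := by
  rw [homog_natCast, homog_natCast, ← mul_assoc, u_mul_ofPoly, pow_succ', mul_assoc,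
    ← mul_assoc (u P), u_mul_v, ← mul_assoc, map_mul]

theorem homog_mul_v (k : ℕ) (R : ℂ[X]) : homog P k R * v P = homog P (k + 1 : ℕ) R := by
  rw [homog_natCast, homog_natCast, mul_assoc, pow_succ]

theorem homog_mul_u (k : ℕ) (R : ℂ[X]) :
    homog P (-(k : ℤ)) R * u P = homog P (-((k + 1 : ℕ) : ℤ)) R := by
  rw [homog_neg_natCast, homog_neg_natCast, mul_assoc, pow_succ]

theorem homog_neg_mul_v (k : ℕ) (R : ℂ[X]) :
    homog P (-((k + 1 : ℕ) : ℤ)) R * v P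
      = homog P (-(k : ℤ)) (R * taylor ((k : ℂ) + 1 / 2) P) := by
  rw [homog_neg_natCast, homog_neg_natCast, mul_assoc, pow_succ, mul_assoc, u_mul_v,
    u_pow_mul_ofPoly, taylor_taylor, ← mul_assoc, map_mul]

theorem homog_succ_mul_u (k : ℕ) (R : ℂ[X]) :
    homog P (k + 1 : ℕ) R * u P = homog P k (R * taylor (-(k : ℂ) + -(1 / 2)) P) := by
  rw [homog_natCast, homog_natCast, mul_assoc, pow_succ, mul_assoc, v_mul_u,
    v_pow_mul_ofPoly, taylor_taylor, ← mul_assoc, map_mul]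

/-- Induction on elements of `𝒜_P` along words in the generators. -/
theorem gen_induction {p : QAlg P → Prop} (halg : ∀ a, p (algebraMap ℂ _ a)) (hu : p (u P))
    (hv : p (v P)) (hz : p (z P)) (hadd : ∀ a b, p a → p b → p (a + b))
    (hmul : ∀ a b, p a → p b → p (a * b)) (a : QAlg P) : p a := by
  obtain ⟨x, rfl⟩ := RingQuot.mkAlgHom_surjective ℂ (QRel P) a
  induction x using FreeAlgebra.induction with
  | grade0 r => rw [AlgHom.commutes]; exact halg r
  | grade1 i => cases i; exacts [hu, hv, hz]
  | mul a b ha hb => rw [map_mul]; exact hmul _ _ ha hb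
  | add a b ha hb => rw [map_add]; exact hadd _ _ ha hb

/-- The sum of homogeneous elements, as a linear map. -/
def homogSum : (ℤ →₀ ℂ[X]) →ₗ[ℂ] QAlg P :=
  Finsupp.lsum ℂ fun k =>
    { toFun := homog P k, map_add' := homog_add P k, map_smul' := homog_smul P k }

theorem homogSum_single (k : ℤ) (R : ℂ[X]) : homogSum P (Finsupp.single k R) = homog P k R := by
  rw [homogSum, Finsupp.lsum_single]; rfl

theorem homogSum_apply (f : ℤ →₀ ℂ[X]) : homogSum P f = ∑ k ∈ f.support, homog P k (f k) := by
  simp [homogSum, Finsupp.sum]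

theorem homogSum_surjective : Function.Surjective (homogSum P) := by
  rw [← LinearMap.range_eq_top]
  have hh : ∀ k R, homog P k R ∈ LinearMap.range (homogSum P) := fun k R =>
    ⟨_, homogSum_single P k R⟩
  -- the range is a left ideal containing `1`
  have hmulgen : ∀ g : QAlg P, (∀ k R, g * homog P k R ∈ LinearMap.range (homogSum P)) →
      ∀ b ∈ LinearMap.range (homogSum P), g * b ∈ LinearMap.range (homogSum P) := by
    rintro g hg _ ⟨f, rfl⟩
    rw [homogSum_apply, Finset.mul_sum]
    exact Submodule.sum_mem _ fun k _ => hg k _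
  have hcase : ∀ (g : QAlg P), (∀ k : ℕ, ∀ R, g * homog P k R ∈ LinearMap.range (homogSum P)) →
      (∀ k : ℕ, ∀ R, g * homog P (-(k : ℤ)) R ∈ LinearMap.range (homogSum P)) →
      ∀ k R, g * homog P k R ∈ LinearMap.range (homogSum P) := by
    intro g h1 h2 k R
    obtain ⟨n, rfl | rfl⟩ := k.eq_nat_or_neg
    exacts [h1 n R, h2 n R]
  refine eq_top_iff.mpr fun a _ => ?_
  have key : ∀ a : QAlg P, ∀ b ∈ LinearMap.range (homogSum P),
      a * b ∈ LinearMap.range (homogSum P) := by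
    intro a
    refine gen_induction P (p := fun a => ∀ b ∈ LinearMap.range (homogSum P),
      a * b ∈ LinearMap.range (homogSum P)) (fun r b hb => ?_) ?_ ?_ ?_
      (fun a a' h h' b hb => ?_) (fun a a' h h' b hb => ?_) a
    · rw [← Algebra.smul_def]; exact Submodule.smul_mem _ _ hb
    · refine hmulgen _ (hcase _ (fun k R => ?_) fun k R => ?_)
      · rcases k with _ | k
        · have := u_mul_homog P 0 R
          simp only [Nat.cast_zero, neg_zero] at this ⊢
          rw [this]; exact hh _ _
        · rw [u_mul_homog_succ]; exact hh _ _
      · rw [u_mul_homog]; exact hh _ _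
    · refine hmulgen _ (hcase _ (fun k R => ?_) fun k R => ?_)
      · rw [v_mul_homog]; exact hh _ _
      · rcases k with _ | k
        · have := v_mul_homog P 0 R
          simp only [Nat.cast_zero, neg_zero] at this ⊢
          rw [this]; exact hh _ _
        · rw [v_mul_homog_neg]; exact hh _ _
    · refine hmulgen _ fun k R => ?_
      rw [← ofPoly_X, ofPoly_mul_homog]; exact hh _ _
    · rw [add_mul]; exact Submodule.add_mem _ (h b hb) (h' b hb)
    · rw [mul_assoc]; exact h _ (h' b hb)
  have h1 : (1 : QAlg P) ∈ LinearMap.range (homogSum P) := by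
    have := hh 0 1
    rwa [homog_zero, map_one] at this
  simpa using key a 1 h1

theorem homog_induction {p : QAlg P → Prop} (hh : ∀ k R, p (homog P k R))
    (hadd : ∀ a b, p a → p b → p (a + b)) (a : QAlg P) : p a := by
  obtain ⟨f, rfl⟩ := homogSum_surjective P a
  induction f using Finsupp.induction_linear with
  | zero => have := hh 0 0; rw [map_zero]; rwa [homog_zero, map_zero] at this
  | add f g hf hg => rw [map_add]; exact hadd _ _ hf hg
  | single k R => rw [homogSum_single]; exact hh k R

/-- The operators by which the generators act on sequences `ℤ → ℂ[X]`; the sequence supported at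
`k` with value `R` stands for the element `R(x) σᵏ` of the ring of difference operators generated
by `ℂ[x]` and the shift `σ : x ↦ x - 1`, with `z = x`, `v = σ` and `u = P(x + 1/2) σ⁻¹`. -/
def repGen : QGen → Module.End ℂ (ℤ → ℂ[X])
  | QGen.u => LinearMap.pi fun k =>
      Algebra.lsmul ℂ ℂ ℂ[X] (taylor (1 / 2) P) ∘ₗ taylor (1 : ℂ) ∘ₗ
        LinearMap.proj (R := ℂ) (φ := fun _ : ℤ => ℂ[X]) (k + 1)
  | QGen.v => LinearMap.pi fun k => taylor (-1 : ℂ) ∘ₗ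
      LinearMap.proj (R := ℂ) (φ := fun _ : ℤ => ℂ[X]) (k - 1)
  | QGen.z => Algebra.lsmul ℂ ℂ (ℤ → ℂ[X]) (X : ℂ[X])

theorem aeval_lsmul (Q R : ℂ[X]) :
    aeval (Algebra.lsmul ℂ ℂ (ℤ → ℂ[X]) Q) R = Algebra.lsmul ℂ ℂ (ℤ → ℂ[X]) (R.comp Q) := by
  rw [aeval_algHom_apply]; rfl

theorem repGen_rel ⦃a b : FreeAlgebra ℂ QGen⦄ (h : QRel P a b) :
    FreeAlgebra.lift ℂ (repGen P) a = FreeAlgebra.lift ℂ (repGen P) b := by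
  cases h with
  | zu =>
    simp only [map_sub, map_mul, map_neg, FreeAlgebra.lift_ι_apply]
    ext f k : 2
    simp [repGen]
    ring
  | zv =>
    simp only [map_sub, map_mul, FreeAlgebra.lift_ι_apply]
    ext f k : 2
    simp [repGen]
    ring
  | vu =>
    rw [map_mul, ← aeval_algHom_apply, map_sub, AlgHom.commutes]
    simp only [FreeAlgebra.lift_ι_apply]
    have e : repGen P QGen.z - algebraMap ℂ _ (1 / 2)
        = Algebra.lsmul ℂ ℂ (ℤ → ℂ[X]) ((X : ℂ[X]) + C (-(1 / 2))) := by
      rw [map_add, C_neg, map_neg, ← sub_eq_add_neg]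
      exact congrArg _ ((Algebra.lsmul ℂ ℂ (ℤ → ℂ[X])).commutes (1 / 2)).symm
    rw [e, aeval_lsmul, ← taylor_apply]
    ext f k : 2
    simp [repGen, taylor_taylor, -one_div]
    left
    congr 2; norm_num
  | uv =>
    rw [map_mul, ← aeval_algHom_apply, map_add, AlgHom.commutes]
    simp only [FreeAlgebra.lift_ι_apply]
    have e : repGen P QGen.z + algebraMap ℂ _ (1 / 2)
        = Algebra.lsmul ℂ ℂ (ℤ → ℂ[X]) ((X : ℂ[X]) + C (1 / 2)) := by
      rw [map_add]
      exact congrArg _ ((Algebra.lsmul ℂ ℂ (ℤ → ℂ[X])).commutes (1 / 2)).symm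
    rw [e, aeval_lsmul, ← taylor_apply]
    ext f k : 2
    simp [repGen, taylor_taylor, -one_div]

/-- The representation of `𝒜_P` by difference operators. -/
def rep : QAlg P →ₐ[ℂ] Module.End ℂ (ℤ → ℂ[X]) :=
  RingQuot.liftAlgHom ℂ ⟨FreeAlgebra.lift ℂ (repGen P), repGen_rel P⟩

theorem rep_gen (i : QGen) : rep P (gen P i) = repGen P i := by simp [rep, gen]

theorem rep_u_apply (f : ℤ → ℂ[X]) (k : ℤ) :
    rep P (u P) f k = taylor (1 / 2) P * taylor 1 (f (k + 1)) := by
  rw [u, rep_gen]; rfl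

theorem rep_v_apply (f : ℤ → ℂ[X]) (k : ℤ) : rep P (v P) f k = taylor (-1) (f (k - 1)) := by
  rw [v, rep_gen]; rfl

theorem rep_ofPoly_apply (R : ℂ[X]) (f : ℤ → ℂ[X]) (k : ℤ) :
    rep P (ofPoly P R) f k = R * f k := by
  have h : rep P (z P) = Algebra.lsmul ℂ ℂ (ℤ → ℂ[X]) (X : ℂ[X]) := by rw [z, rep_gen]; rfl
  rw [ofPoly, ← aeval_algHom_apply, h, aeval_lsmul, comp_X]; rfl

theorem rep_homog_single (k j : ℤ) (h : k ≠ j) (R : ℂ[X]) :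
    rep P (homog P k R) (Pi.single 0 1) j = 0 := by
  obtain ⟨n, rfl | rfl⟩ := k.eq_nat_or_neg
  · rw [homog_natCast, map_mul, Module.End.mul_apply, rep_ofPoly_apply]
    suffices ∀ n : ℕ, ∀ j : ℤ, (n : ℤ) ≠ j → rep P (v P ^ n) (Pi.single 0 1) j = 0 by
      rw [this n j h, mul_zero]
    intro n
    induction n with
    | zero => intro j hj; simp [Pi.single_apply]; rintro rfl; simp at hj
    | succ n ih =>
      intro j hj
      rw [pow_succ', map_mul, Module.End.mul_apply, rep_v_apply, ih _ (by push_cast at hj; omega),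
        map_zero]
  · rw [homog_neg_natCast, map_mul, Module.End.mul_apply, rep_ofPoly_apply]
    suffices ∀ n : ℕ, ∀ j : ℤ, -(n : ℤ) ≠ j → rep P (u P ^ n) (Pi.single 0 1) j = 0 by
      rw [this n j h, mul_zero]
    intro n
    induction n with
    | zero => intro j hj; simp [Pi.single_apply]; rintro rfl; simp at hj
    | succ n ih =>
      intro j hj
      rw [pow_succ', map_mul, Module.End.mul_apply, rep_u_apply, ih _ (by push_cast at hj; omega),
        map_zero, mul_zero]

/-- The polynomial `R` for which the weight zero component of an element of `𝒜_P` is `R(z)`. -/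
def weightZero : QAlg P →ₗ[ℂ] ℂ[X] :=
  LinearMap.proj 0 ∘ₗ LinearMap.applyₗ (Pi.single 0 1) ∘ₗ (rep P).toLinearMap

theorem weightZero_homog (k : ℤ) (R : ℂ[X]) :
    weightZero P (homog P k R) = if k = 0 then R else 0 := by
  change rep P (homog P k R) (Pi.single 0 1) 0 = _
  split_ifs with h
  · rw [h, homog_zero, rep_ofPoly_apply]; simp
  · exact rep_homog_single P k 0 h R

theorem weightZero_ofPoly (R : ℂ[X]) : weightZero P (ofPoly P R) = R := by
  rw [← homog_zero, weightZero_homog, if_pos rfl]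

theorem ofPoly_injective : Function.Injective (ofPoly P) :=
  Function.LeftInverse.injective (weightZero_ofPoly P)

theorem ofPoly_mul_v_ne_zero {R : ℂ[X]} (hR : R ≠ 0) : ofPoly P R * v P ≠ 0 := by
  intro h
  have h1 : rep P (ofPoly P R * v P) (Pi.single 0 1) 1 = 0 := by rw [h]; simp
  rw [map_mul, Module.End.mul_apply, rep_ofPoly_apply, rep_v_apply] at h1
  simp at h1
  exact hR h1

end QAlg

/-! ### Twisted traces, conjugations and positivity -/

namespace QAlg

variable {P : ℂ[X]}

theorem gt_ofPoly (t : ℂˣ) (R : ℂ[X]) : gt P t (ofPoly P R) = ofPoly P R := by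
  rw [ofPoly, ← aeval_algHom_apply, gt_z]

/-- A twisted trace factors through the weight zero component. -/
theorem IsTwistedTrace.eq_weightZero {t : ℂˣ} {T : QAlg P →ₗ[ℂ] ℂ} (h : IsTwistedTrace P t T)
    (a : QAlg P) : T a = T (ofPoly P (weightZero P a)) := by
  refine homog_induction P (p := fun a => T a = T (ofPoly P (weightZero P a)))
    (fun k R => ?_) (fun a b ha hb => ?_) a
  · rw [weightZero_homog]
    split_ifs with hk
    · rw [hk, homog_zero]
    · rw [map_zero, map_zero]
      -- `T (z a) = T (a z)`, while `z a - a z = k a`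
      have h1 := h (ofPoly P X) (homog P k R)
      rw [gt_ofPoly, ofPoly_mul_homog, homog_mul_ofPoly, taylor_X, mul_add, homog_add, map_add,
        mul_comm R X, left_eq_add, mul_comm, ← smul_eq_C_mul, homog_smul, map_smul, smul_eq_mul,
        mul_eq_zero] at h1
      refine h1.resolve_left ?_
      simpa using hk
  · rw [map_add, ha, hb, map_add, map_add, map_add]

theorem IsTwistedTrace.isTwisted {t : ℂˣ} {T : QAlg P →ₗ[ℂ] ℂ} (h : IsTwistedTrace P t T) :
    IsTwisted t P (T ∘ₗ (ofPoly P).toLinearMap) := by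
  intro S
  have h1 := h (v P) (ofPoly P (taylor (1 / 2) S) * u P)
  have e1 : v P * (ofPoly P (taylor (1 / 2) S) * u P) = ofPoly P (taylor (-(1 / 2)) (S * P)) := by
    rw [← mul_assoc, v_mul_ofPoly, mul_assoc, v_mul_u, ← map_mul, taylor_taylor, taylor_mul]
    congr 3; norm_num
  have e2 : ofPoly P (taylor (1 / 2) S) * u P * gt P t (v P)
      = (t : ℂ) • ofPoly P (taylor (1 / 2) (S * P)) := by
    rw [gt_v, mul_smul_comm, mul_assoc, u_mul_v, ← map_mul, taylor_mul]
  rw [e1, e2, map_smul, smul_eq_mul] at h1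
  exact h1

theorem isTwistedTrace_comp_weightZero {t : ℂˣ} {τ : ℂ[X] →ₗ[ℂ] ℂ} (h : IsTwisted t P τ) :
    IsTwistedTrace P t (τ ∘ₗ weightZero P) := by
  set T := τ ∘ₗ weightZero P with hT
  have hTh : ∀ k R, T (homog P k R) = if k = 0 then τ R else 0 := fun k R => by
    rw [hT, LinearMap.comp_apply, weightZero_homog]; split_ifs <;> simp
  have ht0 : (t : ℂ) ≠ 0 := t.ne_zero
  have hind : ∀ g : QAlg P, (∀ k : ℕ, ∀ R, T (g * homog P k R) = T (homog P k R * gt P t g)) →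
      (∀ k : ℕ, ∀ R, T (g * homog P (-(k : ℤ)) R) = T (homog P (-(k : ℤ)) R * gt P t g)) →
      ∀ b, T (g * b) = T (b * gt P t g) := by
    intro g h1 h2 b
    refine homog_induction P (p := fun b => T (g * b) = T (b * gt P t g))
      (fun k R => ?_) (fun a b ha hb => ?_) b
    · obtain ⟨n, rfl | rfl⟩ := k.eq_nat_or_neg
      exacts [h1 n R, h2 n R]
    · rw [mul_add, map_add, ha, hb, add_mul, map_add]
  intro a
  refine gen_induction P (p := fun a => ∀ b, T (a * b) = T (b * gt P t a)) (fun r b => ?_) ?_ ?_ ?_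
    (fun a a' h h' b => ?_) (fun a a' h h' b => ?_) a
  · rw [AlgHom.commutes, Algebra.commutes]
  · refine hind _ (fun k R => ?_) fun k R => ?_
    · rw [gt_u, mul_smul_comm, map_smul, Units.val_inv_eq_inv_val, smul_eq_mul]
      rcases k with _ | k
      · have e1 := u_mul_homog P 0 R
        have e2 := homog_mul_u P 0 R
        simp only [Nat.cast_zero, neg_zero] at e1 e2 ⊢
        rw [e1, e2, hTh, hTh]; simp
      · rw [u_mul_homog_succ, homog_succ_mul_u, hTh, hTh]
        split_ifs with hk
        · have hk' : k = 0 := by exact_mod_cast hk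
          subst hk'
          have h1 := h (taylor (1 / 2) R)
          rw [taylor_mul, taylor_mul, taylor_taylor, taylor_taylor] at h1
          norm_num at h1 ⊢
          rw [h1, inv_mul_cancel_left₀ ht0]
        · simp
    · rw [gt_u, mul_smul_comm, map_smul, u_mul_homog, homog_mul_u, hTh, hTh, if_neg (by omega),
        if_neg (by omega), smul_zero]
  · refine hind _ (fun k R => ?_) fun k R => ?_
    · rw [gt_v, mul_smul_comm, map_smul, v_mul_homog, homog_mul_v, hTh, hTh, if_neg (by omega),
        if_neg (by omega), smul_zero]
    · rw [gt_v, mul_smul_comm, map_smul, smul_eq_mul]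
      rcases k with _ | k
      · have e1 := v_mul_homog P 0 R
        have e2 := homog_mul_v P 0 R
        simp only [Nat.cast_zero, neg_zero] at e1 e2 ⊢
        rw [e1, e2, hTh, hTh]; simp
      · rw [v_mul_homog_neg, homog_neg_mul_v, hTh, hTh]
        split_ifs with hk
        · have hk' : k = 0 := by omega
          subst hk'
          have h1 := h (taylor (-(1 / 2)) R)
          rw [taylor_mul, taylor_mul, taylor_taylor, taylor_taylor] at h1
          norm_num at h1 ⊢
          rw [h1]
        · simp
  · refine hind _ (fun k R => ?_) fun k R => ?_
    all_goals
      rw [← ofPoly_X, gt_ofPoly, ofPoly_mul_homog, homog_mul_ofPoly, hTh, hTh]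
      split_ifs with hk
      · have hk' : k = 0 := by omega
        subst hk'; simp [mul_comm]
      · rfl
  · rw [add_mul, map_add, h, h', map_add, mul_add, map_add]
  · rw [mul_assoc, h, mul_assoc, h', map_mul (gt P t), mul_assoc]

section Conjugation

variable (ρ : Conjugation P)

theorem conj_smul (a : ℂ) (x : QAlg P) : ρ (a • x) = starRingEnd ℂ a • ρ x := ρ.map_smul' a x

theorem conj_u : ρ (u P) = (ρ.lamStar : ℂ) • v P := ρ.map_u'

theorem conj_v : ρ (v P) = (ρ.lam : ℂ) • u P := ρ.map_v'

theorem conj_z : ρ (z P) = -z P := ρ.map_z'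

theorem conj_ofPoly (R : ℂ[X]) : ρ (ofPoly P R) = ofPoly P (conjRefl R) := by
  induction R using Polynomial.induction_on with
  | C a =>
    rw [conjRefl_C, ofPoly_C, ofPoly_C, Algebra.algebraMap_eq_smul_one, conj_smul, map_one,
      Algebra.algebraMap_eq_smul_one]
  | add p q hp hq => rw [map_add, map_add, hp, hq, map_add, map_add]
  | monomial n a h =>
    rw [pow_succ, ← mul_assoc, map_mul (ofPoly P), map_mul, h, ofPoly_X, conj_z,
      map_mul conjRefl (C a * X ^ n), conjRefl_X, mul_neg, map_neg,
      map_mul (ofPoly P) (conjRefl _), ofPoly_X]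
    exact _root_.mul_neg (ofPoly P (conjRefl (C a * X ^ n))) (z P)

theorem conjRefl_taylor (r : ℝ) (R : ℂ[X]) :
    conjRefl (taylor (r : ℂ) R) = taylor (-(r : ℂ)) (conjRefl R) := by
  refine Polynomial.funext fun x => ?_
  rw [eval_conjRefl, taylor_eval, taylor_eval, eval_conjRefl]
  congr 2
  simp [add_comm]

/-- The existence of a conjugation makes `P` symmetric up to a factor. -/
theorem conjRefl_eq_smul : conjRefl P = ((ρ.lam : ℂ) * ρ.lamStar) • P := by
  have h1 := congrArg ρ (v_mul_u P)
  have e : (-(1 / 2) : ℂ) = ((-(1 / 2) : ℝ) : ℂ) := by push_cast; rfl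
  rw [map_mul, conj_v, conj_u, conj_ofPoly, smul_mul_smul_comm, u_mul_v, e, conjRefl_taylor,
    ← map_smul, ← map_smul] at h1
  have h2 := ofPoly_injective P h1
  have e' : (-((-(1 / 2) : ℝ) : ℂ)) = 1 / 2 := by push_cast; ring
  rw [e'] at h2
  exact (taylor_injective _ h2).symm

/-- A conjugation exchanges opposite weights. -/
theorem homog_conj (k : ℤ) (R : ℂ[X]) :
    ∃ R', ρ (homog P k R) = homog P (-k) R' ∧ (R ≠ 0 → R' ≠ 0) := by
  obtain ⟨n, rfl | rfl⟩ := k.eq_nat_or_neg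
  · refine ⟨taylor (n : ℂ) ((ρ.lam : ℂ) ^ n • taylor (-(n : ℂ)) (conjRefl R)), ?_, fun h => ?_⟩
    · rw [homog_natCast, homog_neg_natCast, map_mul, map_pow, conj_ofPoly, conj_v, _root_.smul_pow,
        map_smul, taylor_taylor, add_neg_cancel, taylor_zero, map_smul, mul_smul_comm,
        smul_mul_assoc]
    · rw [Ne, taylor_eq_zero, smul_eq_zero, taylor_eq_zero, not_or]
      exact ⟨pow_ne_zero _ ρ.lam.ne_zero, conjRefl_ne_zero h⟩
  · rw [neg_neg]
    refine ⟨(ρ.lamStar : ℂ) ^ n • conjRefl R, ?_, fun h => ?_⟩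
    · rw [homog_natCast, homog_neg_natCast, map_mul, map_pow, conj_ofPoly, conj_u, _root_.smul_pow,
        map_smul, mul_smul_comm, smul_mul_assoc]
    · exact smul_ne_zero (pow_ne_zero _ ρ.lamStar.ne_zero) (conjRefl_ne_zero h)

variable {ρ}

/-- The two conditions on the functional `τ(R) = T(R(z))` that express positivity of `T` on the
elements `R(z)` and `R(z) v`. -/
def IsPositivePair (ρ : Conjugation P) (τ : ℂ[X] →ₗ[ℂ] ℂ) : Prop :=
  ∀ R : ℂ[X], R ≠ 0 → ((τ (R * conjRefl R)).im = 0 ∧ 0 < (τ (R * conjRefl R)).re) ∧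
    (((ρ.lam : ℂ) * τ (taylor (-(1 / 2)) (R * conjRefl R * P))).im = 0 ∧
      0 < ((ρ.lam : ℂ) * τ (taylor (-(1 / 2)) (R * conjRefl R * P))).re)

theorem ofPoly_mul_conj (R : ℂ[X]) :
    ofPoly P R * ρ (ofPoly P R) = ofPoly P (R * conjRefl R) := by rw [conj_ofPoly, map_mul]

theorem ofPoly_v_mul_conj (R : ℂ[X]) :
    ofPoly P (taylor (-(1 / 2)) R) * v P * ρ (ofPoly P (taylor (-(1 / 2)) R) * v P)
      = (ρ.lam : ℂ) • ofPoly P (taylor (-(1 / 2)) (R * conjRefl R * P)) := by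
  have e : (-(1 / 2) : ℂ) = ((-(1 / 2) : ℝ) : ℂ) := by push_cast; rfl
  have e1 : conjRefl (taylor (-(1 / 2)) R) = taylor (1 / 2) (conjRefl R) := by
    rw [e, conjRefl_taylor]; congr 2; push_cast; ring
  have e2 : taylor (-1 : ℂ) (taylor (1 / 2) (conjRefl R)) = taylor (-(1 / 2)) (conjRefl R) := by
    rw [taylor_taylor]; norm_num
  rw [map_mul, conj_ofPoly, conj_v, e1, mul_assoc, ← mul_assoc (v P), v_mul_ofPoly, e2,
    mul_smul_comm, mul_smul_comm, mul_assoc, v_mul_u, taylor_mul, taylor_mul, map_mul, map_mul,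
    mul_assoc]

theorem IsPositiveDefinite.isPositivePair {T : QAlg P →ₗ[ℂ] ℂ} (h : IsPositiveDefinite ρ T) :
    IsPositivePair ρ (T ∘ₗ (ofPoly P).toLinearMap) := by
  intro R hR
  have h1 := h (ofPoly P R) (by rwa [Ne, map_eq_zero_iff _ (ofPoly_injective P)])
  have h2 := h (ofPoly P (taylor (-(1 / 2)) R) * v P)
    (ofPoly_mul_v_ne_zero P (by rwa [Ne, taylor_eq_zero]))
  rw [ofPoly_mul_conj] at h1
  rw [ofPoly_v_mul_conj, map_smul, smul_eq_mul] at h2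
  exact ⟨h1, h2⟩

theorem IsPositivePair.isNonnegOnSquares {τ : ℂ[X] →ₗ[ℂ] ℂ} (h : IsPositivePair ρ τ) :
    IsNonnegOnSquares τ := fun R => by
  by_cases hR : R = 0
  · simp [hR]
  · exact ⟨(h R hR).1.1, (h R hR).1.2.le⟩

theorem isEquivariant_comp_weightZero {τ : ℂ[X] →ₗ[ℂ] ℂ} (h : IsNonnegOnSquares τ) :
    IsEquivariant ρ (τ ∘ₗ weightZero P) := by
  refine homog_induction P (fun k R => ?_) fun a b ha hb => by
    rw [map_add, map_add, ha, hb, map_add, map_add]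
  simp only [LinearMap.comp_apply]
  by_cases hk : k = 0
  · subst hk
    rw [homog_zero, conj_ofPoly, weightZero_ofPoly, weightZero_ofPoly, h.map_conjRefl]
  · obtain ⟨R', hR', -⟩ := homog_conj ρ k R
    rw [hR', weightZero_homog, weightZero_homog, if_neg hk, if_neg (by simpa using hk)]
    simp

/-- Positivity of `T(a ρ(a))` for homogeneous `a` of every weight follows from weights `0` and `1`:
the passage from `a` to `ρ(a)` changes the sign of the weight, and `T(v b v ρ(v b v))` equals
`T(b p ρ(b p))` with `p = v ρ(v)`, a polynomial in `z`. -/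
theorem pos_homog {t : ℂˣ} (hρ : ∀ a : QAlg P, ρ (ρ a) = gt P t a) {T : QAlg P →ₗ[ℂ] ℂ}
    (hP : P ≠ 0) (hT : IsTwistedTrace P t T)
    (h : IsPositivePair ρ (T ∘ₗ (ofPoly P).toLinearMap)) (k : ℤ) {R : ℂ[X]} (hR : R ≠ 0) :
    (T (homog P k R * ρ (homog P k R))).im = 0 ∧ 0 < (T (homog P k R * ρ (homog P k R))).re := by
  have hnat : ∀ n : ℕ, ∀ R : ℂ[X], R ≠ 0 → (T (homog P n R * ρ (homog P n R))).im = 0 ∧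
      0 < (T (homog P n R * ρ (homog P n R))).re := by
    intro n
    induction n using Nat.twoStepInduction with
    | zero =>
      intro R hR
      rw [Nat.cast_zero, homog_zero, ofPoly_mul_conj]
      exact (h R hR).1
    | one =>
      intro R hR
      have e : R = taylor (-(1 / 2)) (taylor (1 / 2) R) := by
        rw [taylor_taylor, neg_add_cancel, taylor_zero]
      rw [homog_natCast, pow_one, e, ofPoly_v_mul_conj, map_smul, smul_eq_mul]
      exact (h _ (by rwa [Ne, taylor_eq_zero])).2
    | more n ih _ =>
      intro R hR
      set b := homog P n (taylor 1 R) with hb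
      have e1 : homog P (n + 2 : ℕ) R = v P * b * v P := by
        rw [hb, v_mul_homog, homog_mul_v, taylor_taylor, neg_add_cancel, taylor_zero]
      set p := (ρ.lam : ℂ) • taylor (-(1 / 2)) P with hp
      have hp0 : p ≠ 0 := smul_ne_zero ρ.lam.ne_zero (by rwa [Ne, taylor_eq_zero])
      have hvp : v P * ρ (v P) = ofPoly P p := by
        rw [conj_v, mul_smul_comm, v_mul_u, hp, map_smul]
      have e2 : T (v P * b * v P * ρ (v P * b * v P))
          = T (b * ofPoly P p * ρ (b * ofPoly P p)) := by
        rw [mul_assoc (v P), mul_assoc (v P), hT, ← hρ, ← hvp]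
        simp only [map_mul ρ.toRingEquiv, mul_assoc]
      rw [e1, e2, hb, homog_mul_ofPoly]
      exact ih _ (mul_ne_zero (by rwa [Ne, taylor_eq_zero]) (by rwa [Ne, taylor_eq_zero]))
  obtain ⟨n, rfl | rfl⟩ := k.eq_nat_or_neg
  · exact hnat n R hR
  · obtain ⟨R', hR', h0⟩ := homog_conj ρ (-(n : ℤ)) R
    rw [neg_neg] at hR'
    rw [hT, ← hρ, hR']
    exact hnat n R' (h0 hR)

theorem isPositiveDefinite_of_isPositivePair {t : ℂˣ} (hρ : ∀ a : QAlg P, ρ (ρ a) = gt P t a)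
    {T : QAlg P →ₗ[ℂ] ℂ} (hP : P ≠ 0) (hT : IsTwistedTrace P t T)
    (h : IsPositivePair ρ (T ∘ₗ (ofPoly P).toLinearMap)) : IsPositiveDefinite ρ T := by
  intro a ha
  obtain ⟨f, rfl⟩ := homogSum_surjective P a
  have hf : f ≠ 0 := by rintro rfl; exact ha (map_zero _)
  -- products of components of different weights have trace zero
  have hcross : ∀ k l : ℤ, k ≠ l → ∀ R Q, T (homog P k R * ρ (homog P l Q)) = 0 := by
    intro k l hkl R Q
    obtain ⟨Q', hQ', -⟩ := homog_conj ρ l Q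
    rw [hQ']
    have h1 := hT (ofPoly P X) (homog P k R * homog P (-l) Q')
    rw [gt_ofPoly, ← mul_assoc, ofPoly_mul_homog, mul_assoc, homog_mul_ofPoly, taylor_X,
      mul_comm Q', add_mul, homog_add, ← smul_eq_C_mul, homog_smul, mul_add, mul_smul_comm,
      map_add, map_smul, ← ofPoly_mul_homog P (-l) X Q', ← mul_assoc, homog_mul_ofPoly, taylor_X,
      mul_add, homog_add, add_mul, map_add, mul_comm R X, mul_comm R (C _), ← smul_eq_C_mul,
      homog_smul, smul_mul_assoc, map_smul, add_assoc, left_eq_add, smul_eq_mul, smul_eq_mul,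
      ← add_mul, mul_eq_zero] at h1
    refine h1.resolve_left fun h2 => hkl ?_
    have h3 : ((l : ℂ)) = k := by push_cast at h2; linear_combination h2
    exact_mod_cast h3.symm
  have hsum : T (homogSum P f * ρ (homogSum P f))
      = ∑ k ∈ f.support, T (homog P k (f k) * ρ (homog P k (f k))) := by
    rw [homogSum_apply, map_sum, Finset.sum_mul_sum, map_sum]
    refine Finset.sum_congr rfl fun k hk => ?_
    rw [map_sum, Finset.sum_eq_single_of_mem k hk fun l _ hl => hcross k l (Ne.symm hl) _ _]
  have hpos := fun k (hk : k ∈ f.support) =>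
    pos_homog hρ hP hT h k (Finsupp.mem_support_iff.mp hk)
  rw [hsum]
  constructor
  · rw [Complex.im_sum]; exact Finset.sum_eq_zero fun k hk => (hpos k hk).1
  · rw [Complex.re_sum]
    exact Finset.sum_pos (fun k hk => (hpos k hk).2) (Finsupp.support_nonempty_iff.mpr hf)

end Conjugation

end QAlg

/-! ### Shifting the line of integration in a strip -/

section Contour

open MeasureTheory Filter Topology

theorem integrable_exp_neg_mul_abs {δ : ℝ} (hδ : 0 < δ) :
    Integrable fun y : ℝ => Real.exp (-(δ * |y|)) := by
  rw [← integrableOn_univ, ← Set.Iic_union_Ioi (a := (0 : ℝ))]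
  refine IntegrableOn.union ?_ ?_
  · refine (integrableOn_exp_mul_Iic hδ 0).congr_fun (fun y hy => ?_) measurableSet_Iic
    rw [abs_of_nonpos (Set.mem_Iic.1 hy), mul_neg, neg_neg]
  · refine (integrableOn_exp_mul_Ioi (neg_neg_of_pos hδ) 0).congr_fun (fun y hy => ?_)
      measurableSet_Ioi
    rw [abs_of_pos (Set.mem_Ioi.1 hy), ← neg_mul]

/-- Cauchy's theorem for a function decaying exponentially in a vertical strip. -/
theorem integral_vertical_line_eq {h : ℂ → ℂ} {a b C δ : ℝ} (hδ : 0 < δ) (hab : a ≤ b)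
    (hd : ∀ x : ℂ, a ≤ x.re → x.re ≤ b → DifferentiableAt ℂ h x)
    (hb : ∀ x : ℂ, a ≤ x.re → x.re ≤ b → ‖h x‖ ≤ C * Real.exp (-(δ * |x.im|))) :
    ∫ y : ℝ, h (y * Complex.I + a) = ∫ y : ℝ, h (y * Complex.I + b) := by
  have hint : Integrable fun y : ℝ => C * Real.exp (-(δ * |y|)) :=
    (integrable_exp_neg_mul_abs hδ).const_mul C
  have hline : ∀ r : ℝ, a ≤ r → r ≤ b → Integrable fun y : ℝ => h (r + y * Complex.I) := by
    intro r h1 h2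
    refine hint.mono' ?_ (Eventually.of_forall fun y => ?_)
    · refine Continuous.aestronglyMeasurable (continuous_iff_continuousAt.2 fun y => ?_)
      refine ContinuousAt.comp (g := h) (hd _ (by simpa using h1) (by simpa using h2)).continuousAt
        (by fun_prop)
    · simpa using hb (r + y * Complex.I) (by simpa using h1) (by simpa using h2)
  have key : ∀ T : ℝ, (((∫ x : ℝ in a..b, h (x + (-T : ℝ) * Complex.I)) -
      ∫ x : ℝ in a..b, h (x + (T : ℝ) * Complex.I)) +
      Complex.I • ∫ y : ℝ in (-T)..T, h (b + y * Complex.I)) -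
      Complex.I • ∫ y : ℝ in (-T)..T, h (a + y * Complex.I) = 0 := by
    intro T
    have := Complex.integral_boundary_rect_eq_zero_of_differentiableOn h (⟨a, -T⟩ : ℂ) ⟨b, T⟩
      (fun x hx => by
        rw [Complex.mem_reProdIm] at hx
        have h1 := hx.1
        rw [Set.uIcc_of_le hab] at h1
        exact (hd x h1.1 h1.2).differentiableWithinAt)
    simpa using this
  have hexp : Tendsto (fun T : ℝ => C * Real.exp (-(δ * |T|)) * |b - a|) atTop (𝓝 0) := by
    have h1 : Tendsto (fun T : ℝ => Real.exp (-(δ * |T|))) atTop (𝓝 0) :=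
      Real.tendsto_exp_neg_atTop_nhds_zero.comp
        (tendsto_abs_atTop_atTop.const_mul_atTop hδ)
    simpa using (h1.const_mul C).mul_const |b - a|
  have hhor : ∀ s : ℝ, s = 1 ∨ s = -1 →
      Tendsto (fun T : ℝ => ∫ x : ℝ in a..b, h (x + ((s * T : ℝ) : ℂ) * Complex.I)) atTop (𝓝 0) := by
    intro s hs
    refine squeeze_zero_norm (fun T => ?_) hexp
    refine intervalIntegral.norm_integral_le_of_norm_le_const fun x hx => ?_
    rw [Set.uIoc_of_le hab] at hx
    have := hb (x + ((s * T : ℝ) : ℂ) * Complex.I) (by simpa using hx.1.le) (by simpa using hx.2)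
    rcases hs with rfl | rfl <;> simpa using this
  have hver : ∀ r : ℝ, a ≤ r → r ≤ b → Tendsto (fun T : ℝ => Complex.I •
      ∫ y : ℝ in (-T)..T, h (r + y * Complex.I)) atTop
      (𝓝 (Complex.I • ∫ y : ℝ, h (r + y * Complex.I))) := fun r h1 h2 =>
    (intervalIntegral_tendsto_integral (hline r h1 h2) tendsto_neg_atTop_atBot tendsto_id).const_smul _
  have hlim := (((hhor (-1) (Or.inr rfl)).sub (hhor 1 (Or.inl rfl))).add
    (hver b hab le_rfl)).sub (hver a le_rfl hab)
  have h0 := tendsto_nhds_unique hlim ((tendsto_congr fun T => by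
    simpa using key T).2 tendsto_const_nhds)
  simp only [sub_zero, zero_add, smul_eq_mul] at h0
  have h1 := mul_left_cancel₀ Complex.I_ne_zero (sub_eq_zero.1 h0)
  simp_rw [add_comm (_ * Complex.I)]
  exact h1.symm

end Contour

/-! ### The weights -/

/-- The function `x ↦ exp(2πix)`. -/
def expTwoPi (x : ℂ) : ℂ := Complex.exp (2 * Real.pi * Complex.I * x)

theorem differentiable_expTwoPi : Differentiable ℂ expTwoPi := by
  unfold expTwoPi; fun_prop

theorem expTwoPi_ne_zero (x : ℂ) : expTwoPi x ≠ 0 := Complex.exp_ne_zero _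

theorem norm_expTwoPi (x : ℂ) : ‖expTwoPi x‖ = Real.exp (-(2 * Real.pi * x.im)) := by
  rw [expTwoPi, Complex.norm_exp]
  congr 1
  simp

theorem expTwoPi_add_one (x : ℂ) : expTwoPi (x + 1) = expTwoPi x := by
  rw [expTwoPi, mul_add, mul_one, Complex.exp_add, Complex.exp_two_pi_mul_I, mul_one, expTwoPi]

theorem expTwoPi_eq_iff {x y : ℂ} : expTwoPi x = expTwoPi y ↔ ∃ n : ℤ, x = y + n := by
  rw [expTwoPi, expTwoPi, Complex.exp_eq_exp_iff_exists_int]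
  refine exists_congr fun n => ?_
  have h : (2 * Real.pi * Complex.I : ℂ) ≠ 0 := Complex.two_pi_I_ne_zero
  rw [show 2 * (Real.pi : ℂ) * Complex.I * y + n * (2 * Real.pi * Complex.I) =
    2 * Real.pi * Complex.I * (y + n) by ring]
  exact mul_right_inj' h

theorem expTwoPi_neg_conj (x : ℂ) :
    expTwoPi (-starRingEnd ℂ x) = starRingEnd ℂ (expTwoPi x) := by
  rw [expTwoPi, expTwoPi, ← Complex.exp_conj]
  simp [Complex.conj_ofNat]

theorem expTwoPi_mul_I (y : ℝ) : expTwoPi (y * Complex.I) = (Real.exp (-(2 * Real.pi * y)) : ℝ) := by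
  rw [expTwoPi, Complex.ofReal_exp]
  congr 1
  push_cast
  linear_combination (2 * Real.pi * y : ℂ) * Complex.I_mul_I

theorem expTwoPi_sub_half (x : ℂ) : expTwoPi (x - 1 / 2) = -expTwoPi x := by
  rw [expTwoPi, show 2 * Real.pi * Complex.I * (x - 1 / 2) =
    2 * Real.pi * Complex.I * x - Real.pi * Complex.I by ring, Complex.exp_sub,
    Complex.exp_pi_mul_I, expTwoPi, div_neg, div_one]

/-- In the closed strip `|Re x| ≤ 1/2`, if `α` lies in the open one, the function
`exp(2πiα) - exp(2πix)` of `x` vanishes at `α` only. -/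
theorem eq_of_expTwoPi_eq {α x : ℂ} (hα : |α.re| < 1 / 2) (hx : |x.re| ≤ 1 / 2)
    (h : expTwoPi α = expTwoPi x) : x = α := by
  obtain ⟨n, hn⟩ := expTwoPi_eq_iff.1 h
  have h1 : α.re = x.re + n := by simpa using congrArg Complex.re hn
  rw [abs_lt] at hα
  rw [abs_le] at hx
  have h2 : (n : ℝ) < 1 := by linarith
  have h3 : (-1 : ℝ) < n := by linarith
  have h4 : n = 0 := by
    have h2' : n < 1 := by exact_mod_cast h2
    have h3' : -1 < n := by exact_mod_cast h3
    omega
  simp [hn, h4]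

/-- The entire function `(exp(2πiα) - exp(2πix)) / (x - α)` of `x`. -/
def expFactor (α x : ℂ) : ℂ := dslope (fun x => expTwoPi α - expTwoPi x) α x

theorem sub_mul_expFactor (α x : ℂ) :
    (x - α) * expFactor α x = expTwoPi α - expTwoPi x := by
  have := sub_smul_dslope (fun x => expTwoPi α - expTwoPi x) α x
  simpa [expFactor] using this

theorem expFactor_self (α : ℂ) : expFactor α α = -(2 * Real.pi * Complex.I * expTwoPi α) := by
  rw [expFactor, dslope_same]
  have h : HasDerivAt (fun x => expTwoPi α - expTwoPi x)
      (-(Complex.exp (2 * Real.pi * Complex.I * α) * (2 * Real.pi * Complex.I * 1))) α :=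
    (((hasDerivAt_id α).const_mul (2 * Real.pi * Complex.I)).cexp).const_sub (expTwoPi α)
  rw [h.deriv, expTwoPi]
  ring

theorem differentiable_expFactor (α : ℂ) : Differentiable ℂ (expFactor α) := by
  rw [← differentiableOn_univ]
  exact (Complex.differentiableOn_dslope Filter.univ_mem).2
    (differentiable_expTwoPi.const_sub _).differentiableOn

theorem expFactor_ne_zero {α x : ℂ} (hα : |α.re| < 1 / 2) (hx : |x.re| ≤ 1 / 2) :
    expFactor α x ≠ 0 := by
  intro h
  have h1 := sub_mul_expFactor α x
  rw [h, mul_zero, eq_comm, sub_eq_zero] at h1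
  have h2 := eq_of_expTwoPi_eq hα hx h1
  rw [h2, expFactor_self, neg_eq_zero] at h
  exact mul_ne_zero Complex.two_pi_I_ne_zero (expTwoPi_ne_zero α) h

/-- In the closed strip, up to a subexponential factor, `1 / expFactor α` is bounded at `+i∞` and
decays like `exp(2π Im x)` at `-i∞`. -/
theorem norm_inv_expFactor_le {α : ℂ} (hα : |α.re| < 1 / 2) {η : ℝ} (hη : 0 < η) :
    ∃ C : ℝ, 0 ≤ C ∧ ∀ x : ℂ, |x.re| ≤ 1 / 2 →
      ‖(expFactor α x)⁻¹‖ * max 1 (Real.exp (-(2 * Real.pi * x.im))) ≤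
        C * Real.exp (η * |x.im|) := by
  have hpi := Real.pi_pos
  set B : ℝ := |α.im| + 1 with hB
  obtain ⟨C₁, hC₁⟩ : ∃ C, ∀ x ∈ Set.Icc (-(1/2) : ℝ) (1/2) ×ℂ Set.Icc (-B) B,
      ‖(expFactor α x)⁻¹ * max 1 (Real.exp (-(2 * Real.pi * x.im)))‖ ≤ C := by
    refine IsCompact.exists_bound_of_continuousOn (isCompact_Icc.reProdIm isCompact_Icc) ?_
    refine ContinuousOn.mul (ContinuousOn.inv₀ (differentiable_expFactor α).continuous.continuousOn
      fun x hx => expFactor_ne_zero hα (abs_le.2 ⟨hx.1.1, hx.1.2⟩)) ?_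
    refine Continuous.continuousOn ?_
    fun_prop
  have hC₁0 : 0 ≤ C₁ := (norm_nonneg _).trans (hC₁ 0 (by
    rw [Complex.mem_reProdIm]; simp; positivity))
  have hlin : ∀ s : ℝ, s ≤ η⁻¹ * Real.exp (η * s) := fun s => by
    rw [inv_mul_eq_div, le_div_iff₀ hη]
    linarith [Real.add_one_le_exp (η * s)]
  have hexp : ∀ p q : ℝ, p + 1 ≤ q →
      2 * Real.exp (-(2 * Real.pi * q)) ≤ Real.exp (-(2 * Real.pi * p)) := fun p q hpq => by
    rw [show -(2 * Real.pi * p) = 2 * Real.pi * (q - p) + -(2 * Real.pi * q) by ring, Real.exp_add]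
    refine mul_le_mul_of_nonneg_right ?_ (Real.exp_pos _).le
    have h1 := Real.add_one_le_exp (2 * Real.pi * (q - p))
    have h2 : 3 ≤ Real.pi := Real.pi_gt_three.le
    nlinarith
  set E : ℝ := Real.exp (-(2 * Real.pi * α.im)) with hE
  have hE0 : 0 < E := Real.exp_pos _
  set m : ℝ := min 1 E / 2 with hm
  have hm0 : 0 < m := by positivity
  refine ⟨C₁ + 2 * η⁻¹ * m⁻¹, by positivity, fun x hx => ?_⟩
  have hone : 1 ≤ Real.exp (η * |x.im|) := Real.one_le_exp (by positivity)
  by_cases hxB : |x.im| ≤ B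
  · have h1 := hC₁ x ⟨abs_le.1 hx, abs_le.1 hxB⟩
    rw [norm_mul] at h1
    have h2 : ‖((max 1 (Real.exp (-(2 * Real.pi * x.im))) : ℝ) : ℂ)‖ =
        max 1 (Real.exp (-(2 * Real.pi * x.im))) := by
      rw [Complex.norm_real, Real.norm_of_nonneg]
      positivity
    rw [h2] at h1
    have h3 : C₁ * 1 ≤ C₁ * Real.exp (η * |x.im|) := mul_le_mul_of_nonneg_left hone hC₁0
    have h4 : 0 ≤ 2 * η⁻¹ * m⁻¹ * Real.exp (η * |x.im|) := by positivity
    linarith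
  push Not at hxB
  have hden : m * max 1 (Real.exp (-(2 * Real.pi * x.im))) ≤ ‖expTwoPi α - expTwoPi x‖ := by
    rcases le_total 0 x.im with h0 | h0
    · rw [abs_of_nonneg h0] at hxB
      have h1 := hexp α.im x.im (by linarith [le_abs_self α.im])
      have h2 := norm_sub_norm_le (expTwoPi α) (expTwoPi x)
      rw [norm_expTwoPi, norm_expTwoPi] at h2
      rw [max_eq_left (Real.exp_le_one_iff.2 (by
        have := mul_nonneg hpi.le h0
        linarith))]
      have h3 : min 1 E ≤ E := min_le_right _ _
      linarith
    · rw [abs_of_nonpos h0] at hxB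
      have h1 := hexp x.im α.im (by linarith [neg_abs_le α.im])
      have h2 := norm_sub_norm_le (expTwoPi x) (expTwoPi α)
      rw [norm_expTwoPi, norm_expTwoPi, norm_sub_rev] at h2
      rw [max_eq_right (Real.one_le_exp (by
        have := mul_nonneg hpi.le (neg_nonneg.2 h0)
        linarith))]
      have h3 : m * Real.exp (-(2 * Real.pi * x.im)) ≤ 1 / 2 * Real.exp (-(2 * Real.pi * x.im)) :=
        mul_le_mul_of_nonneg_right (by linarith [min_le_left 1 E]) (Real.exp_pos _).le
      linarith
  have hnum : ‖x - α‖ ≤ 2 * |x.im| := by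
    have h1 := Complex.norm_le_abs_re_add_abs_im (x - α)
    have h2 : |(x - α).re| ≤ 1 := by
      rw [Complex.sub_re]
      linarith [abs_sub x.re α.re]
    have h3 : |(x - α).im| ≤ |x.im| + |α.im| := abs_sub x.im α.im
    linarith
  have hq := expFactor_ne_zero hα hx
  have h5 := congrArg norm (sub_mul_expFactor α x)
  rw [norm_mul] at h5
  rw [norm_inv, inv_mul_le_iff₀ (norm_pos_iff.2 hq)]
  have h6 : max 1 (Real.exp (-(2 * Real.pi * x.im))) ≤
      m⁻¹ * (2 * |x.im| * ‖expFactor α x‖) := by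
    rw [← div_eq_inv_mul, le_div_iff₀ hm0, mul_comm]
    refine hden.trans (h5.symm.le.trans (mul_le_mul_of_nonneg_right hnum (norm_nonneg _)))
  refine h6.trans ?_
  have h7 := mul_le_mul_of_nonneg_left (hlin |x.im|)
    (by positivity : 0 ≤ 2 * m⁻¹ * ‖expFactor α x‖)
  have h8 : 0 ≤ ‖expFactor α x‖ * (C₁ * Real.exp (η * |x.im|)) := by positivity
  linarith

/-- The product of `norm_inv_expFactor_le` over a multiset. -/
theorem norm_prod_inv_expFactor_le {S : Multiset ℂ} (hS : ∀ α ∈ S, |α.re| < 1 / 2) {η : ℝ}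
    (hη : 0 < η) :
    ∃ C : ℝ, 0 ≤ C ∧ ∀ x : ℂ, |x.re| ≤ 1 / 2 →
      ‖(S.map fun α => (expFactor α x)⁻¹).prod‖ *
        max 1 (Real.exp (-(2 * Real.pi * x.im))) ^ S.card ≤ C * Real.exp (η * |x.im|) := by
  induction S using Multiset.induction_on generalizing η with
  | empty =>
    refine ⟨1, zero_le_one, fun x _ => ?_⟩
    simpa using Real.one_le_exp (by positivity : 0 ≤ η * |x.im|)
  | cons α S ih =>
    obtain ⟨C₁, h1, hC₁⟩ := norm_inv_expFactor_le (hS α (Multiset.mem_cons_self α S))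
      (half_pos hη)
    obtain ⟨C₂, h2, hC₂⟩ := ih (fun β hβ => hS β (Multiset.mem_cons_of_mem hβ)) (half_pos hη)
    refine ⟨C₁ * C₂, mul_nonneg h1 h2, fun x hx => ?_⟩
    rw [Multiset.map_cons, Multiset.prod_cons, Multiset.card_cons, norm_mul, pow_succ,
      show η * |x.im| = η / 2 * |x.im| + η / 2 * |x.im| by ring, Real.exp_add]
    have := mul_le_mul (hC₁ x hx) (hC₂ x hx) (by positivity) (by positivity)
    calc _ = _ := by ring
      _ ≤ _ := this
      _ = _ := by ring

/-- The numerator `exp(2πic(x+1/2)) G(-exp(2πix))` of the quasi-periodic weight. -/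
def weightNum (c : ℝ) (G : ℂ[X]) (x : ℂ) : ℂ :=
  Complex.exp (2 * Real.pi * Complex.I * (c * (x + 1 / 2))) * G.eval (-expTwoPi x)

theorem differentiable_weightNum (c : ℝ) (G : ℂ[X]) : Differentiable ℂ (weightNum c G) := by
  unfold weightNum
  refine Differentiable.mul (by fun_prop) ?_
  exact G.differentiable.comp differentiable_expTwoPi.neg

theorem weightNum_add_one (c : ℝ) (G : ℂ[X]) (x : ℂ) :
    weightNum c G (x + 1) =
      Complex.exp (2 * Real.pi * Complex.I * c) * weightNum c G x := by
  rw [weightNum, expTwoPi_add_one, weightNum, show 2 * Real.pi * Complex.I * (c * (x + 1 + 1 / 2)) =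
    2 * Real.pi * Complex.I * c + 2 * Real.pi * Complex.I * (c * (x + 1 / 2)) by ring,
    Complex.exp_add, mul_assoc]

/-- The condition on the numerator that makes the weight decay at both ends of the strip. -/
def IsWeightNumerator (c : ℝ) (l : ℕ) (G : ℂ[X]) : Prop :=
  G.degree < (l : WithBot ℕ) ∧ (c = 0 → G.coeff 0 = 0)

/-- The rate at which the weights decay. In terms of `ξ = e^{2πix}`, the numerators are combinations
of `ξ^{c+k}`, where `c + k ≤ c + l - 1` falls short of the degree `l` of the denominator by at least
`1 - c`, and `c + k ≥ c`, with `k ≥ 1` if `c = 0`. -/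
def decayRate (c : ℝ) : ℝ := min (1 - c) (if c = 0 then 1 else c)

theorem decayRate_pos {c : ℝ} (hc0 : 0 ≤ c) (hc1 : c < 1) : 0 < decayRate c := by
  refine lt_min (by linarith) ?_
  split_ifs with h
  · exact one_pos
  · exact lt_of_le_of_ne hc0 (Ne.symm h)

theorem norm_weightNum_le {c : ℝ} (hc0 : 0 ≤ c) {l : ℕ} {G : ℂ[X]}
    (hG : IsWeightNumerator c l G) :
    ∃ C : ℝ, 0 ≤ C ∧ ∀ x : ℂ, ‖weightNum c G x‖ ≤
      C * (Real.exp (-(2 * Real.pi * decayRate c * |x.im|)) *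
        max 1 (Real.exp (-(2 * Real.pi * x.im))) ^ l) := by
  have hpi := Real.pi_pos
  refine ⟨∑ k ∈ G.support, ‖G.coeff k‖, Finset.sum_nonneg fun _ _ => norm_nonneg _, fun x => ?_⟩
  rw [weightNum, eval_eq_sum, Polynomial.sum, Finset.mul_sum, Finset.sum_mul]
  refine norm_sum_le_of_le _ fun k hk => ?_
  have hk0 := mem_support_iff.1 hk
  have hkl : (k : ℝ) + 1 ≤ l := by
    have : k < l := by
      have := (le_degree_of_ne_zero hk0).trans_lt hG.1
      exact_mod_cast this
    exact_mod_cast this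
  have hκ1 : decayRate c ≤ 1 - c := min_le_left _ _
  have hκ2 : decayRate c ≤ c + k := by
    refine (min_le_right _ _).trans ?_
    split_ifs with h
    · have : k ≠ 0 := fun h' => hk0 (h' ▸ hG.2 h)
      have : (1 : ℝ) ≤ k := by exact_mod_cast Nat.one_le_iff_ne_zero.2 this
      linarith
    · linarith [(Nat.cast_nonneg k : (0 : ℝ) ≤ k)]
  rw [norm_mul, norm_mul, norm_pow, norm_neg, norm_expTwoPi, Complex.norm_exp, mul_left_comm]
  refine mul_le_mul_of_nonneg_left ?_ (norm_nonneg _)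
  rw [show (2 * Real.pi * Complex.I * (c * (x + 1 / 2)) : ℂ).re = -(2 * Real.pi * c * x.im) by
    simp; ring, ← Real.exp_nat_mul, ← Real.exp_add]
  rcases le_total 0 x.im with h0 | h0
  · have h1 : (1 : ℝ) ≤ max 1 (Real.exp (-(2 * Real.pi * x.im))) ^ l :=
      one_le_pow₀ (le_max_left _ _)
    refine le_trans (Real.exp_le_exp.2 ?_) (le_mul_of_one_le_right (Real.exp_pos _).le h1)
    rw [abs_of_nonneg h0]
    have := mul_le_mul_of_nonneg_left hκ2 (mul_nonneg hpi.le h0)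
    linarith
  · refine le_trans ?_ (mul_le_mul_of_nonneg_left (pow_le_pow_left₀ (Real.exp_pos _).le
      (le_max_right 1 (Real.exp (-(2 * Real.pi * x.im)))) l) (Real.exp_pos _).le)
    rw [← Real.exp_nat_mul, ← Real.exp_add, abs_of_nonpos h0]
    refine Real.exp_le_exp.2 ?_
    have := mul_le_mul_of_nonneg_left (show c + k ≤ l - decayRate c by linarith)
      (mul_nonneg hpi.le (neg_nonneg.2 h0))
    linarith

/-- The product of the weight with the polynomial of its poles in the open strip; it is regular in
the closed strip. -/
def weightKernel (c : ℝ) (S : Multiset ℂ) (G : ℂ[X]) (x : ℂ) : ℂ :=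
  weightNum c G x * (S.map fun α => (expFactor α x)⁻¹).prod

theorem differentiableAt_weightKernel (c : ℝ) {S : Multiset ℂ} (hS : ∀ α ∈ S, |α.re| < 1 / 2)
    (G : ℂ[X]) {x : ℂ} (hx : |x.re| ≤ 1 / 2) : DifferentiableAt ℂ (weightKernel c S G) x := by
  refine DifferentiableAt.mul (differentiable_weightNum c G x) ?_
  induction S using Multiset.induction_on with
  | empty => simp
  | cons α S ih =>
    simp only [Multiset.map_cons, Multiset.prod_cons]
    refine DifferentiableAt.mul ?_ (ih fun β hβ => hS β (Multiset.mem_cons_of_mem hβ))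
    exact (differentiable_expFactor α x).inv
      (expFactor_ne_zero (hS α (Multiset.mem_cons_self α S)) hx)

theorem norm_weightKernel_le {c : ℝ} (hc0 : 0 ≤ c) (hc1 : c < 1) {S : Multiset ℂ}
    (hS : ∀ α ∈ S, |α.re| < 1 / 2) {G : ℂ[X]} (hG : IsWeightNumerator c S.card G) :
    ∃ C : ℝ, 0 ≤ C ∧ ∀ x : ℂ, |x.re| ≤ 1 / 2 →
      ‖weightKernel c S G x‖ ≤ C * Real.exp (-(Real.pi * decayRate c * |x.im|)) := by
  obtain ⟨C₁, h1, hC₁⟩ := norm_weightNum_le hc0 hG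
  obtain ⟨C₂, h2, hC₂⟩ := norm_prod_inv_expFactor_le hS
    (mul_pos Real.pi_pos (decayRate_pos hc0 hc1))
  refine ⟨C₁ * C₂, mul_nonneg h1 h2, fun x hx => ?_⟩
  rw [weightKernel, norm_mul]
  set M : ℝ := max 1 (Real.exp (-(2 * Real.pi * x.im))) ^ S.card
  refine (mul_le_mul_of_nonneg_right (hC₁ x) (norm_nonneg _)).trans ?_
  calc _ = C₁ * Real.exp (-(2 * Real.pi * decayRate c * |x.im|)) *
        (‖(S.map fun α => (expFactor α x)⁻¹).prod‖ * M) := by ring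
    _ ≤ C₁ * Real.exp (-(2 * Real.pi * decayRate c * |x.im|)) *
        (C₂ * Real.exp (Real.pi * decayRate c * |x.im|)) :=
      mul_le_mul_of_nonneg_left (hC₂ x hx) (by positivity)
    _ = C₁ * C₂ * (Real.exp (-(2 * Real.pi * decayRate c * |x.im|)) *
        Real.exp (Real.pi * decayRate c * |x.im|)) := by ring
    _ = _ := by
      rw [← Real.exp_add]
      congr 2
      ring

/-! ### The functionals defined by the weights -/

/-- The monic polynomial with the given multiset of roots. -/
def rootPoly (S : Multiset ℂ) : ℂ[X] := (S.map fun α => X - C α).prod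

theorem monic_rootPoly (S : Multiset ℂ) : (rootPoly S).Monic :=
  monic_multiset_prod_of_monic _ _ fun α _ => monic_X_sub_C α

theorem natDegree_rootPoly (S : Multiset ℂ) : (rootPoly S).natDegree = S.card :=
  natDegree_multiset_prod_X_sub_C_eq_card S

theorem eval_rootPoly (S : Multiset ℂ) (x : ℂ) :
    (rootPoly S).eval x = (S.map fun α => x - α).prod := by
  rw [rootPoly, eval_multiset_prod, Multiset.map_map]
  simp

/-- The weight `w(y) = W(iy - 1/2)`, where `W` is the quasi-periodic function with simple
denominators `exp(2πiα) - exp(2πix)`, `α ∈ S`. -/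
def weight (c : ℝ) (S : Multiset ℂ) (G : ℂ[X]) (y : ℝ) : ℂ :=
  weightNum c G (y * Complex.I - 1 / 2) *
    (S.map fun α => (expTwoPi α - expTwoPi (y * Complex.I - 1 / 2))⁻¹).prod

theorem eval_rootPoly_mul_eq_weightKernel (c : ℝ) {S : Multiset ℂ} (G : ℂ[X]) {x : ℂ}
    (hx : x ∉ S) :
    (rootPoly S).eval x * (weightNum c G x *
      (S.map fun α => (expTwoPi α - expTwoPi x)⁻¹).prod) = weightKernel c S G x := by
  rw [weightKernel, mul_left_comm, eval_rootPoly, ← Multiset.prod_map_mul]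
  congr 2
  refine Multiset.map_congr rfl fun α hα => ?_
  have h : x - α ≠ 0 := sub_ne_zero.2 fun h => hx (h ▸ hα)
  rw [← sub_mul_expFactor, mul_inv, mul_inv_cancel_left₀ h]

theorem expTwoPi_mul_I_sub_half (y : ℝ) :
    expTwoPi (y * Complex.I - 1 / 2) = -(Real.exp (-(2 * Real.pi * y)) : ℝ) := by
  rw [expTwoPi_sub_half, expTwoPi_mul_I]

theorem expTwoPi_mul_I_add_half (y : ℝ) :
    expTwoPi (y * Complex.I + 1 / 2) = expTwoPi (y * Complex.I - 1 / 2) := by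
  rw [← expTwoPi_add_one (y * Complex.I - 1 / 2)]
  congr 1; ring

theorem weight_eq (c : ℝ) (S : Multiset ℂ) (G : ℂ[X]) (y : ℝ) :
    weight c S G y = (Real.exp (-(2 * Real.pi * y)) ^ c : ℝ) *
      G.eval ((Real.exp (-(2 * Real.pi * y)) : ℝ) : ℂ) *
      (S.map fun α => (expTwoPi α + (Real.exp (-(2 * Real.pi * y)) : ℝ))⁻¹).prod := by
  have h : 2 * Real.pi * Complex.I * (c * (y * Complex.I - 1 / 2 + 1 / 2)) =
      ((-(2 * Real.pi * y) * c : ℝ) : ℂ) := by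
    push_cast
    linear_combination (2 * Real.pi * c * y : ℂ) * Complex.I_mul_I
  rw [weight, weightNum, expTwoPi_mul_I_sub_half, neg_neg, ← Real.exp_mul, h, ← Complex.ofReal_exp]
  simp only [sub_neg_eq_add]

theorem expTwoPi_add_exp_ne_zero {α : ℂ} (hα : |α.re| < 1 / 2) (y : ℝ) :
    expTwoPi α + (Real.exp (-(2 * Real.pi * y)) : ℝ) ≠ 0 := by
  intro h
  have h1 := eq_of_expTwoPi_eq (x := y * Complex.I - 1 / 2) hα (by norm_num)
    (by rw [expTwoPi_mul_I_sub_half]; exact eq_neg_of_add_eq_zero_left h)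
  rw [← h1] at hα
  norm_num at hα

theorem continuous_weight (c : ℝ) {S : Multiset ℂ} (hS : ∀ α ∈ S, |α.re| < 1 / 2) (G : ℂ[X]) :
    Continuous (weight c S G) := by
  unfold weight
  refine Continuous.mul ((differentiable_weightNum c G).continuous.comp (by fun_prop)) ?_
  refine continuous_multiset_prod _ fun α hα => Continuous.inv₀ ?_ fun y => ?_
  · exact (continuous_const.sub (differentiable_expTwoPi.continuous.comp (by fun_prop)))
  · rw [expTwoPi_mul_I_sub_half, sub_neg_eq_add]
    exact expTwoPi_add_exp_ne_zero (hS α hα) y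

section Functional

open MeasureTheory

theorem expIntegrable_of_norm_le {w : ℝ → ℂ} (hw : Continuous w) {C δ : ℝ} (hδ : 0 < δ)
    (h : ∀ y, ‖w y‖ ≤ C * Real.exp (-(2 * δ * |y|))) : ExpIntegrable δ w volume := by
  refine ⟨hw.aestronglyMeasurable, ((integrable_exp_neg_mul_abs hδ).const_mul C).mono'
    (Continuous.aestronglyMeasurable (by fun_prop)) (Filter.Eventually.of_forall fun y => ?_)⟩
  rw [norm_mul, norm_norm, Real.norm_eq_abs, Real.abs_exp]
  refine (mul_le_mul_of_nonneg_right (h y) (Real.exp_pos _).le).trans_eq ?_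
  rw [mul_assoc, ← Real.exp_add]
  congr 2
  ring

theorem exists_le_norm_eval_rootPoly {S : Multiset ℂ} (hS : ∀ α ∈ S, |α.re| < 1 / 2) :
    ∃ m : ℝ, 0 < m ∧ ∀ y : ℝ, m ≤ ‖(rootPoly S).eval (y * Complex.I - 1 / 2)‖ := by
  induction S using Multiset.induction_on with
  | empty => exact ⟨1, one_pos, fun y => by simp [rootPoly]⟩
  | cons α S ih =>
    obtain ⟨m, hm, h⟩ := ih fun β hβ => hS β (Multiset.mem_cons_of_mem hβ)
    have hα := (abs_lt.1 (hS α (Multiset.mem_cons_self α S))).1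
    refine ⟨(1 / 2 + α.re) * m, mul_pos (by linarith) hm, fun y => ?_⟩
    rw [eval_rootPoly, Multiset.map_cons, Multiset.prod_cons, norm_mul, ← eval_rootPoly]
    refine mul_le_mul ?_ (h y) hm.le (norm_nonneg _)
    refine le_trans ?_ (Complex.abs_re_le_norm _)
    rw [← abs_neg]
    refine le_trans (le_of_eq ?_) (le_abs_self _)
    simp; ring

theorem notMem_of_abs_re_eq {S : Multiset ℂ} (hS : ∀ α ∈ S, |α.re| < 1 / 2) {x : ℂ}
    (hx : |x.re| = 1 / 2) : x ∉ S := fun h => (hS x h).ne hx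

theorem expIntegrable_weight {c : ℝ} (hc0 : 0 ≤ c) (hc1 : c < 1) {S : Multiset ℂ}
    (hS : ∀ α ∈ S, |α.re| < 1 / 2) {G : ℂ[X]} (hG : IsWeightNumerator c S.card G) :
    ExpIntegrable (Real.pi * decayRate c / 2) (weight c S G) volume := by
  obtain ⟨C, hC, h⟩ := norm_weightKernel_le hc0 hc1 hS hG
  obtain ⟨m, hm, hm'⟩ := exists_le_norm_eval_rootPoly hS
  have hκ := decayRate_pos hc0 hc1
  refine expIntegrable_of_norm_le (continuous_weight c hS G) (C := m⁻¹ * C)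
    (by have := Real.pi_pos; positivity) fun y => ?_
  have hre : |(y * Complex.I - 1 / 2 : ℂ).re| = 1 / 2 := by norm_num
  have h1 := h (y * Complex.I - 1 / 2) hre.le
  rw [← eval_rootPoly_mul_eq_weightKernel c G (notMem_of_abs_re_eq hS hre), norm_mul] at h1
  have h2 := (mul_le_mul_of_nonneg_right (hm' y) (norm_nonneg (weight c S G y))).trans h1
  rw [← le_div_iff₀' hm] at h2
  refine h2.trans_eq ?_
  rw [div_eq_inv_mul, ← mul_assoc]
  congr 2
  simp
  left; ring

theorem continuous_weightKernel_mul_I (c : ℝ) {S : Multiset ℂ} (hS : ∀ α ∈ S, |α.re| < 1 / 2)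
    (G : ℂ[X]) : Continuous fun y : ℝ => weightKernel c S G (y * Complex.I) := by
  refine continuous_iff_continuousAt.2 fun y => ?_
  exact ContinuousAt.comp (g := weightKernel c S G) (f := fun y : ℝ => (y : ℂ) * Complex.I)
    (differentiableAt_weightKernel c hS G (by simp)).continuousAt (by fun_prop)

theorem expIntegrable_weightKernel {c : ℝ} (hc0 : 0 ≤ c) (hc1 : c < 1) {S : Multiset ℂ}
    (hS : ∀ α ∈ S, |α.re| < 1 / 2) {G : ℂ[X]} (hG : IsWeightNumerator c S.card G) :
    ExpIntegrable (Real.pi * decayRate c / 2) (fun y : ℝ => weightKernel c S G (y * Complex.I))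
      volume := by
  obtain ⟨C, hC, h⟩ := norm_weightKernel_le hc0 hc1 hS hG
  have hκ := decayRate_pos hc0 hc1
  refine expIntegrable_of_norm_le (continuous_weightKernel_mul_I c hS G) (C := C)
    (by have := Real.pi_pos; positivity) fun y => ?_
  refine (h (y * Complex.I) (by simp)).trans_eq ?_
  congr 2
  simp
  left; ring

/-- Moving the contour inside the strip. -/
theorem integral_weightKernel_mul_eval {c : ℝ} (hc0 : 0 ≤ c) (hc1 : c < 1) {S : Multiset ℂ}
    (hS : ∀ α ∈ S, |α.re| < 1 / 2) {G : ℂ[X]} (hG : IsWeightNumerator c S.card G) (f : ℂ[X])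
    {a b : ℝ} (ha : -(1 / 2) ≤ a) (hab : a ≤ b) (hb : b ≤ 1 / 2) :
    ∫ y : ℝ, weightKernel c S G (y * Complex.I + a) * f.eval (y * Complex.I + a) =
      ∫ y : ℝ, weightKernel c S G (y * Complex.I + b) * f.eval (y * Complex.I + b) := by
  obtain ⟨C, hC, h⟩ := norm_weightKernel_le hc0 hc1 hS hG
  have hδ : 0 < Real.pi * decayRate c / 2 := by
    have := decayRate_pos hc0 hc1
    have := Real.pi_pos
    positivity
  obtain ⟨B, hB, h'⟩ := exists_norm_eval_le_exp f (r := 1 / 2) (by norm_num) hδ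
  have hre : ∀ x : ℂ, a ≤ x.re → x.re ≤ b → |x.re| ≤ 1 / 2 := fun x h1 h2 =>
    abs_le.2 ⟨ha.trans h1, h2.trans hb⟩
  refine integral_vertical_line_eq (h := fun x => weightKernel c S G x * f.eval x) (C := C * B)
    hδ hab (fun x h1 h2 => ?_) fun x h1 h2 => ?_
  · exact (differentiableAt_weightKernel c hS G (hre x h1 h2)).mul f.differentiableAt
  · rw [norm_mul]
    refine (mul_le_mul (h x (hre x h1 h2)) (h' x (hre x h1 h2)) (norm_nonneg _)
      (by positivity)).trans_eq ?_
    rw [mul_mul_mul_comm, ← Real.exp_add]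
    congr 2
    ring

/-- The functional `R ↦ ∫ w(y) R(iy) dy` of a weight. -/
def weightFunctional {c : ℝ} (hc0 : 0 ≤ c) (hc1 : c < 1) {S : Multiset ℂ}
    (hS : ∀ α ∈ S, |α.re| < 1 / 2) {G : ℂ[X]} (hG : IsWeightNumerator c S.card G) :
    ℂ[X] →ₗ[ℂ] ℂ :=
  momentFunctional (by have := decayRate_pos hc0 hc1; have := Real.pi_pos; positivity)
    (expIntegrable_weight hc0 hc1 hS hG)

theorem weightFunctional_apply {c : ℝ} (hc0 : 0 ≤ c) (hc1 : c < 1) {S : Multiset ℂ}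
    (hS : ∀ α ∈ S, |α.re| < 1 / 2) {G : ℂ[X]} (hG : IsWeightNumerator c S.card G) (R : ℂ[X]) :
    weightFunctional hc0 hc1 hS hG R = ∫ y : ℝ, weight c S G y * R.eval (y * Complex.I) := rfl

/-- Moving the contour to the imaginary axis turns the weight into the kernel. -/
theorem weightFunctional_taylor {c : ℝ} (hc0 : 0 ≤ c) (hc1 : c < 1) {S : Multiset ℂ}
    (hS : ∀ α ∈ S, |α.re| < 1 / 2) {G : ℂ[X]} (hG : IsWeightNumerator c S.card G) (f : ℂ[X]) :
    weightFunctional hc0 hc1 hS hG (taylor (-(1 / 2)) (f * rootPoly S)) =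
      ∫ y : ℝ, weightKernel c S G (y * Complex.I) * f.eval (y * Complex.I) := by
  have h := integral_weightKernel_mul_eval hc0 hc1 hS hG f (a := -(1 / 2)) (b := 0) le_rfl
    (by norm_num) (by norm_num)
  simp only [Complex.ofReal_zero, add_zero] at h
  rw [weightFunctional_apply, ← h]
  congr 1
  ext y
  have hre : |(y * Complex.I - 1 / 2 : ℂ).re| = 1 / 2 := by norm_num
  rw [show ((-(1 / 2) : ℝ) : ℂ) = -(1 / 2) by push_cast; rfl, taylor_eval, eval_mul,
    ← sub_eq_add_neg, ← eval_rootPoly_mul_eq_weightKernel c G (notMem_of_abs_re_eq hS hre), weight]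
  ring

theorem isTwisted_weightFunctional {c : ℝ} (hc0 : 0 ≤ c) (hc1 : c < 1) {S : Multiset ℂ}
    (hS : ∀ α ∈ S, |α.re| < 1 / 2) {G : ℂ[X]} (hG : IsWeightNumerator c S.card G) :
    IsTwisted (Complex.exp (2 * Real.pi * Complex.I * c)) (rootPoly S)
      (weightFunctional hc0 hc1 hS hG) := by
  intro f
  have h := integral_weightKernel_mul_eval hc0 hc1 hS hG f (a := 0) (b := 1 / 2) (by norm_num)
    (by norm_num) le_rfl
  simp only [Complex.ofReal_zero, add_zero] at h
  rw [weightFunctional_taylor, h, weightFunctional_apply, ← integral_const_mul]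
  congr 1
  ext y
  have hre : |(y * Complex.I + 1 / 2 : ℂ).re| = 1 / 2 := by norm_num
  have hN : weightNum c G (y * Complex.I + 1 / 2) =
      Complex.exp (2 * Real.pi * Complex.I * c) * weightNum c G (y * Complex.I - 1 / 2) := by
    rw [← weightNum_add_one]
    congr 1; ring
  rw [show ((1 / 2 : ℝ) : ℂ) = 1 / 2 by push_cast; rfl, taylor_eval, eval_mul,
    ← eval_rootPoly_mul_eq_weightKernel c G (notMem_of_abs_re_eq hS hre), weight, hN,
    expTwoPi_mul_I_add_half]
  ring

end Functional

/-! ### Signs of the weights -/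

/-- A product over a multiset stable under `α ↦ -conj α` is positive as soon as the factors at
imaginary `α` are, and the factors at `α` and `-conj α` are conjugate. -/
theorem exists_pos_prod_of_symmetric {S : Multiset ℂ} (hS : S.map (fun α => -starRingEnd ℂ α) = S)
    {g : ℂ → ℂ} (hg : ∀ α ∈ S, g (-starRingEnd ℂ α) = starRingEnd ℂ (g α))
    (h0 : ∀ α ∈ S, g α ≠ 0) (hpos : ∀ α ∈ S, α.re = 0 → ∃ r : ℝ, 0 < r ∧ g α = r) :
    ∃ r : ℝ, 0 < r ∧ (S.map g).prod = r := by
  have himag : ∃ r : ℝ, 0 < r ∧ ((S.filter fun α => α.re = 0).map g).prod = r := by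
    have : ∀ T : Multiset ℂ, (∀ α ∈ T, ∃ r : ℝ, 0 < r ∧ g α = r) →
        ∃ r : ℝ, 0 < r ∧ (T.map g).prod = r := by
      intro T
      induction T using Multiset.induction_on with
      | empty => exact fun _ => ⟨1, one_pos, by simp⟩
      | cons α T ih =>
        intro h
        obtain ⟨r, hr, e⟩ := h α (Multiset.mem_cons_self α T)
        obtain ⟨s, hs, e'⟩ := ih fun β hβ => h β (Multiset.mem_cons_of_mem hβ)
        exact ⟨r * s, mul_pos hr hs, by
          rw [Multiset.map_cons, Multiset.prod_cons, e, e', Complex.ofReal_mul]⟩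
    refine this _ fun α hα => ?_
    rw [Multiset.mem_filter] at hα
    exact hpos α hα.1 hα.2
  obtain ⟨r, hr, hr'⟩ := himag
  set L := S.filter fun α => α.re < 0 with hL
  have hR : (S.filter fun α => 0 < α.re) = L.map fun α => -starRingEnd ℂ α := by
    conv_lhs => rw [← hS]
    rw [Multiset.filter_map, hL]
    congr 1
    refine Multiset.filter_congr fun α _ => ?_
    simp
  have hRprod : ((S.filter fun α => 0 < α.re).map g).prod = starRingEnd ℂ (L.map g).prod := by
    rw [hR, Multiset.map_map, map_multiset_prod, Multiset.map_map]
    congr 1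
    exact Multiset.map_congr rfl fun α hα => hg α (Multiset.mem_filter.1 hα).1
  have hsplit : S = L + (S.filter (fun α => α.re = 0) + S.filter fun α => 0 < α.re) := by
    conv_lhs => rw [← Multiset.filter_add_not (fun α : ℂ => α.re < 0) S]
    congr 1
    conv_lhs => rw [← Multiset.filter_add_not (fun α : ℂ => α.re = 0)
      (S.filter fun α : ℂ => ¬ α.re < 0)]
    rw [Multiset.filter_filter, Multiset.filter_filter]
    congr 1 <;> refine Multiset.filter_congr fun α _ => ?_
    · constructor
      · exact fun h => h.1
      · exact fun h => ⟨h, by rw [h]; exact lt_irrefl _⟩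
    · rw [not_lt, and_comm, lt_iff_le_and_ne, ne_comm]
  refine ⟨r * Complex.normSq (L.map g).prod, mul_pos hr (Complex.normSq_pos.2 ?_), ?_⟩
  · rw [Ne, Multiset.prod_eq_zero_iff, Multiset.mem_map]
    rintro ⟨α, hα, h⟩
    exact h0 α (Multiset.mem_filter.1 hα).1 h
  · conv_lhs => rw [hsplit]
    rw [Multiset.map_add, Multiset.map_add, Multiset.prod_add, Multiset.prod_add, hr', hRprod,
      Complex.ofReal_mul, ← Complex.mul_conj]
    ring

theorem exists_pos_prod_expTwoPi_add {S : Multiset ℂ} (hS : ∀ α ∈ S, |α.re| < 1 / 2)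
    (hσ : S.map (fun α => -starRingEnd ℂ α) = S) (y : ℝ) :
    ∃ r : ℝ, 0 < r ∧
      (S.map fun α => (expTwoPi α + (Real.exp (-(2 * Real.pi * y)) : ℝ))⁻¹).prod = r := by
  refine exists_pos_prod_of_symmetric hσ (fun α _ => ?_)
    (fun α hα => inv_ne_zero (expTwoPi_add_exp_ne_zero (hS α hα) y)) (fun α _ h => ?_)
  · rw [expTwoPi_neg_conj, map_inv₀, map_add, Complex.conj_ofReal]
  · obtain ⟨b, rfl⟩ : ∃ b : ℝ, α = b * Complex.I := ⟨α.im, by apply Complex.ext <;> simp [h]⟩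
    refine ⟨(Real.exp (-(2 * Real.pi * b)) + Real.exp (-(2 * Real.pi * y)))⁻¹, by positivity, ?_⟩
    rw [expTwoPi_mul_I]
    push_cast
    simp

theorem add_mul_I_mul_expFactor (α : ℂ) (y : ℝ) :
    (y + Complex.I * α) * (Complex.I * expFactor α (y * Complex.I)) =
      expTwoPi α - expTwoPi (y * Complex.I) := by
  have h := sub_mul_expFactor α (y * Complex.I)
  have h' : (y + Complex.I * α) * Complex.I = y * Complex.I - α := by
    linear_combination α * Complex.I_mul_I
  rw [← mul_assoc, h', h]

/-- The regularized factors are positive on the imaginary axis, up to a power of `i`. -/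
theorem exists_pos_prod_expFactor {S : Multiset ℂ} (hS : ∀ α ∈ S, |α.re| < 1 / 2)
    (hσ : S.map (fun α => -starRingEnd ℂ α) = S) (y : ℝ) :
    ∃ r : ℝ, 0 < r ∧ (S.map fun α => (Complex.I * expFactor α (y * Complex.I))⁻¹).prod = r := by
  have hpi := Real.pi_pos
  refine exists_pos_prod_of_symmetric hσ (fun α _ => ?_) (fun α hα => inv_ne_zero
    (mul_ne_zero Complex.I_ne_zero (expFactor_ne_zero (hS α hα) (by simp)))) (fun α _ h => ?_)
  · rw [map_inv₀]
    refine congrArg Inv.inv ?_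
    by_cases hy : y + Complex.I * α = 0
    · have : α = y * Complex.I := by
        linear_combination -Complex.I * hy + α * Complex.I_mul_I
      have h' : -starRingEnd ℂ (y * Complex.I) = y * Complex.I := by simp
      rw [this, h', expFactor_self, expTwoPi_mul_I]
      simp only [map_mul, map_neg, Complex.conj_I, Complex.conj_ofReal, Complex.conj_ofNat]
      ring
    · have h1 := add_mul_I_mul_expFactor α y
      have h2 := add_mul_I_mul_expFactor (-starRingEnd ℂ α) y
      have h3 : (y + Complex.I * -starRingEnd ℂ α : ℂ) = starRingEnd ℂ (y + Complex.I * α) := by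
        simp
      have h4 : starRingEnd ℂ (expTwoPi (y * Complex.I)) = expTwoPi (y * Complex.I) := by
        rw [expTwoPi_mul_I, Complex.conj_ofReal]
      rw [h3, expTwoPi_neg_conj, ← h4, ← map_sub, ← h1, map_mul] at h2
      exact mul_left_cancel₀ ((map_ne_zero (starRingEnd ℂ)).2 hy) h2
  · obtain ⟨b, rfl⟩ : ∃ b : ℝ, α = b * Complex.I := ⟨α.im, by apply Complex.ext <;> simp [h]⟩
    by_cases hy : y = b
    · subst hy
      refine ⟨(2 * Real.pi * Real.exp (-(2 * Real.pi * y)))⁻¹, by positivity, ?_⟩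
      rw [expFactor_self, expTwoPi_mul_I, Complex.ofReal_inv]
      congr 1
      push_cast
      linear_combination -(2 * Real.pi * Complex.exp (-(2 * Real.pi * y)) : ℂ) * Complex.I_mul_I
    · refine ⟨(y - b) / (Real.exp (-(2 * Real.pi * b)) - Real.exp (-(2 * Real.pi * y))), ?_, ?_⟩
      · rcases lt_or_gt_of_ne hy with h1 | h1
        · refine div_pos_of_neg_of_neg (by linarith) (sub_neg.2 (Real.exp_lt_exp.2 ?_))
          nlinarith
        · refine div_pos (by linarith) (sub_pos.2 (Real.exp_lt_exp.2 ?_))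
          nlinarith
      · have h1 := add_mul_I_mul_expFactor (b * Complex.I) y
        have h2 : (y + Complex.I * (b * Complex.I) : ℂ) = ((y - b : ℝ) : ℂ) := by
          push_cast
          linear_combination (b : ℂ) * Complex.I_mul_I
        have h3 : ((y - b : ℝ) : ℂ) ≠ 0 := by
          exact_mod_cast sub_ne_zero.2 hy
        rw [h2, expTwoPi_mul_I, expTwoPi_mul_I] at h1
        rw [Complex.ofReal_div, Complex.ofReal_sub (Real.exp _), ← h1, div_mul_eq_div_div,
          div_self h3, one_div]

theorem exists_pos_prod_add_I_mul {O : Multiset ℂ} (hO : ∀ α ∈ O, α.re ≠ 0)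
    (hσ : O.map (fun α => -starRingEnd ℂ α) = O) (y : ℝ) :
    ∃ r : ℝ, 0 < r ∧ (O.map fun α => (y + Complex.I * α : ℂ)).prod = r := by
  refine exists_pos_prod_of_symmetric hσ (fun α _ => by simp) (fun α hα h => hO α hα ?_)
    (fun α hα h => (hO α hα h).elim)
  simpa using congrArg Complex.im h

/-- The sign of the density on the imaginary axis to which `weightFunctional_taylor` leads. -/
theorem exists_pos_eval_rootPoly_mul_weightKernel (c : ℝ) {S O : Multiset ℂ}
    (hS : ∀ α ∈ S, |α.re| < 1 / 2) (hSσ : S.map (fun α => -starRingEnd ℂ α) = S)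
    (hO : ∀ α ∈ O, α.re ≠ 0) (hOσ : O.map (fun α => -starRingEnd ℂ α) = O) (y : ℝ) :
    ∃ r : ℝ, 0 < r ∧ ∀ G : ℂ[X],
      (Complex.I ^ (S.card + O.card))⁻¹ * Complex.exp (-(Real.pi * Complex.I * c)) *
        ((rootPoly O).eval (y * Complex.I) * weightKernel c S G (y * Complex.I)) =
      r * G.eval (-(Real.exp (-(2 * Real.pi * y)) : ℝ) : ℂ) := by
  obtain ⟨r, hr, hr'⟩ := exists_pos_prod_expFactor hS hSσ y
  obtain ⟨s, hs, hs'⟩ := exists_pos_prod_add_I_mul hO hOσ y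
  refine ⟨r * s * Real.exp (-(2 * Real.pi * c * y)), by positivity, fun G => ?_⟩
  have hI : ∀ T : Multiset ℂ, (T.map fun _ => Complex.I).prod = Complex.I ^ T.card := fun T => by
    rw [Multiset.map_const', Multiset.prod_replicate]
  have h1 : (rootPoly O).eval (y * Complex.I) = Complex.I ^ O.card * s := by
    rw [eval_rootPoly, ← hs', ← hI, ← Multiset.prod_map_mul]
    congr 1
    refine Multiset.map_congr rfl fun α _ => ?_
    linear_combination -α * Complex.I_mul_I
  have h2 : (S.map fun α => (expFactor α (y * Complex.I))⁻¹).prod = Complex.I ^ S.card * r := by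
    rw [← hr', ← hI, ← Multiset.prod_map_mul]
    congr 1
    refine Multiset.map_congr rfl fun α _ => ?_
    rw [mul_inv, mul_inv_cancel_left₀ Complex.I_ne_zero]
  have h3 : Complex.exp (2 * Real.pi * Complex.I * (c * (y * Complex.I + 1 / 2))) =
      Complex.exp (Real.pi * Complex.I * c) * Real.exp (-(2 * Real.pi * c * y)) := by
    rw [Complex.ofReal_exp, ← Complex.exp_add]
    congr 1
    push_cast
    linear_combination (2 * Real.pi * c * y : ℂ) * Complex.I_mul_I
  have h4 : Complex.exp (-(Real.pi * Complex.I * c)) * Complex.exp (Real.pi * Complex.I * c) = 1 := by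
    rw [← Complex.exp_add, neg_add_cancel, Complex.exp_zero]
  have h5 : (Complex.I ^ (S.card + O.card))⁻¹ * (Complex.I ^ O.card * Complex.I ^ S.card) = 1 := by
    rw [← pow_add, add_comm]
    exact inv_mul_cancel₀ (pow_ne_zero _ Complex.I_ne_zero)
  rw [weightKernel, weightNum, h1, h2, h3, expTwoPi_mul_I]
  push_cast
  linear_combination (r * s * Complex.exp (-(2 * Real.pi * c * y)) *
    G.eval (-Complex.exp (-(2 * Real.pi * y)))) * ((Complex.I ^ (S.card + O.card))⁻¹ *
    (Complex.I ^ O.card * Complex.I ^ S.card) * h4 + h5)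

/-! ### The roots of the parameter -/

/-- The roots in the open strip. -/
def stripRoots (P : ℂ[X]) : Multiset ℂ := P.roots.filter fun α => |α.re| < 1 / 2

/-- The roots outside the open strip. -/
def outerRoots (P : ℂ[X]) : Multiset ℂ := P.roots.filter fun α => ¬ |α.re| < 1 / 2

theorem abs_re_lt_of_mem_stripRoots {P : ℂ[X]} : ∀ α ∈ stripRoots P, |α.re| < 1 / 2 :=
  fun _ h => (Multiset.mem_filter.1 h).2

theorem le_abs_re_of_mem_outerRoots {P : ℂ[X]} : ∀ α ∈ outerRoots P, 1 / 2 ≤ |α.re| :=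
  fun _ h => not_lt.1 (Multiset.mem_filter.1 h).2

theorem re_ne_zero_of_mem_outerRoots {P : ℂ[X]} : ∀ α ∈ outerRoots P, α.re ≠ 0 :=
  fun α h h0 => by
    have := le_abs_re_of_mem_outerRoots α h
    norm_num [h0] at this

theorem rootPoly_add (S O : Multiset ℂ) : rootPoly (S + O) = rootPoly S * rootPoly O := by
  rw [rootPoly, Multiset.map_add, Multiset.prod_add, rootPoly, rootPoly]

theorem rootPoly_roots {P : ℂ[X]} (hP : P.Monic) : rootPoly P.roots = P :=
  ((IsAlgClosed.splits P).eq_prod_roots_of_monic hP).symm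

theorem rootPoly_outerRoots_mul {P : ℂ[X]} (hP : P.Monic) :
    rootPoly (outerRoots P) * rootPoly (stripRoots P) = P := by
  rw [mul_comm, ← rootPoly_add, stripRoots, outerRoots, Multiset.filter_add_not,
    rootPoly_roots hP]

theorem card_stripRoots_add_card_outerRoots {P : ℂ[X]} (hP : P.Monic) :
    (stripRoots P).card + (outerRoots P).card = P.natDegree := by
  rw [← Multiset.card_add, stripRoots, outerRoots, Multiset.filter_add_not,
    ← natDegree_rootPoly, rootPoly_roots hP]

theorem roots_rootPoly (S : Multiset ℂ) : (rootPoly S).roots = S :=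
  roots_multiset_prod_X_sub_C S

theorem conjRefl_rootPoly (S : Multiset ℂ) : conjRefl (rootPoly S) =
    C ((-1) ^ S.card) * rootPoly (S.map fun α => -starRingEnd ℂ α) := by
  rw [rootPoly, map_multiset_prod, Multiset.map_map, rootPoly, Multiset.map_map]
  induction S using Multiset.induction_on with
  | empty => simp
  | cons α S ih =>
    rw [Multiset.map_cons, Multiset.prod_cons, ih, Multiset.map_cons, Multiset.prod_cons,
      Multiset.card_cons]
    simp only [Function.comp_apply, map_sub, conjRefl_X, conjRefl_C, map_neg, pow_succ, map_mul,
      map_one]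
    ring

theorem map_roots_of_conjRefl_eq_smul {P : ℂ[X]} (hP : P.Monic) {a : ℂ} (ha : a ≠ 0)
    (h : conjRefl P = a • P) : P.roots.map (fun α => -starRingEnd ℂ α) = P.roots := by
  have h1 := conjRefl_rootPoly P.roots
  rw [rootPoly_roots hP, h, smul_eq_C_mul] at h1
  have h2 := congrArg roots h1
  rw [roots_C_mul _ ha, roots_C_mul _ (pow_ne_zero _ (by norm_num)), roots_rootPoly] at h2
  exact h2.symm

theorem map_stripRoots {P : ℂ[X]}
    (h : P.roots.map (fun α => -starRingEnd ℂ α) = P.roots) :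
    (stripRoots P).map (fun α => -starRingEnd ℂ α) = stripRoots P := by
  conv_rhs => rw [stripRoots, ← h]
  rw [Multiset.filter_map, stripRoots]
  congr 1
  refine Multiset.filter_congr fun α _ => ?_
  simp

theorem map_outerRoots {P : ℂ[X]}
    (h : P.roots.map (fun α => -starRingEnd ℂ α) = P.roots) :
    (outerRoots P).map (fun α => -starRingEnd ℂ α) = outerRoots P := by
  conv_rhs => rw [outerRoots, ← h]
  rw [Multiset.filter_map, outerRoots]
  congr 1
  refine Multiset.filter_congr fun α _ => ?_
  simp

/-! ### All twisted functionals are given by weights -/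

section Numerators

open MeasureTheory

theorem IsWeightNumerator.add {c : ℝ} {l : ℕ} {G H : ℂ[X]} (hG : IsWeightNumerator c l G)
    (hH : IsWeightNumerator c l H) : IsWeightNumerator c l (G + H) :=
  ⟨(degree_add_le G H).trans_lt (max_lt hG.1 hH.1), fun h => by
    rw [coeff_add, hG.2 h, hH.2 h, add_zero]⟩

theorem IsWeightNumerator.smul {c : ℝ} {l : ℕ} {G : ℂ[X]} (hG : IsWeightNumerator c l G) (a : ℂ) :
    IsWeightNumerator c l (a • G) :=
  ⟨(degree_smul_le a G).trans_lt hG.1, fun h => by rw [coeff_smul, hG.2 h, smul_zero]⟩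

theorem weight_add (c : ℝ) (S : Multiset ℂ) (G H : ℂ[X]) (y : ℝ) :
    weight c S (G + H) y = weight c S G y + weight c S H y := by
  simp only [weight, weightNum, eval_add]
  ring

theorem weight_smul (c : ℝ) (S : Multiset ℂ) (a : ℂ) (G : ℂ[X]) (y : ℝ) :
    weight c S (a • G) y = a * weight c S G y := by
  simp only [weight, weightNum, eval_smul, smul_eq_mul]
  ring

theorem pi_mul_decayRate_div_two_pos {c : ℝ} (hc0 : 0 ≤ c) (hc1 : c < 1) :
    0 < Real.pi * decayRate c / 2 :=
  half_pos (mul_pos Real.pi_pos (decayRate_pos hc0 hc1))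

variable {c : ℝ} (hc0 : 0 ≤ c) (hc1 : c < 1) {S : Multiset ℂ} (hS : ∀ α ∈ S, |α.re| < 1 / 2)

theorem weightFunctional_add {G H : ℂ[X]} (hG : IsWeightNumerator c S.card G)
    (hH : IsWeightNumerator c S.card H) :
    weightFunctional hc0 hc1 hS (hG.add hH) =
      weightFunctional hc0 hc1 hS hG + weightFunctional hc0 hc1 hS hH := by
  refine LinearMap.ext fun R => ?_
  have hδ := pi_mul_decayRate_div_two_pos hc0 hc1
  have h1 := (expIntegrable_weight hc0 hc1 hS hG).integrable_mul_eval hδ R 0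
  have h2 := (expIntegrable_weight hc0 hc1 hS hH).integrable_mul_eval hδ R 0
  simp only [Complex.ofReal_zero, add_zero] at h1 h2
  simp only [LinearMap.add_apply, weightFunctional_apply, weight_add, add_mul]
  exact integral_add h1 h2

theorem weightFunctional_smul {G : ℂ[X]} (hG : IsWeightNumerator c S.card G) (a : ℂ) :
    weightFunctional hc0 hc1 hS (hG.smul a) = a • weightFunctional hc0 hc1 hS hG := by
  refine LinearMap.ext fun R => ?_
  simp only [LinearMap.smul_apply, weightFunctional_apply, weight_smul, mul_assoc, smul_eq_mul]
  exact integral_const_mul _ _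

theorem weight_eq_zero_iff {G : ℂ[X]} (hS : ∀ α ∈ S, |α.re| < 1 / 2) (y : ℝ) :
    weight c S G y = 0 ↔ G.eval ((Real.exp (-(2 * Real.pi * y)) : ℝ) : ℂ) = 0 := by
  have h1 : ((Real.exp (-(2 * Real.pi * y)) ^ c : ℝ) : ℂ) ≠ 0 :=
    Complex.ofReal_ne_zero.2 (Real.rpow_pos_of_pos (Real.exp_pos _) c).ne'
  have h2 : (S.map fun α => (expTwoPi α + (Real.exp (-(2 * Real.pi * y)) : ℝ))⁻¹).prod ≠ 0 := by
    rw [Ne, Multiset.prod_eq_zero_iff, Multiset.mem_map]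
    rintro ⟨α, hα, h⟩
    exact inv_ne_zero (expTwoPi_add_exp_ne_zero (hS α hα) y) h
  rw [weight_eq, mul_eq_zero, mul_eq_zero, or_iff_left h2, or_iff_right h1]

theorem finite_setOf_eval_exp_eq_zero {G : ℂ[X]} (hG : G ≠ 0) {s : ℂ} (hs : s ≠ 0) :
    {y : ℝ | G.eval (s * (Real.exp (-(2 * Real.pi * y)) : ℝ)) = 0}.Finite := by
  refine Set.Finite.preimage (f := fun y : ℝ => s * (Real.exp (-(2 * Real.pi * y)) : ℝ))
    (s := {x | G.IsRoot x}) (fun a _ b _ hab => ?_) (finite_setOfPred_isRoot hG)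
  have h1 := Real.exp_injective (Complex.ofReal_injective (mul_left_cancel₀ hs hab))
  have := Real.pi_pos
  nlinarith

theorem finite_setOf_weight_eq_zero {G : ℂ[X]} (hS : ∀ α ∈ S, |α.re| < 1 / 2) (hG : G ≠ 0) :
    {y : ℝ | weight c S G y = 0}.Finite := by
  simp_rw [weight_eq_zero_iff hS]
  simpa using finite_setOf_eval_exp_eq_zero hG one_ne_zero

theorem finite_setOf_eval_mul_I_eq_zero {R : ℂ[X]} (hR : R ≠ 0) :
    {y : ℝ | R.eval (y * Complex.I) = 0}.Finite :=
  Set.Finite.preimage (f := fun y : ℝ => (y * Complex.I : ℂ)) (s := {x | R.IsRoot x})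
    (fun a _ b _ hab => by simpa using hab) (finite_setOfPred_isRoot hR)

/-- A weight functional that vanishes on a nonzero ideal comes from the zero weight. -/
theorem eq_zero_of_weightFunctional_mul_eq_zero {G : ℂ[X]} (hG : IsWeightNumerator c S.card G)
    {A : ℂ[X]} (hA : A ≠ 0) (h : ∀ R, weightFunctional hc0 hc1 hS hG (A * R) = 0) : G = 0 := by
  by_contra hG0
  have hδ := pi_mul_decayRate_div_two_pos hc0 hc1
  have h1 := (expIntegrable_weight hc0 hc1 hS hG).mul_eval (half_lt_self hδ) A 0
  simp only [Complex.ofReal_zero, add_zero] at h1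
  have hw : Continuous fun y : ℝ => weight c S G y * A.eval (y * Complex.I) :=
    (continuous_weight c hS G).mul (A.continuous.comp (by fun_prop))
  have h2 := eq_zero_of_moments_eq_zero (half_pos hδ) hw h1 fun R => by
    have := h R
    rw [weightFunctional_apply] at this
    simpa only [eval_mul, mul_assoc] using this
  refine Set.infinite_univ (α := ℝ) (((finite_setOf_weight_eq_zero (c := c) hS hG0).union
    (finite_setOf_eval_mul_I_eq_zero hA)).subset fun y _ => ?_)
  exact mul_eq_zero.1 (congrFun h2 y)

theorem exp_eq_one_iff (hc0 : 0 ≤ c) (hc1 : c < 1) :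
    Complex.exp (2 * Real.pi * Complex.I * c) = 1 ↔ c = 0 := by
  constructor
  · intro h
    have h1 : expTwoPi (c : ℂ) = expTwoPi 0 := by rw [expTwoPi, h, expTwoPi, mul_zero, Complex.exp_zero]
    obtain ⟨n, hn⟩ := expTwoPi_eq_iff.1 h1
    have h2 : c = n := by
      rw [zero_add] at hn
      exact_mod_cast hn
    rw [h2] at hc0 hc1
    have h3 : n = 0 := le_antisymm (by
      have : n < 1 := by exact_mod_cast hc1
      omega) (by exact_mod_cast hc0)
    rw [h2, h3, Int.cast_zero]
  · rintro rfl
    simp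

/-- Every twisted functional for the polynomial with roots in the open strip is given by a weight:
by `IsTwisted.eq_zero_of_low_degree` the space of these functionals has at most the dimension of
the space of numerators. -/
theorem IsTwisted.exists_weightFunctional_eq {τ : ℂ[X] →ₗ[ℂ] ℂ}
    (hτ : IsTwisted (Complex.exp (2 * Real.pi * Complex.I * c)) (rootPoly S) τ) :
    ∃ (G : ℂ[X]) (hG : IsWeightNumerator c S.card G), weightFunctional hc0 hc1 hS hG = τ := by
  set t := Complex.exp (2 * Real.pi * Complex.I * c) with ht
  set e := degreeDrop t with he
  set d := S.card - e with hd
  -- `X ^ e * G` with `deg G < d` parametrizes the numerators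
  have hnum : ∀ G ∈ degreeLT ℂ d, IsWeightNumerator c S.card (X ^ e * G) := by
    intro G hG
    rw [mem_degreeLT] at hG
    refine ⟨?_, fun h => ?_⟩
    · by_cases hG0 : G = 0
      · simp [hG0]
      rw [degree_mul, degree_X_pow, degree_eq_natDegree hG0]
      rw [degree_eq_natDegree hG0] at hG
      have : G.natDegree < d := by exact_mod_cast hG
      exact_mod_cast (by omega : e + G.natDegree < S.card)
    · have : e = 1 := by
        rw [he, degreeDrop, if_pos ((exp_eq_one_iff hc0 hc1).2 h)]
      rw [this, pow_one, coeff_X_mul_zero]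
  let L : degreeLT ℂ d →ₗ[ℂ] (Fin d → ℂ) :=
    { toFun := fun G k => weightFunctional hc0 hc1 hS (hnum G G.2) (X ^ (k : ℕ))
      map_add' := fun G H => by
        ext k
        rw [Pi.add_apply, ← LinearMap.add_apply, ← weightFunctional_add]
        simp only [Submodule.coe_add, mul_add]
      map_smul' := fun a G => by
        ext k
        rw [Pi.smul_apply, RingHom.id_apply, ← LinearMap.smul_apply, ← weightFunctional_smul]
        simp only [Submodule.coe_smul, mul_smul_comm] }
  have hdet : ∀ σ : ℂ[X] →ₗ[ℂ] ℂ, IsTwisted t (rootPoly S) σ →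
      (∀ k : Fin d, σ (X ^ (k : ℕ)) = 0) → σ = 0 := fun σ hσ h0 =>
    hσ.eq_zero_of_low_degree (monic_rootPoly S) fun k hk => by
      rw [natDegree_rootPoly] at hk
      exact h0 ⟨k, hk⟩
  have hL : Function.Injective L := by
    refine (injective_iff_map_eq_zero L).2 fun G hG => ?_
    have h1 := hdet _ (isTwisted_weightFunctional hc0 hc1 hS (hnum G G.2)) fun k =>
      congrFun hG k
    have h2 := eq_zero_of_weightFunctional_mul_eq_zero hc0 hc1 hS (hnum G G.2) one_ne_zero
      fun R => by rw [h1, LinearMap.zero_apply]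
    exact Subtype.ext ((mul_eq_zero.1 h2).resolve_left (pow_ne_zero _ X_ne_zero))
  have hinj : Function.Injective (L ∘ₗ (degreeLTEquiv ℂ d).symm.toLinearMap) := by
    rw [LinearMap.coe_comp]
    exact hL.comp (degreeLTEquiv ℂ d).symm.injective
  obtain ⟨a, ha⟩ := LinearMap.injective_iff_surjective.1 hinj fun k => τ (X ^ (k : ℕ))
  refine ⟨_, hnum _ ((degreeLTEquiv ℂ d).symm a).2, sub_eq_zero.1 ?_⟩
  refine hdet _ ((isTwisted_weightFunctional hc0 hc1 hS _).sub hτ) fun k => ?_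
  rw [LinearMap.sub_apply, sub_eq_zero]
  exact congrFun ha k

end Numerators

/-! ### Positivity of functionals given by densities -/

section Positivity

open MeasureTheory

theorem eval_mul_conjRefl_mul_I (R : ℂ[X]) (y : ℝ) :
    (R * conjRefl R).eval (y * Complex.I) = (Complex.normSq (R.eval (y * Complex.I)) : ℝ) := by
  rw [eval_mul, eval_conjRefl_mul_I, Complex.mul_conj]

/-- A nonnegative density with finitely many zeros is positive on nonzero squares. -/
theorem momentFunctional_mul_conjRefl_pos {w : ℝ → ℂ} {δ : ℝ} (hδ : 0 < δ) (hw : Continuous w)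
    (hh : ExpIntegrable δ w volume) (hr : ∀ y, (w y).im = 0 ∧ 0 ≤ (w y).re)
    (hfin : {y | w y = 0}.Finite) {R : ℂ[X]} (hR : R ≠ 0) :
    (momentFunctional hδ hh (R * conjRefl R)).im = 0 ∧
      0 < (momentFunctional hδ hh (R * conjRefl R)).re := by
  set f : ℝ → ℝ := fun y => (w y).re * Complex.normSq (R.eval (y * Complex.I)) with hf
  have hfw : ∀ y, w y * (R * conjRefl R).eval (y * Complex.I) = (f y : ℂ) := fun y => by
    have : w y = ((w y).re : ℂ) := by apply Complex.ext <;> simp [(hr y).1]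
    rw [eval_mul_conjRefl_mul_I, hf, Complex.ofReal_mul, ← this]
  have hint := hh.integrable_mul_eval hδ (R * conjRefl R) 0
  simp only [Complex.ofReal_zero, add_zero, hfw] at hint
  rw [momentFunctional_apply]
  simp_rw [hfw]
  rw [integral_complex_ofReal, Complex.ofReal_im, Complex.ofReal_re]
  refine ⟨rfl, ?_⟩
  obtain ⟨y, hy⟩ : ∃ y, f y ≠ 0 := by
    by_contra! h
    refine Set.infinite_univ (α := ℝ) ((hfin.union
      (finite_setOf_eval_mul_I_eq_zero hR)).subset fun y _ => ?_)
    rcases mul_eq_zero.1 (h y) with h1 | h1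
    · exact Or.inl (Complex.ext h1 (hr y).1)
    · exact Or.inr (Complex.normSq_eq_zero.1 h1)
  have hfc : Continuous f := (Complex.continuous_re.comp hw).mul
    (Complex.continuous_normSq.comp (R.continuous.comp (by fun_prop)))
  refine integral_pos_of_integrable_nonneg_nonzero hfc ?_
    (fun y => mul_nonneg (hr y).2 (Complex.normSq_nonneg _)) hy
  simpa using hint.re

theorem isNonnegOnSquares_momentFunctional_one {μ : Measure ℝ} {δ : ℝ} (hδ : 0 < δ)
    (hμ : ExpIntegrable δ (fun _ => 1) μ) : IsNonnegOnSquares (momentFunctional hδ hμ) := by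
  intro R
  rw [momentFunctional_apply]
  simp_rw [one_mul, eval_mul_conjRefl_mul_I]
  rw [integral_complex_ofReal, Complex.ofReal_im, Complex.ofReal_re]
  exact ⟨rfl, integral_nonneg fun y => Complex.normSq_nonneg _⟩

end Positivity

/-! ### Point masses at the boundary roots -/

theorem finite_boundaryRoots {P : ℂ[X]} (hP : P ≠ 0) : {α : ℂ | P.IsRoot α ∧ α.re = -1 / 2}.Finite :=
  (finite_setOfPred_isRoot hP).subset fun _ h => h.1

/-- An enumeration of the roots on the line `Re α = -1/2`. -/
def boundaryEquiv {P : ℂ[X]} (hP : P ≠ 0) :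
    {α : ℂ | P.IsRoot α ∧ α.re = -1 / 2} ≃ Fin (boundaryRootCount P) :=
  haveI := (finite_boundaryRoots hP).to_subtype
  Finite.equivFinOfCardEq rfl

/-- The imaginary parts of the roots on the line `Re α = -1/2`. -/
def boundaryPoint {P : ℂ[X]} (hP : P ≠ 0) (j : Fin (boundaryRootCount P)) : ℝ :=
  ((boundaryEquiv hP).symm j : ℂ).im

section Boundary

variable {P : ℂ[X]} (hP : P ≠ 0)

theorem boundaryPoint_injective : Function.Injective (boundaryPoint hP) := fun i j h =>
  (boundaryEquiv hP).symm.injective (Subtype.ext (Complex.ext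
    (((boundaryEquiv hP).symm i).2.2.trans ((boundaryEquiv hP).symm j).2.2.symm) h))

theorem eval_boundaryPoint_sub (j : Fin (boundaryRootCount P)) :
    P.eval (boundaryPoint hP j * Complex.I - 1 / 2) = 0 := by
  have h := ((boundaryEquiv hP).symm j).2
  have e : (boundaryPoint hP j * Complex.I - 1 / 2 : ℂ) = (boundaryEquiv hP).symm j := by
    apply Complex.ext
    · rw [h.2]; norm_num
    · simp [boundaryPoint]
  rw [e]
  exact h.1

theorem eval_neg_conj_eq_zero {a : ℂ} (h : conjRefl P = a • P) {x : ℂ} (hx : P.eval x = 0) :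
    P.eval (-starRingEnd ℂ x) = 0 := by
  have h1 := eval_conjRefl P x
  rw [h, eval_smul, hx, smul_zero, eq_comm, map_eq_zero_iff _ (RingHom.injective _)] at h1
  exact h1

theorem eval_boundaryPoint_add {a : ℂ} (h : conjRefl P = a • P) (j : Fin (boundaryRootCount P)) :
    P.eval (boundaryPoint hP j * Complex.I + 1 / 2) = 0 := by
  have h1 := eval_neg_conj_eq_zero h (eval_boundaryPoint_sub hP j)
  rwa [show -starRingEnd ℂ (boundaryPoint hP j * Complex.I - 1 / 2) =
    boundaryPoint hP j * Complex.I + 1 / 2 by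
      simp [Complex.conj_ofNat]; ring] at h1

theorem exists_boundaryPoint_eq {a : ℂ} (h : conjRefl P = a • P) {x : ℂ} (hx : P.eval x = 0)
    (hre : |x.re| = 1 / 2) : ∃ j, boundaryPoint hP j = x.im := by
  have key : ∀ x : ℂ, P.eval x = 0 → x.re = -1 / 2 → ∃ j, boundaryPoint hP j = x.im :=
    fun x h1 h2 => ⟨boundaryEquiv hP ⟨x, h1, h2⟩, by simp [boundaryPoint]⟩
  rcases abs_eq (by norm_num) |>.1 hre with h1 | h1
  · simpa using key _ (eval_neg_conj_eq_zero h hx) (by simp [h1]; norm_num)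
  · exact key x hx (by rw [h1]; norm_num)

/-- The functional `R ↦ ∑ mⱼ R(iyⱼ)` of point masses at the boundary points. -/
def atomFunctional (m : Fin (boundaryRootCount P) → ℝ≥0) : ℂ[X] →ₗ[ℂ] ℂ :=
  ∑ j, ((m j : ℝ) : ℂ) • leval (boundaryPoint hP j * Complex.I : ℂ)

theorem atomFunctional_apply (m : Fin (boundaryRootCount P) → ℝ≥0) (R : ℂ[X]) :
    atomFunctional hP m R = ∑ j, ((m j : ℝ) : ℂ) * R.eval (boundaryPoint hP j * Complex.I) := by
  simp [atomFunctional, LinearMap.sum_apply]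

theorem atomFunctional_add (m m' : Fin (boundaryRootCount P) → ℝ≥0) :
    atomFunctional hP (m + m') = atomFunctional hP m + atomFunctional hP m' := by
  refine LinearMap.ext fun R => ?_
  simp only [atomFunctional_apply, LinearMap.add_apply, Pi.add_apply, NNReal.coe_add,
    Complex.ofReal_add, add_mul, Finset.sum_add_distrib]

theorem atomFunctional_smul (a : ℝ≥0) (m : Fin (boundaryRootCount P) → ℝ≥0) :
    atomFunctional hP (a • m) = ((a : ℝ) : ℂ) • atomFunctional hP m := by
  refine LinearMap.ext fun R => ?_
  simp only [atomFunctional_apply, LinearMap.smul_apply, Pi.smul_apply, smul_eq_mul,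
    NNReal.coe_mul, Complex.ofReal_mul, mul_assoc, Finset.mul_sum]

theorem atomFunctional_taylor_neg (m : Fin (boundaryRootCount P) → ℝ≥0) (f : ℂ[X]) :
    atomFunctional hP m (taylor (-(1 / 2)) (f * P)) = 0 := by
  rw [atomFunctional_apply]
  refine Finset.sum_eq_zero fun j _ => ?_
  rw [taylor_eval, eval_mul, ← sub_eq_add_neg, eval_boundaryPoint_sub, mul_zero, mul_zero]

theorem isTwisted_atomFunctional {a : ℂ} (h : conjRefl P = a • P) (t : ℂ)
    (m : Fin (boundaryRootCount P) → ℝ≥0) : IsTwisted t P (atomFunctional hP m) := by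
  intro f
  rw [atomFunctional_taylor_neg, atomFunctional_apply, Finset.sum_eq_zero, mul_zero]
  intro j _
  rw [taylor_eval, eval_mul, eval_boundaryPoint_add hP h, mul_zero, mul_zero]

theorem isNonnegOnSquares_atomFunctional (m : Fin (boundaryRootCount P) → ℝ≥0) :
    IsNonnegOnSquares (atomFunctional hP m) := by
  intro R
  rw [atomFunctional_apply]
  simp_rw [eval_mul_conjRefl_mul_I, ← Complex.ofReal_mul]
  rw [← Complex.ofReal_sum, Complex.ofReal_im, Complex.ofReal_re]
  exact ⟨rfl, Finset.sum_nonneg fun j _ => mul_nonneg (m j).2 (Complex.normSq_nonneg _)⟩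

/-- The masses are determined by their functional. -/
theorem atomFunctional_injective : Function.Injective (atomFunctional hP) := by
  intro m m' h
  ext j
  set R : ℂ[X] := ∏ k ∈ Finset.univ.erase j, (X - C (boundaryPoint hP k * Complex.I : ℂ)) with hR
  have hRk : ∀ k ≠ j, R.eval (boundaryPoint hP k * Complex.I) = 0 := fun k hk => by
    rw [hR, eval_prod]
    exact Finset.prod_eq_zero (Finset.mem_erase.2 ⟨hk, Finset.mem_univ k⟩) (by simp)
  have hRj : R.eval (boundaryPoint hP j * Complex.I) ≠ 0 := by
    rw [hR, eval_prod, Finset.prod_ne_zero_iff]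
    intro k hk
    rw [eval_sub, eval_X, eval_C, sub_ne_zero]
    intro h1
    have h2 : boundaryPoint hP j = boundaryPoint hP k := by simpa using h1
    exact (Finset.mem_erase.1 hk).1 (boundaryPoint_injective hP h2).symm
  have h1 := LinearMap.congr_fun h R
  have h2 : ∀ m : Fin (boundaryRootCount P) → ℝ≥0, atomFunctional hP m R =
      ((m j : ℝ) : ℂ) * R.eval (boundaryPoint hP j * Complex.I) := fun m => by
    rw [atomFunctional_apply]
    exact Finset.sum_eq_single j (fun k _ hk => by rw [hRk k hk, mul_zero]) (by simp)
  rw [h2, h2] at h1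
  exact_mod_cast mul_right_cancel₀ hRj h1

open MeasureTheory in
/-- Splitting off the masses of a measure at the boundary points. -/
theorem exists_atomFunctional_add {μ : Measure ℝ} {δ : ℝ} (hδ : 0 < δ)
    (hμ : ExpIntegrable δ (fun _ => 1) μ) :
    ∃ (m : Fin (boundaryRootCount P) → ℝ≥0) (ν : Measure ℝ) (hν : ExpIntegrable δ (fun _ => 1) ν),
      (∀ j, ν {boundaryPoint hP j} = 0) ∧
      momentFunctional hδ hμ = momentFunctional hδ hν + atomFunctional hP m := by
  have := hμ.isFiniteMeasure hδ
  set A : Finset ℝ := Finset.univ.image (boundaryPoint hP) with hA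
  have hAm : MeasurableSet (A : Set ℝ) := A.measurableSet
  have hν : ExpIntegrable δ (fun _ => (1 : ℂ)) (μ.restrict (A : Set ℝ)ᶜ) :=
    ⟨hμ.1.restrict, hμ.2.restrict⟩
  refine ⟨fun j => (μ {boundaryPoint hP j}).toNNReal, μ.restrict (A : Set ℝ)ᶜ,
    hν, fun j => ?_, LinearMap.ext fun R => ?_⟩
  · rw [Measure.restrict_apply (measurableSet_singleton _)]
    convert measure_empty (μ := μ)
    rw [Set.singleton_inter_eq_empty, Set.notMem_compl_iff]
    simp [hA]
  · have hint := hμ.integrable_mul_eval hδ R 0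
    simp only [Complex.ofReal_zero, add_zero] at hint
    rw [LinearMap.add_apply, momentFunctional_apply, momentFunctional_apply, atomFunctional_apply,
      ← integral_add_compl hAm hint, add_comm, setIntegral_finset A hint.integrableOn, hA,
      Finset.sum_image fun i _ j _ h => boundaryPoint_injective hP h]
    congr 1
    refine Finset.sum_congr rfl fun j _ => ?_
    rw [one_mul, Complex.real_smul]
    rfl

end Boundary

/-! ### The functional of a numerator and of point masses -/

open MeasureTheory in
theorem IsTwisted.of_rootPoly_mul {μ : Measure ℝ} {δ : ℝ} (hδ : 0 < δ)
    (hμ : ExpIntegrable δ (fun _ => 1) μ) {t : ℂ} {Q : ℂ[X]} {O : Multiset ℂ}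
    (hO : ∀ α ∈ O, 1 / 2 ≤ |α.re| ∧ (|α.re| = 1 / 2 → μ {α.im} = 0))
    (h : IsTwisted t (rootPoly O * Q) (momentFunctional hδ hμ)) :
    IsTwisted t Q (momentFunctional hδ hμ) := by
  induction O using Multiset.induction_on with
  | empty => simpa [rootPoly] using h
  | cons α O ih =>
    refine ih (fun β hβ => hO β (Multiset.mem_cons_of_mem hβ)) ?_
    have hα := hO α (Multiset.mem_cons_self α O)
    refine IsTwisted.of_mul_X_sub_C hδ hμ (α := α) ?_ hα.1 hα.2
    simpa [rootPoly, mul_assoc] using h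

/-- A polynomial with real values on the positive half-line is real. -/
theorem exists_map_ofReal_eq {G : ℂ[X]} (h : ∀ x : ℝ, 0 < x → (G.eval (x : ℂ)).im = 0) :
    ∃ F : ℝ[X], F.map Complex.ofRealHom = G := by
  have h1 : G.map (starRingEnd ℂ) = G := by
    refine eq_of_infinite_eval_eq _ _ (((Set.Ioi_infinite (0 : ℝ)).image
      Complex.ofReal_injective.injOn).mono ?_)
    rintro _ ⟨x, hx, rfl⟩
    have h2 : (G.map (starRingEnd ℂ)).eval (starRingEnd ℂ (x : ℂ)) = starRingEnd ℂ (G.eval (x : ℂ)) :=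
      Polynomial.eval_map_apply (f := starRingEnd ℂ) (p := G) (x : ℂ)
    rw [Complex.conj_ofReal] at h2
    show (G.map (starRingEnd ℂ)).eval (x : ℂ) = G.eval (x : ℂ)
    rw [h2]
    exact Complex.conj_eq_iff_im.2 (h x hx)
  refine (mem_lifts G).1 ((lifts_iff_coeff_lifts G).2 fun n => ?_)
  have h2 := congrArg (fun F => coeff F n) h1
  simp only [coeff_map] at h2
  exact ⟨(G.coeff n).re, Complex.conj_eq_iff_re.1 h2⟩

theorem eval_map_ofRealHom (F : ℝ[X]) (x : ℝ) :
    (F.map Complex.ofRealHom).eval (x : ℂ) = (F.eval x : ℝ) :=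
  Polynomial.eval_map_apply (f := Complex.ofRealHom) (p := F) x

theorem isWeightNumerator_map_iff {c : ℝ} {l : ℕ} {F : ℝ[X]} :
    IsWeightNumerator c l (F.map Complex.ofRealHom) ↔
      F.degree < (l : WithBot ℕ) ∧ (c = 0 → F.eval 0 = 0) := by
  rw [IsWeightNumerator, degree_map, coeff_map, ← coeff_zero_eq_eval_zero]
  simp

theorem exists_exp_eq {x : ℝ} (hx : 0 < x) : ∃ y : ℝ, Real.exp (-(2 * Real.pi * y)) = x := by
  refine ⟨-(Real.log x / (2 * Real.pi)), ?_⟩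
  have := Real.pi_pos.ne'
  rw [show -(2 * Real.pi * -(Real.log x / (2 * Real.pi))) = Real.log x by field_simp,
    Real.exp_log hx]

namespace QAlg

section Classification

open MeasureTheory

variable {P : ℂ[X]} {c : ℝ}

/-- The functional `R ↦ λ τ(R(x - 1/2) P(x - 1/2))`, `τ` being the functional of a weight, is given
by this density on the imaginary axis. -/
def secondDensity (ρ : Conjugation P) (c : ℝ) (G : ℂ[X]) (y : ℝ) : ℂ :=
  (ρ.lam : ℂ) * ((rootPoly (outerRoots P)).eval (y * Complex.I) *
    weightKernel c (stripRoots P) G (y * Complex.I))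

theorem continuous_secondDensity (ρ : Conjugation P) (c : ℝ) (G : ℂ[X]) :
    Continuous (secondDensity ρ c G) :=
  continuous_const.mul (((rootPoly (outerRoots P)).continuous.comp (by fun_prop)).mul
    (continuous_weightKernel_mul_I c abs_re_lt_of_mem_stripRoots G))

theorem expIntegrable_secondDensity (hc0 : 0 ≤ c) (hc1 : c < 1)
    (ρ : Conjugation P) {G : ℂ[X]}
    (hG : IsWeightNumerator c (stripRoots P).card G) :
    ExpIntegrable (Real.pi * decayRate c / 2 / 2) (secondDensity ρ c G) volume := by
  have h := (expIntegrable_weightKernel hc0 hc1 abs_re_lt_of_mem_stripRoots hG).mul_eval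
    (half_lt_self (pi_mul_decayRate_div_two_pos hc0 hc1))
    (C (ρ.lam : ℂ) * rootPoly (outerRoots P)) 0
  convert h using 2 with y
  simp only [secondDensity, eval_mul, eval_C, Complex.ofReal_zero, add_zero]
  ring

theorem lam_mul_weightFunctional (hc0 : 0 ≤ c) (hc1 : c < 1) (hP : P.Monic)
    (ρ : Conjugation P) {G : ℂ[X]}
    (hG : IsWeightNumerator c (stripRoots P).card G) (f : ℂ[X]) :
    (ρ.lam : ℂ) * weightFunctional hc0 hc1 abs_re_lt_of_mem_stripRoots hG
        (taylor (-(1 / 2)) (f * P)) =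
      momentFunctional (half_pos (pi_mul_decayRate_div_two_pos hc0 hc1))
        (expIntegrable_secondDensity hc0 hc1 ρ hG) f := by
  have h : f * P = f * rootPoly (outerRoots P) * rootPoly (stripRoots P) := by
    rw [mul_assoc, rootPoly_outerRoots_mul hP]
  rw [h, weightFunctional_taylor, momentFunctional_apply,
    ← integral_const_mul]
  congr 1
  ext y
  rw [secondDensity, eval_mul]
  ring

theorem map_roots (ρ : Conjugation P) (hP : P.Monic) :
    P.roots.map (fun α => -starRingEnd ℂ α) = P.roots :=
  map_roots_of_conjRefl_eq_smul hP (mul_ne_zero ρ.lam.ne_zero ρ.lamStar.ne_zero)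
    (conjRefl_eq_smul ρ)

/-- The second density has the sign of `ε G` on the negative half-line. -/
theorem exists_pos_secondDensity_eq (ρ : Conjugation P) (hP : P.Monic) {ε : ℤˣ}
    (hε : (ρ.lam : ℂ) = ((ε : ℤ) : ℂ) * (‖(ρ.lam : ℂ)‖ : ℂ) *
      (Complex.I ^ P.natDegree)⁻¹ * Complex.exp (-(Real.pi * Complex.I * c))) (y : ℝ) :
    ∃ r : ℝ, 0 < r ∧ ∀ G : ℂ[X], secondDensity ρ c G y =
      r * (((ε : ℤ) : ℂ) * G.eval (-(Real.exp (-(2 * Real.pi * y)) : ℝ) : ℂ)) := by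
  obtain ⟨r, hr, h⟩ := exists_pos_eval_rootPoly_mul_weightKernel c
    (abs_re_lt_of_mem_stripRoots (P := P)) (map_stripRoots (map_roots ρ hP))
    re_ne_zero_of_mem_outerRoots (map_outerRoots (map_roots ρ hP)) y
  refine ⟨‖(ρ.lam : ℂ)‖ * r, mul_pos (norm_pos_iff.2 ρ.lam.ne_zero) hr, fun G => ?_⟩
  have h1 := h G
  rw [card_stripRoots_add_card_outerRoots hP] at h1
  rw [secondDensity, Complex.ofReal_mul]
  linear_combination ((rootPoly (outerRoots P)).eval (y * Complex.I) *
    weightKernel c (stripRoots P) G (y * Complex.I)) * hε + (((ε : ℤ) : ℂ) * ‖(ρ.lam : ℂ)‖) * h1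

theorem exists_pos_weight_eq (ρ : Conjugation P) (hP : P.Monic) (y : ℝ) :
    ∃ r : ℝ, 0 < r ∧ ∀ G : ℂ[X], weight c (stripRoots P) G y =
      r * G.eval ((Real.exp (-(2 * Real.pi * y)) : ℝ) : ℂ) := by
  obtain ⟨r, hr, h⟩ := exists_pos_prod_expTwoPi_add (abs_re_lt_of_mem_stripRoots (P := P))
    (map_stripRoots (map_roots ρ hP)) y
  refine ⟨Real.exp (-(2 * Real.pi * y)) ^ c * r,
    mul_pos (Real.rpow_pos_of_pos (Real.exp_pos _) c) hr, fun G => ?_⟩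
  rw [weight_eq, h, Complex.ofReal_mul]
  ring

/-- The functional of a numerator `G` and of masses `m` at the boundary points. -/
def traceFunctional (hc0 : 0 ≤ c) (hc1 : c < 1) (hP : P ≠ 0) {G : ℝ[X]}
    (hG : IsWeightNumerator c (stripRoots P).card (G.map Complex.ofRealHom))
    (m : Fin (boundaryRootCount P) → ℝ≥0) : ℂ[X] →ₗ[ℂ] ℂ :=
  weightFunctional hc0 hc1 abs_re_lt_of_mem_stripRoots hG + atomFunctional hP m

theorem isTwisted_traceFunctional (hc0 : 0 ≤ c) (hc1 : c < 1)
    (ρ : Conjugation P) (hP : P.Monic) {G : ℝ[X]}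
    (hG : IsWeightNumerator c (stripRoots P).card (G.map Complex.ofRealHom))
    (m : Fin (boundaryRootCount P) → ℝ≥0) :
    IsTwisted (Complex.exp (2 * Real.pi * Complex.I * c)) P
      (traceFunctional hc0 hc1 hP.ne_zero hG m) :=
  ((isTwisted_weightFunctional hc0 hc1 abs_re_lt_of_mem_stripRoots hG).of_dvd
    ⟨_, ((mul_comm _ _).trans (rootPoly_outerRoots_mul hP)).symm⟩).add
    (isTwisted_atomFunctional hP.ne_zero (conjRefl_eq_smul ρ) _ m)

theorem lam_mul_traceFunctional (hc0 : 0 ≤ c) (hc1 : c < 1)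
    (ρ : Conjugation P) (hP : P.Monic) {G : ℝ[X]}
    (hG : IsWeightNumerator c (stripRoots P).card (G.map Complex.ofRealHom))
    (m : Fin (boundaryRootCount P) → ℝ≥0) (f : ℂ[X]) :
    (ρ.lam : ℂ) * traceFunctional hc0 hc1 hP.ne_zero hG m (taylor (-(1 / 2)) (f * P)) =
      momentFunctional (half_pos (pi_mul_decayRate_div_two_pos hc0 hc1))
        (expIntegrable_secondDensity hc0 hc1 ρ hG) f := by
  rw [traceFunctional, LinearMap.add_apply, atomFunctional_taylor_neg, add_zero,
    lam_mul_weightFunctional hc0 hc1 hP ρ hG]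

theorem isPositivePair_traceFunctional (hc0 : 0 ≤ c) (hc1 : c < 1)
    (ρ : Conjugation P) (hP : P.Monic) {ε : ℤˣ}
    (hε : (ρ.lam : ℂ) = ((ε : ℤ) : ℂ) * (‖(ρ.lam : ℂ)‖ : ℂ) *
      (Complex.I ^ P.natDegree)⁻¹ * Complex.exp (-(Real.pi * Complex.I * c))) {G : ℝ[X]}
    (hG : IsWeightNumerator c (stripRoots P).card (G.map Complex.ofRealHom)) (hG0 : G ≠ 0)
    (hpos : ∀ x : ℝ, 0 < x → 0 ≤ G.eval x)
    (hneg : ∀ x : ℝ, x < 0 → 0 ≤ ((ε : ℤ) : ℝ) * G.eval x)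
    (m : Fin (boundaryRootCount P) → ℝ≥0) :
    IsPositivePair ρ (traceFunctional hc0 hc1 hP.ne_zero hG m) := by
  have hG0' : G.map Complex.ofRealHom ≠ 0 := (Polynomial.map_ne_zero_iff
    Complex.ofRealHom.injective).2 hG0
  intro R hR
  constructor
  · have h1 := momentFunctional_mul_conjRefl_pos (pi_mul_decayRate_div_two_pos hc0 hc1)
      (continuous_weight c abs_re_lt_of_mem_stripRoots _)
      (expIntegrable_weight hc0 hc1 abs_re_lt_of_mem_stripRoots hG) (fun y => by
        obtain ⟨r, hr, h⟩ := exists_pos_weight_eq (c := c) ρ hP y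
        rw [h, eval_map_ofRealHom, ← Complex.ofReal_mul, Complex.ofReal_im, Complex.ofReal_re]
        exact ⟨rfl, mul_nonneg hr.le (hpos _ (Real.exp_pos _))⟩)
      (finite_setOf_weight_eq_zero abs_re_lt_of_mem_stripRoots hG0') hR
    have h2 := isNonnegOnSquares_atomFunctional hP.ne_zero m R
    rw [traceFunctional, LinearMap.add_apply, Complex.add_im, Complex.add_re]
    exact ⟨by rw [h2.1, add_zero]; exact h1.1, add_pos_of_pos_of_nonneg h1.2 h2.2⟩
  · rw [lam_mul_traceFunctional hc0 hc1 ρ hP hG]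
    refine momentFunctional_mul_conjRefl_pos _ (continuous_secondDensity ρ c _) _ (fun y => ?_) ?_ hR
    · obtain ⟨r, hr, h⟩ := exists_pos_secondDensity_eq ρ hP hε y
      have e : secondDensity ρ c (G.map Complex.ofRealHom) y =
          ((r * (((ε : ℤ) : ℝ) * G.eval (-Real.exp (-(2 * Real.pi * y)))) : ℝ) : ℂ) := by
        rw [h, ← Complex.ofReal_neg, eval_map_ofRealHom]
        push_cast
        rfl
      rw [e, Complex.ofReal_im, Complex.ofReal_re]
      exact ⟨rfl, mul_nonneg hr.le (hneg _ (neg_neg_of_pos (Real.exp_pos _)))⟩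
    · refine (finite_setOf_eval_exp_eq_zero hG0' (neg_ne_zero.2 one_ne_zero)).subset fun y hy => ?_
      obtain ⟨r, hr, h⟩ := exists_pos_secondDensity_eq ρ hP hε y
      have h1 : secondDensity ρ c (G.map Complex.ofRealHom) y = 0 := hy
      rw [h, mul_eq_zero, or_iff_right (Complex.ofReal_ne_zero.2 hr.ne'), mul_eq_zero,
        or_iff_right (Int.cast_ne_zero.2 ε.ne_zero)] at h1
      show eval (-1 * _) _ = _
      rwa [neg_one_mul]

theorem traceFunctional_injective (hc0 : 0 ≤ c) (hc1 : c < 1) (hP : P ≠ 0) {G H : ℝ[X]}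
    (hG : IsWeightNumerator c (stripRoots P).card (G.map Complex.ofRealHom))
    (hH : IsWeightNumerator c (stripRoots P).card (H.map Complex.ofRealHom))
    {m k : Fin (boundaryRootCount P) → ℝ≥0}
    (h : traceFunctional hc0 hc1 hP hG m = traceFunctional hc0 hc1 hP hH k) : G = H ∧ m = k := by
  -- on multiples of `A` the point masses vanish, so that the weights can be compared
  set A : ℂ[X] := ∏ j, (X - C (boundaryPoint hP j * Complex.I : ℂ)) with hA
  have hA0 : A ≠ 0 := (monic_prod_of_monic _ _ fun j _ => monic_X_sub_C _).ne_zero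
  have hatom : ∀ (m : Fin (boundaryRootCount P) → ℝ≥0) R, atomFunctional hP m (A * R) = 0 :=
    fun m R => by
      rw [atomFunctional_apply]
      refine Finset.sum_eq_zero fun j _ => ?_
      have : A.eval (boundaryPoint hP j * Complex.I) = 0 := by
        rw [hA, eval_prod]
        exact Finset.prod_eq_zero (Finset.mem_univ j) (by simp)
      rw [eval_mul, this, zero_mul, mul_zero]
  have h1 := eq_zero_of_weightFunctional_mul_eq_zero hc0 hc1 abs_re_lt_of_mem_stripRoots
    (hG.add (hH.smul (-1))) hA0 fun R => by
      have h2 := LinearMap.congr_fun h (A * R)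
      simp only [traceFunctional, LinearMap.add_apply, hatom, add_zero] at h2
      rw [weightFunctional_add hc0 hc1 _ hG (hH.smul (-1)), weightFunctional_smul hc0 hc1 _ hH,
        LinearMap.add_apply, LinearMap.smul_apply, h2]
      simp
  rw [neg_one_smul, add_neg_eq_zero] at h1
  obtain rfl := map_injective _ Complex.ofRealHom.injective h1
  exact ⟨rfl, atomFunctional_injective hP (add_left_cancel h)⟩

/-- Every functional satisfying the conditions of a positive trace comes from a numerator in the
cone and from masses at the boundary points. -/
theorem exists_traceFunctional_eq (hc0 : 0 ≤ c) (hc1 : c < 1)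
    (ρ : Conjugation P) (hP : P.Monic) {ε : ℤˣ}
    (hε : (ρ.lam : ℂ) = ((ε : ℤ) : ℂ) * (‖(ρ.lam : ℂ)‖ : ℂ) *
      (Complex.I ^ P.natDegree)⁻¹ * Complex.exp (-(Real.pi * Complex.I * c)))
    {τ : ℂ[X] →ₗ[ℂ] ℂ} (ht : IsTwisted (Complex.exp (2 * Real.pi * Complex.I * c)) P τ)
    (hτ : IsPositivePair ρ τ) :
    ∃ (G : ℝ[X]) (hG : IsWeightNumerator c (stripRoots P).card (G.map Complex.ofRealHom))
      (m : Fin (boundaryRootCount P) → ℝ≥0), G ≠ 0 ∧ (∀ x : ℝ, 0 < x → 0 ≤ G.eval x) ∧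
      (∀ x : ℝ, x < 0 → 0 ≤ ((ε : ℤ) : ℝ) * G.eval x) ∧
      traceFunctional hc0 hc1 hP.ne_zero hG m = τ := by
  obtain ⟨μ, hμ⟩ := hτ.isNonnegOnSquares.exists_measure
  obtain ⟨B, M, hM, hb⟩ := ht.moment_growth hP
  obtain ⟨δ, hδ, hμδ⟩ := exists_expIntegrable_one hμ hM hb
  obtain ⟨m, ν, hν, hν0, hsum⟩ := exists_atomFunctional_add hP.ne_zero hδ hμδ
  have hτμ : momentFunctional hδ hμδ = τ := LinearMap.ext fun R => by
    rw [momentFunctional_apply, ← (hμ R).2]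
    simp only [one_mul]
  rw [hτμ] at hsum
  -- the measure without its masses at the boundary points is twisted for the strip roots only
  have hνt : IsTwisted (Complex.exp (2 * Real.pi * Complex.I * c)) (rootPoly (stripRoots P))
      (momentFunctional hδ hν) := by
    refine IsTwisted.of_rootPoly_mul hδ hν (O := outerRoots P) (fun α hα =>
      ⟨le_abs_re_of_mem_outerRoots α hα, fun h => ?_⟩) ?_
    · obtain ⟨j, hj⟩ := exists_boundaryPoint_eq hP.ne_zero (conjRefl_eq_smul ρ)
        (isRoot_of_mem_roots (Multiset.mem_of_mem_filter hα)) h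
      rw [← hj]
      exact hν0 j
    · rw [rootPoly_outerRoots_mul hP, ← sub_eq_of_eq_add hsum]
      exact ht.sub (isTwisted_atomFunctional hP.ne_zero (conjRefl_eq_smul ρ) _ m)
  obtain ⟨G', hG', hGν⟩ := hνt.exists_weightFunctional_eq hc0 hc1 abs_re_lt_of_mem_stripRoots
  have hw := nonneg_of_isNonnegOnSquares (pi_mul_decayRate_div_two_pos hc0 hc1)
    (continuous_weight c abs_re_lt_of_mem_stripRoots _)
    (expIntegrable_weight hc0 hc1 abs_re_lt_of_mem_stripRoots hG') (by
      have h := isNonnegOnSquares_momentFunctional_one hδ hν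
      rw [← hGν] at h
      exact h)
  have hpos : ∀ x : ℝ, 0 < x → (G'.eval (x : ℂ)).im = 0 ∧ 0 ≤ (G'.eval (x : ℂ)).re := by
    intro x hx
    obtain ⟨y, rfl⟩ := exists_exp_eq hx
    obtain ⟨r, hr, h⟩ := exists_pos_weight_eq (c := c) ρ hP y
    have h1 := hw y
    rw [h, Complex.im_ofReal_mul, Complex.re_ofReal_mul] at h1
    exact ⟨(mul_eq_zero.1 h1.1).resolve_left hr.ne', nonneg_of_mul_nonneg_right h1.2 hr⟩
  obtain ⟨G, rfl⟩ := exists_map_ofReal_eq fun x hx => (hpos x hx).1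
  have hτG : traceFunctional hc0 hc1 hP.ne_zero hG' m = τ := by
    rw [traceFunctional, hGν, hsum]
  have hsecond := fun R hR => (hτ R hR).2
  simp only [← hτG, lam_mul_traceFunctional hc0 hc1 ρ hP hG'] at hsecond
  have hw2 := nonneg_of_isNonnegOnSquares (half_pos (pi_mul_decayRate_div_two_pos hc0 hc1))
    (continuous_secondDensity ρ c _) (expIntegrable_secondDensity hc0 hc1 ρ hG') (fun R => by
      by_cases hR : R = 0
      · simp [hR]
      · exact ⟨(hsecond R hR).1, (hsecond R hR).2.le⟩)
  refine ⟨G, hG', m, ?_, fun x hx => ?_, fun x hx => ?_, hτG⟩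
  · rintro rfl
    have h1 := (hsecond 1 one_ne_zero).2
    rw [momentFunctional_apply] at h1
    simp [secondDensity, weightKernel, weightNum] at h1
  · have h1 := (hpos x hx).2
    rwa [eval_map_ofRealHom, Complex.ofReal_re] at h1
  · obtain ⟨y, hy⟩ := exists_exp_eq (neg_pos.2 hx)
    obtain ⟨r, hr, h⟩ := exists_pos_secondDensity_eq ρ hP hε y
    have h1 := (hw2 y).2
    have e : secondDensity ρ c (G.map Complex.ofRealHom) y =
        ((r * (((ε : ℤ) : ℝ) * G.eval x) : ℝ) : ℂ) := by
      rw [h, hy, Complex.ofReal_neg, neg_neg, eval_map_ofRealHom]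
      push_cast
      rfl
    rw [e, Complex.ofReal_re] at h1
    exact nonneg_of_mul_nonneg_right h1 hr

end Classification

end QAlg

/-! ### The isomorphism of cones -/

namespace QAlg

section Equivalence

variable {P : ℂ[X]} {c : ℝ} {t : ℂˣ} {ε : ℤˣ}

theorem eq_one_of_eq_zero (ht : (t : ℂ) = Complex.exp (2 * Real.pi * Complex.I * c)) (hc : c = 0) :
    t = 1 := Units.ext (by rw [ht, hc]; simp)

theorem isWeightNumerator_of_mem (ht : (t : ℂ) = Complex.exp (2 * Real.pi * Complex.I * c))
    (G : polynomialCone (openStripRootCount P) t ε) :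
    IsWeightNumerator c (stripRoots P).card ((G : ℝ[X]).map Complex.ofRealHom) :=
  isWeightNumerator_map_iff.2 ⟨G.2.2.1, fun h => G.2.2.2.1 (eq_one_of_eq_zero ht h)⟩

/-- The trace defined by a numerator in the cone and by point masses at the boundary points. -/
def traceOfPair (hP : P.Monic) (ρ : Conjugation P) (hρ : ∀ a : QAlg P, ρ (ρ a) = gt P t a)
    (hc0 : 0 ≤ c) (hc1 : c < 1) (ht : (t : ℂ) = Complex.exp (2 * Real.pi * Complex.I * c))
    (hε : (ρ.lam : ℂ) = ((ε : ℤ) : ℂ) * (‖(ρ.lam : ℂ)‖ : ℂ) *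
      (Complex.I ^ P.natDegree)⁻¹ * Complex.exp (-(Real.pi * Complex.I * c)))
    (p : polynomialCone (openStripRootCount P) t ε × (Fin (boundaryRootCount P) → ℝ≥0)) :
    positiveTraceCone ρ t :=
  ⟨traceFunctional hc0 hc1 hP.ne_zero (isWeightNumerator_of_mem ht p.1) p.2 ∘ₗ weightZero P, by
    have h1 := isPositivePair_traceFunctional hc0 hc1 ρ hP hε (isWeightNumerator_of_mem ht p.1)
      p.1.2.1 p.1.2.2.2.2.1 p.1.2.2.2.2.2 p.2
    have h2 : IsTwistedTrace P t _ := isTwistedTrace_comp_weightZero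
      (ht ▸ isTwisted_traceFunctional hc0 hc1 ρ hP (isWeightNumerator_of_mem ht p.1) p.2)
    refine ⟨h2, isEquivariant_comp_weightZero h1.isNonnegOnSquares,
      isPositiveDefinite_of_isPositivePair hρ hP.ne_zero h2 ?_⟩
    convert h1
    refine LinearMap.ext fun R => ?_
    simp [weightZero_ofPoly]⟩

variable (hP : P.Monic) (ρ : Conjugation P) (hρ : ∀ a : QAlg P, ρ (ρ a) = gt P t a)
  (hc0 : 0 ≤ c) (hc1 : c < 1) (ht : (t : ℂ) = Complex.exp (2 * Real.pi * Complex.I * c))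
  (hε : (ρ.lam : ℂ) = ((ε : ℤ) : ℂ) * (‖(ρ.lam : ℂ)‖ : ℂ) *
    (Complex.I ^ P.natDegree)⁻¹ * Complex.exp (-(Real.pi * Complex.I * c)))

theorem coe_traceOfPair
    (p : polynomialCone (openStripRootCount P) t ε × (Fin (boundaryRootCount P) → ℝ≥0)) :
    (traceOfPair hP ρ hρ hc0 hc1 ht hε p : QAlg P →ₗ[ℂ] ℂ) =
      traceFunctional hc0 hc1 hP.ne_zero (isWeightNumerator_of_mem ht p.1) p.2 ∘ₗ weightZero P :=
  rfl

theorem traceOfPair_add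
    (p q : polynomialCone (openStripRootCount P) t ε × (Fin (boundaryRootCount P) → ℝ≥0)) :
    traceOfPair hP ρ hρ hc0 hc1 ht hε (p + q) =
      traceOfPair hP ρ hρ hc0 hc1 ht hε p + traceOfPair hP ρ hρ hc0 hc1 ht hε q := by
  refine Subtype.ext ?_
  show _ = (traceOfPair hP ρ hρ hc0 hc1 ht hε p : QAlg P →ₗ[ℂ] ℂ) +
    (traceOfPair hP ρ hρ hc0 hc1 ht hε q : QAlg P →ₗ[ℂ] ℂ)
  rw [coe_traceOfPair, coe_traceOfPair, coe_traceOfPair, ← LinearMap.add_comp]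
  congr 1
  rw [traceFunctional, traceFunctional, traceFunctional, add_add_add_comm,
    ← weightFunctional_add, ← atomFunctional_add]
  congr 1
  refine LinearMap.ext fun R => ?_
  rw [weightFunctional_apply, weightFunctional_apply, ← Polynomial.map_add]
  rfl

theorem traceOfPair_smul {a : ℝ} (ha : 0 < a)
    (p : polynomialCone (openStripRootCount P) t ε × (Fin (boundaryRootCount P) → ℝ≥0)) :
    (traceOfPair hP ρ hρ hc0 hc1 ht hε
      (⟨a • (p.1 : ℝ[X]), (polynomialCone (openStripRootCount P) t ε).smul_mem ha p.1.2⟩,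
        a.toNNReal • p.2) : QAlg P →ₗ[ℂ] ℂ) =
      a • (traceOfPair hP ρ hρ hc0 hc1 ht hε p : QAlg P →ₗ[ℂ] ℂ) := by
  rw [coe_traceOfPair, coe_traceOfPair, ← Complex.coe_smul, ← LinearMap.smul_comp]
  congr 1
  rw [traceFunctional, traceFunctional, smul_add, atomFunctional_smul, ← weightFunctional_smul,
    Real.coe_toNNReal a ha.le]
  congr 1
  refine LinearMap.ext fun R => ?_
  rw [weightFunctional_apply, weightFunctional_apply]
  congr 3
  rw [Polynomial.map_smul]
  rfl

theorem traceOfPair_injective : Function.Injective (traceOfPair hP ρ hρ hc0 hc1 ht hε) := by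
  intro p q h
  have h1 := congrArg (fun T : positiveTraceCone ρ t => (T : QAlg P →ₗ[ℂ] ℂ)) h
  simp only [coe_traceOfPair] at h1
  have h2 := traceFunctional_injective hc0 hc1 hP.ne_zero (isWeightNumerator_of_mem ht p.1)
    (isWeightNumerator_of_mem ht q.1) (m := p.2) (k := q.2) (LinearMap.ext fun R => by
      have h3 := LinearMap.congr_fun h1 (ofPoly P R)
      simpa only [LinearMap.comp_apply, weightZero_ofPoly] using h3)
  exact Prod.ext (Subtype.ext h2.1) h2.2

theorem traceOfPair_surjective : Function.Surjective (traceOfPair hP ρ hρ hc0 hc1 ht hε) := by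
  intro T
  obtain ⟨G, hG, m, hG0, hpos, hneg, h⟩ := exists_traceFunctional_eq hc0 hc1 ρ hP hε
    (ht ▸ T.2.1.isTwisted) T.2.2.2.isPositivePair
  have hG' := isWeightNumerator_map_iff.1 hG
  refine ⟨(⟨G, hG0, hG'.1, fun h1 => hG'.2 ((exp_eq_one_iff hc0 hc1).1 ?_), hpos, hneg⟩, m),
    Subtype.ext (LinearMap.ext fun a => ?_)⟩
  · rw [← ht, h1, Units.val_one]
  · rw [coe_traceOfPair, LinearMap.comp_apply, h, T.2.1.eq_weightZero]
    rfl

end Equivalence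

end QAlg

end

/-- Every conjugation `ρ` with `ρ² = g_t` is covered: then `|t| = 1`, so `t = exp(2πic)` for a unique
`c ∈ [0,1)`, and `λ = ε |λ| i^{-n} exp(-πic)` for a unique sign `ε`, so that `ρ` is `ρ_+` or `ρ_-`
according to `ε = 1` or `ε = -1`. -/
theorem mainTheorem2 (P : ℂ[X]) (hP : P.Monic) (t : ℂˣ)
    (ρ : QAlg.Conjugation P) (hρ : ∀ a : QAlg P, ρ (ρ a) = QAlg.gt P t a)
    (c : ℝ) (hc0 : 0 ≤ c) (hc1 : c < 1)
    (ht : (t : ℂ) = Complex.exp (2 * Real.pi * Complex.I * c))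
    (ε : ℤˣ)
    (hε : (ρ.lam : ℂ) = ((ε : ℤ) : ℂ) * (‖(ρ.lam : ℂ)‖ : ℂ) *
      (Complex.I ^ P.natDegree)⁻¹ * Complex.exp (-(Real.pi * Complex.I * c))) :
    ∃ e : QAlg.positiveTraceCone ρ t ≃+
        (polynomialCone (openStripRootCount P) t ε × (Fin (boundaryRootCount P) → ℝ≥0)),
      ∀ (a : ℝ) (ha : 0 < a) (T : QAlg.positiveTraceCone ρ t),
        ((e ⟨a • (T : QAlg P →ₗ[ℂ] ℂ),
            (QAlg.positiveTraceCone ρ t).smul_mem ha T.2⟩).1 : ℝ[X]) = a • ((e T).1 : ℝ[X]) ∧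
        (e ⟨a • (T : QAlg P →ₗ[ℂ] ℂ),
            (QAlg.positiveTraceCone ρ t).smul_mem ha T.2⟩).2 = a.toNNReal • (e T).2 := by
  let Θ : (polynomialCone (openStripRootCount P) t ε × (Fin (boundaryRootCount P) → ℝ≥0)) →ₙ+
      QAlg.positiveTraceCone ρ t :=
    ⟨QAlg.traceOfPair hP ρ hρ hc0 hc1 ht hε, QAlg.traceOfPair_add hP ρ hρ hc0 hc1 ht hε⟩
  let e := (AddEquiv.ofBijective Θ ⟨QAlg.traceOfPair_injective hP ρ hρ hc0 hc1 ht hε,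
    QAlg.traceOfPair_surjective hP ρ hρ hc0 hc1 ht hε⟩).symm
  refine ⟨e, fun a ha T => ?_⟩
  obtain ⟨p, rfl⟩ := e.symm.surjective T
  have h : (⟨a • (e.symm p : QAlg P →ₗ[ℂ] ℂ), (QAlg.positiveTraceCone ρ t).smul_mem ha
      (e.symm p).2⟩ : QAlg.positiveTraceCone ρ t) = e.symm
        (⟨a • (p.1 : ℝ[X]), (polynomialCone (openStripRootCount P) t ε).smul_mem ha p.1.2⟩,
          a.toNNReal • p.2) :=
    Subtype.ext (QAlg.traceOfPair_smul hP ρ hρ hc0 hc1 ht hε ha p).symm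
  rw [h, AddEquiv.apply_symm_apply, AddEquiv.apply_symm_apply]
  exact ⟨rfl, rfl⟩
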